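/- Let $n\in\mathbb N$ and let $H:\mathbb R^n\to[0,\infty)$ be a norm that is of class $C^2$ on $\mathbb R^n\setminus\{0\}$ and such that $H^2$ is strictly convex. Let $$H_0(x)=\sup_{\xi\neq 0}\frac{\langle x,\xi\rangle}{H(\xi)}\qquad(x\in\mathbb R^n)$$ be its dual norm, and put, for $\xi,x\in\mathbb R^n$ and $\eta,y\in\mathbb R$, $$\Phi(\xi,\eta)=\sqrt{H(\xi)^2+\eta^2},\qquad \Phi_0(x,y)=\sqrt{H_0(x)^2+y^2}.$$ Write $z=(x,y)$ and $\mathbb R^{n+1}_+=\{(x,y)\in\mathbb R^n\times\mathbb R: y>0\}$. Let $\alpha\in(-1,1)$ and $2-\alpha\le b<n+1$. Then for every $u\in C_0^\infty(\mathbb R^{n+1})$ the three integrals below are finite and $$K(n,\alpha,b)\int_{\mathbb R^n}\frac{u^2(x,0)}{H_0^{1-\alpha}(x)}\,dx+\frac{(\alpha+b-2)^2}{4}\int_{\mathbb R^{n+1}_+}\frac{y^\alpha u^2(z)}{\Phi_0^2(z)}\,dz\le\int_{\mathbb R^{n+1}_+}y^\alpha\,\Phi^2(\nabla u)\,dz,$$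 where $$K(n,\alpha,b)=(1-\alpha)\,\frac{\Gamma\left(\frac{n-2\alpha-b+3}{4}\right)\Gamma\left(\frac{n+b-1}{4}\right)\Gamma\left(\frac{\alpha+1}{2}\right)}{\Gamma\left(\frac{3-\alpha}{2}\right)\Gamma\left(\frac{n+1-b}{4}\right)\Gamma\left(\frac{n+2\alpha+b-3}{4}\right)}.$$ The constant $K(n,\alpha,b)$ is optimal: if $C\in\mathbb R$ is such that the inequality with $C$ in place of $K(n,\alpha,b)$ holds for all $u\in C_0^\infty(\mathbb R^{n+1})$, then $C\le K(n,\alpha,b)$. -/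

import Mathlib

open MeasureTheory
open scoped ContDiff RealInnerProductSpace

namespace FinslerHardy

/-- A norm `H` on `ℝⁿ` (a seminorm vanishing only at the origin) that is of class `C²` away from
the origin and whose square is strictly convex. -/
structure IsFinslerNorm {n : ℕ} (H : Seminorm ℝ (EuclideanSpace ℝ (Fin n))) : Prop where
  definite : ∀ ξ, H ξ = 0 → ξ = 0
  contDiffOn : ContDiffOn ℝ 2 (fun ξ => H ξ) {0}ᶜ
  strictConvexOn_sq : StrictConvexOn ℝ Set.univ (fun ξ => H ξ ^ 2)

/-- The dual norm `H₀(x) = sup_{ξ ≠ 0} ⟨x, ξ⟩ / H(ξ)`. -/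
noncomputable def dualNorm {n : ℕ} (H : Seminorm ℝ (EuclideanSpace ℝ (Fin n)))
    (x : EuclideanSpace ℝ (Fin n)) : ℝ :=
  ⨆ ξ : {ξ : EuclideanSpace ℝ (Fin n) // ξ ≠ 0}, ⟪x, (ξ : EuclideanSpace ℝ (Fin n))⟫ / H ξ

/-- The norm `Φ(ξ, η) = √(H(ξ)² + η²)` on `ℝⁿ⁺¹ = ℝⁿ × ℝ`. -/
noncomputable def Phi {n : ℕ} (H : Seminorm ℝ (EuclideanSpace ℝ (Fin n)))
    (ζ : EuclideanSpace ℝ (Fin n) × ℝ) : ℝ :=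
  Real.sqrt (H ζ.1 ^ 2 + ζ.2 ^ 2)

/-- The norm `Φ₀(x, y) = √(H₀(x)² + y²)` on `ℝⁿ⁺¹ = ℝⁿ × ℝ`, dual to `Φ`. -/
noncomputable def Phi0 {n : ℕ} (H : Seminorm ℝ (EuclideanSpace ℝ (Fin n)))
    (z : EuclideanSpace ℝ (Fin n) × ℝ) : ℝ :=
  Real.sqrt (dualNorm H z.1 ^ 2 + z.2 ^ 2)

/-- The gradient `∇u = (∇ₓu, ∂u/∂y)` of a function on `ℝⁿ × ℝ`. -/
noncomputable def grad {n : ℕ} (u : EuclideanSpace ℝ (Fin n) × ℝ → ℝ)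
    (z : EuclideanSpace ℝ (Fin n) × ℝ) : EuclideanSpace ℝ (Fin n) × ℝ :=
  (gradient (fun x => u (x, z.2)) z.1, deriv (fun y => u (z.1, y)) z.2)

/-- The upper half space `{(x, y) ∈ ℝⁿ × ℝ : y > 0}`. -/
def upperHalfSpace (n : ℕ) : Set (EuclideanSpace ℝ (Fin n) × ℝ) := {z | 0 < z.2}

/-- The integrand `u(x, 0)² / H₀(x)^(1 - α)` on `ℝⁿ`. -/
noncomputable def traceDensity {n : ℕ} (H : Seminorm ℝ (EuclideanSpace ℝ (Fin n))) (α : ℝ)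
    (u : EuclideanSpace ℝ (Fin n) × ℝ → ℝ) (x : EuclideanSpace ℝ (Fin n)) : ℝ :=
  u (x, 0) ^ 2 / dualNorm H x ^ (1 - α)

/-- The integrand `y^α u(z)² / Φ₀(z)²`, `z = (x, y)`. -/
noncomputable def hardyDensity {n : ℕ} (H : Seminorm ℝ (EuclideanSpace ℝ (Fin n))) (α : ℝ)
    (u : EuclideanSpace ℝ (Fin n) × ℝ → ℝ) (z : EuclideanSpace ℝ (Fin n) × ℝ) : ℝ :=
  z.2 ^ α * u z ^ 2 / Phi0 H z ^ 2

/-- The integrand `y^α Φ(∇u(z))²`, `z = (x, y)`. -/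
noncomputable def energyDensity {n : ℕ} (H : Seminorm ℝ (EuclideanSpace ℝ (Fin n))) (α : ℝ)
    (u : EuclideanSpace ℝ (Fin n) × ℝ → ℝ) (z : EuclideanSpace ℝ (Fin n) × ℝ) : ℝ :=
  z.2 ^ α * Phi H (grad u z) ^ 2

/-- The constant `K(n, α, b)`. -/
noncomputable def K (n : ℕ) (α b : ℝ) : ℝ :=
  (1 - α) *
    (Real.Gamma ((n - 2 * α - b + 3) / 4) * Real.Gamma ((n + b - 1) / 4)
      * Real.Gamma ((α + 1) / 2)) /
    (Real.Gamma ((3 - α) / 2) * Real.Gamma ((n + 1 - b) / 4)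
      * Real.Gamma ((n + 2 * α + b - 3) / 4))

/-- The inequality with constant `C` in front of the boundary term, for the function `u`. -/
def InterpolationInequality {n : ℕ} (H : Seminorm ℝ (EuclideanSpace ℝ (Fin n))) (α b C : ℝ)
    (u : EuclideanSpace ℝ (Fin n) × ℝ → ℝ) : Prop :=
  C * (∫ x, traceDensity H α u x)
      + (α + b - 2) ^ 2 / 4 * (∫ z in upperHalfSpace n, hardyDensity H α u z)
    ≤ ∫ z in upperHalfSpace n, energyDensity H α u z

end FinslerHardy

/-! ### Beta integrals and an Euler integral solving the hypergeometric equation. -/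

namespace FinslerHardy
open Set Filter Topology ProbabilityTheory

/-! The inequality reduces to the quadrant r, y > 0. On a ray x = rσ with H₀(σ) = 1, duality gives
|∂u/∂r| ≤ H(∇ₓu), so Φ(∇u)² dominates (∂u/∂r)² + (∂u/∂y)². In polar coordinates adapted to H₀ it is
therefore enough to prove, ray by ray, a two-dimensional inequality with weight r^(n-1) y^α
(`lintegral_interpolation_inequality`).

In polar coordinates (ρ, θ) of the quadrant that problem separates (`quadrant_inequality`). The
radial derivative obeys a Hardy inequality with constant γ², γ = (n+α-1)/2 (`radial_hardy`). With A
= (n+1-b)/4 and λ = 4A(n/2 - A - (1-α)/2) one has γ² = (γ-2A)² + λ and (γ-2A)² = (α+b-2)²/4. The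
first summand is the Hardy term of the theorem; the second feeds the angular inequality ∫ w (g'² +
λg²) ≥ κ g(0)² with w = sin^α cos^(n-1) (`angular_inequality`). The latter is Jacobi's argument: if
P > 0 solves (wP')' = λwP and the flux wP' vanishes at π/2, completing the square leaves only the
boundary term -(wP'/P)(0) g(0)². As a function of sin²θ, P solves a hypergeometric equation, and its
Euler integral `hypInt` makes positivity, monotonicity and the boundary values explicit. The
resulting quotient of beta functions is K (`angConst_eq_K`).

For optimality (`le_angConst`) the test functions are φ(Φ₀) P(y²/Φ₀²), with φ almost extremal for
the radial Hardy inequality. They lack smoothness in two ways. P is singular at 0, so its argument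
is shifted by δ > 0, which does not increase the angular energy because P is decreasing and P' is
increasing (`angular_energy_le`). H₀ is mollified, which keeps the gradients in the unit ball of H
(`exists_smooth_approx_dualNorm`, `inequality_of_dualNorm`). For functions of (H₀(x), y) all three
integrals carry the same factor `sphereConst`, which cancels. -/

theorem lintegral_rpow_mul_exp_neg_mul_Ioi {a r : ℝ} (ha : 0 < a) (hr : 0 < r) :
    ∫⁻ t in Ioi (0 : ℝ), ENNReal.ofReal (t ^ (a - 1) * Real.exp (-(r * t)))
      = ENNReal.ofReal ((1 / r) ^ a * Real.Gamma a) := by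
  have h := Real.integral_rpow_mul_exp_neg_mul_Ioi ha hr
  have hpos : 0 < (1 / r) ^ a * Real.Gamma a :=
    mul_pos (Real.rpow_pos_of_pos (by positivity) _) (Real.Gamma_pos_of_pos ha)
  rw [← h, ofReal_integral_eq_lintegral_ofReal]
  · by_contra hne
    have := integral_undef hne
    rw [h] at this
    exact hpos.ne' this
  · filter_upwards [ae_restrict_mem measurableSet_Ioi] with t ht
    have : (0 : ℝ) < t := ht
    positivity

/-- After multiplication by Γ(a+b), the power of 1+x is written as a gamma integral in t; Tonelli
then gives Γ(a)Γ(b). Lower integrals make integrability a by-product. -/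
theorem lintegral_rpow_mul_one_add_rpow {a b : ℝ} (ha : 0 < a) (hb : 0 < b) :
    ∫⁻ x in Ioi (0 : ℝ), ENNReal.ofReal (x ^ (a - 1) * (1 + x) ^ (-(a + b)))
      = ENNReal.ofReal (beta a b) := by
  have hab : 0 < a + b := add_pos ha hb
  have hG := Real.Gamma_pos_of_pos hab
  have key : ENNReal.ofReal (Real.Gamma (a + b)) *
      ∫⁻ x in Ioi (0 : ℝ), ENNReal.ofReal (x ^ (a - 1) * (1 + x) ^ (-(a + b)))
      = ENNReal.ofReal (Real.Gamma a * Real.Gamma b) := by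
    rw [← lintegral_const_mul' _ _ ENNReal.ofReal_ne_top]
    calc _ = ∫⁻ x in Ioi (0 : ℝ), ∫⁻ t in Ioi (0 : ℝ),
          ENNReal.ofReal (x ^ (a - 1) * (t ^ (a + b - 1) * Real.exp (-((1 + x) * t)))) := by
          refine setLIntegral_congr_fun measurableSet_Ioi fun x hx => ?_
          have hx : 0 < x := hx
          have h1 : 0 ≤ x ^ (a - 1) := by positivity
          simp_rw [ENNReal.ofReal_mul h1]
          rw [lintegral_const_mul' _ _ ENNReal.ofReal_ne_top,
            lintegral_rpow_mul_exp_neg_mul_Ioi hab (by positivity : 0 < 1 + x),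
            ← ENNReal.ofReal_mul h1, ← ENNReal.ofReal_mul h1, ← ENNReal.ofReal_mul hG.le]
          congr 1
          rw [one_div, Real.inv_rpow (by positivity), Real.rpow_neg (by positivity)]
          ring
      _ = ∫⁻ t in Ioi (0 : ℝ), ∫⁻ x in Ioi (0 : ℝ),
          ENNReal.ofReal (x ^ (a - 1) * (t ^ (a + b - 1) * Real.exp (-((1 + x) * t)))) := by
          refine lintegral_lintegral_swap (Measurable.aemeasurable ?_)
          unfold Function.uncurry
          fun_prop
      _ = ∫⁻ t in Ioi (0 : ℝ),
          ENNReal.ofReal (Real.Gamma a) * ENNReal.ofReal (t ^ (b - 1) * Real.exp (-(1 * t))) := by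
          refine setLIntegral_congr_fun measurableSet_Ioi fun t ht => ?_
          have ht : 0 < t := ht
          have h1 : 0 ≤ t ^ (a + b - 1) * Real.exp (-t) := by positivity
          have h2 : ∀ x : ℝ, x ^ (a - 1) * (t ^ (a + b - 1) * Real.exp (-((1 + x) * t)))
              = t ^ (a + b - 1) * Real.exp (-t) * (x ^ (a - 1) * Real.exp (-(t * x))) := by
            intro x
            rw [show -((1 + x) * t) = -t + -(t * x) by ring, Real.exp_add]; ring
          simp_rw [h2, ENNReal.ofReal_mul h1]
          rw [lintegral_const_mul' _ _ ENNReal.ofReal_ne_top,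
            lintegral_rpow_mul_exp_neg_mul_Ioi ha ht, ← ENNReal.ofReal_mul h1,
            ← ENNReal.ofReal_mul (Real.Gamma_pos_of_pos ha).le]
          congr 1
          rw [one_div, Real.inv_rpow ht.le, show a + b - 1 = (b - 1) + a by ring,
            Real.rpow_add ht]
          have : t ^ a ≠ 0 := (Real.rpow_pos_of_pos ht _).ne'
          field_simp
      _ = _ := by
          rw [lintegral_const_mul' _ _ ENNReal.ofReal_ne_top,
            lintegral_rpow_mul_exp_neg_mul_Ioi hb one_pos,
            ← ENNReal.ofReal_mul (Real.Gamma_pos_of_pos ha).le]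
          simp
  have h0 : ENNReal.ofReal (Real.Gamma (a + b)) ≠ 0 := by simpa using hG
  rw [← ENNReal.mul_right_inj h0 ENNReal.ofReal_ne_top, key, ← ENNReal.ofReal_mul hG.le]
  congr 1
  unfold beta
  field_simp

theorem integrableOn_rpow_mul_one_add_rpow {a b : ℝ} (ha : 0 < a) (hb : 0 < b) :
    IntegrableOn (fun x : ℝ => x ^ (a - 1) * (1 + x) ^ (-(a + b))) (Ioi 0) := by
  refine ⟨Measurable.aestronglyMeasurable (by fun_prop), ?_⟩
  rw [hasFiniteIntegral_iff_ofReal, lintegral_rpow_mul_one_add_rpow ha hb]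
  · exact ENNReal.ofReal_lt_top
  · filter_upwards [ae_restrict_mem measurableSet_Ioi] with t ht
    have : (0 : ℝ) < t := ht
    positivity

theorem integral_rpow_mul_one_add_rpow {a b : ℝ} (ha : 0 < a) (hb : 0 < b) :
    ∫ x in Ioi (0 : ℝ), x ^ (a - 1) * (1 + x) ^ (-(a + b)) = beta a b := by
  rw [integral_eq_lintegral_of_nonneg_ae, lintegral_rpow_mul_one_add_rpow ha hb,
    ENNReal.toReal_ofReal (beta_pos ha hb).le]
  · filter_upwards [ae_restrict_mem measurableSet_Ioi] with t ht
    have : (0 : ℝ) < t := ht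
    positivity
  · exact Measurable.aestronglyMeasurable (by fun_prop)

/-- The integrand of `hypInt`. -/
noncomputable def hypIntegrand (p q r s x : ℝ) : ℝ := x ^ (p - 1) * (1 + x) ^ q * (x + s) ^ (-r)

/-- The Euler type integral `∫₀^∞ x^(p-1) (1+x)^q (x+s)^(-r) dx`. -/
noncomputable def hypInt (p q r s : ℝ) : ℝ := ∫ x in Ioi (0 : ℝ), hypIntegrand p q r s x

theorem measurable_hypIntegrand (p q r s : ℝ) : Measurable (hypIntegrand p q r s) := by
  unfold hypIntegrand; fun_prop

theorem hypIntegrand_pos {p q r s x : ℝ} (hs : 0 ≤ s) (hx : 0 < x) :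
    0 < hypIntegrand p q r s x := by
  unfold hypIntegrand; positivity

theorem hypIntegrand_anti {p q r s t x : ℝ} (hr : 0 ≤ r) (hs : 0 ≤ s) (hst : s ≤ t) (hx : 0 < x) :
    hypIntegrand p q r t x ≤ hypIntegrand p q r s x := by
  unfold hypIntegrand
  have : (x + t) ^ (-r) ≤ (x + s) ^ (-r) :=
    Real.rpow_le_rpow_of_nonpos (by positivity) (by linarith) (by linarith)
  gcongr

/-- The bound x + s ≥ min(s,1)(1+x) reduces this to a beta integral. For s > 0 there is no
singularity of (x+s)^(-r) at the origin, so r may exceed p; the derivatives in s need this. -/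
theorem integrableOn_hypIntegrand {p q r s : ℝ} (hp : 0 < p) (hr : 0 ≤ r) (hpqr : p + q < r)
    (hs : 0 < s) : IntegrableOn (hypIntegrand p q r s) (Ioi 0) := by
  set c := min s 1 with hc
  have hc0 : 0 < c := lt_min hs one_pos
  have hint := (integrableOn_rpow_mul_one_add_rpow hp (b := r - q - p) (by linarith)).const_mul
    (c ^ (-r))
  refine hint.mono' (measurable_hypIntegrand ..).aestronglyMeasurable ?_
  filter_upwards [ae_restrict_mem measurableSet_Ioi] with x hx
  have hx : 0 < x := hx
  rw [Real.norm_of_nonneg (hypIntegrand_pos hs.le hx).le]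
  unfold hypIntegrand
  have h1 : c * (1 + x) ≤ x + s := by
    have := min_le_left s 1
    have := min_le_right s 1
    nlinarith
  have h2 : (x + s) ^ (-r) ≤ c ^ (-r) * (1 + x) ^ (-r) := by
    rw [← Real.mul_rpow hc0.le (by positivity)]
    exact Real.rpow_le_rpow_of_nonpos (by positivity) h1 (by linarith)
  calc x ^ (p - 1) * (1 + x) ^ q * (x + s) ^ (-r)
      ≤ x ^ (p - 1) * (1 + x) ^ q * (c ^ (-r) * (1 + x) ^ (-r)) := by gcongr
    _ = c ^ (-r) * (x ^ (p - 1) * (1 + x) ^ (-(p + (r - q - p)))) := by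
      rw [show -(p + (r - q - p)) = q + -r by ring, Real.rpow_add (by positivity)]; ring

theorem hypIntegrand_zero_right {p q r x : ℝ} (hx : 0 < x) :
    hypIntegrand p q r 0 x = x ^ ((p - r) - 1) * (1 + x) ^ (-((p - r) + (r - p - q))) := by
  unfold hypIntegrand
  rw [add_zero, show (p - r) - 1 = (p - 1) + -r by ring, Real.rpow_add hx,
    show -((p - r) + (r - p - q)) = q by ring]
  ring

theorem integrableOn_hypIntegrand_zero {p q r : ℝ} (hpr : r < p) (hpqr : p + q < r) :
    IntegrableOn (hypIntegrand p q r 0) (Ioi 0) :=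
  (integrableOn_rpow_mul_one_add_rpow (a := p - r) (b := r - p - q) (by linarith)
    (by linarith)).congr_fun (fun _ hx => (hypIntegrand_zero_right hx).symm) measurableSet_Ioi

theorem hypInt_zero_right {p q r : ℝ} (hpr : r < p) (hpqr : p + q < r) :
    hypInt p q r 0 = beta (p - r) (r - p - q) := by
  rw [← integral_rpow_mul_one_add_rpow (by linarith) (by linarith)]
  exact setIntegral_congr_fun measurableSet_Ioi fun _ hx => hypIntegrand_zero_right hx

theorem integrableOn_hypIntegrand_of_nonneg {p q r s : ℝ} (hr : 0 ≤ r) (hrp : r < p)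
    (hpqr : p + q < r) (hs : 0 ≤ s) : IntegrableOn (hypIntegrand p q r s) (Ioi 0) := by
  rcases hs.eq_or_lt with rfl | hs
  · exact integrableOn_hypIntegrand_zero hrp hpqr
  · exact integrableOn_hypIntegrand (by linarith) hr hpqr hs

theorem hypInt_pos_of_integrableOn {p q r s : ℝ} (hs : 0 ≤ s)
    (h : IntegrableOn (hypIntegrand p q r s) (Ioi 0)) : 0 < hypInt p q r s := by
  unfold hypInt
  rw [setIntegral_pos_iff_support_of_nonneg_ae _ h]
  · have : Function.support (hypIntegrand p q r s) ∩ Ioi 0 = Ioi 0 :=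
      inter_eq_right.2 fun x hx => (hypIntegrand_pos hs hx).ne'
    rw [this]; simp
  · filter_upwards [ae_restrict_mem measurableSet_Ioi] with x hx
    exact (hypIntegrand_pos hs hx).le

theorem hypInt_anti {p q r s t : ℝ} (hr : 0 ≤ r) (hs : 0 ≤ s) (hst : s ≤ t)
    (h1 : IntegrableOn (hypIntegrand p q r s) (Ioi 0))
    (h2 : IntegrableOn (hypIntegrand p q r t) (Ioi 0)) : hypInt p q r t ≤ hypInt p q r s :=
  setIntegral_mono_on h2 h1 measurableSet_Ioi fun _ hx => hypIntegrand_anti hr hs hst hx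

/-- The integrand grows as s decreases, so the one at s = 0 dominates; it is of beta type because r
< p. -/
theorem continuousWithinAt_hypInt_zero {p q r : ℝ} (hr : 0 ≤ r) (hrp : r < p)
    (hpqr : p + q < r) : ContinuousWithinAt (hypInt p q r) (Ici 0) 0 := by
  refine tendsto_integral_filter_of_dominated_convergence (hypIntegrand p q r 0) ?_ ?_
    (integrableOn_hypIntegrand_zero hrp hpqr) ?_
  · exact Eventually.of_forall fun s => (measurable_hypIntegrand ..).aestronglyMeasurable
  · filter_upwards [self_mem_nhdsWithin] with s hs
    filter_upwards [ae_restrict_mem measurableSet_Ioi] with x hx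
    rw [Real.norm_of_nonneg (hypIntegrand_pos hs hx).le]
    exact hypIntegrand_anti hr le_rfl hs hx
  · filter_upwards [ae_restrict_mem measurableSet_Ioi] with x hx
    have hx : 0 < x := hx
    refine Tendsto.mono_left (ContinuousAt.tendsto ?_) nhdsWithin_le_nhds
    unfold hypIntegrand
    refine ContinuousAt.mul continuousAt_const ?_
    exact ContinuousAt.rpow_const (by fun_prop) (Or.inl (by simpa using hx.ne'))

/-- Differentiation in s raises r by one and keeps p and q, so the whole family is closed under it.
Near s the derivative is dominated by its value at s/2. -/
theorem hasDerivAt_hypInt {p q r s : ℝ} (hp : 0 < p) (hr : 0 ≤ r) (hpqr : p + q < r)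
    (hs : 0 < s) : HasDerivAt (hypInt p q r) (-r * hypInt p q (r + 1) s) s := by
  have hs2 : 0 < s / 2 := by positivity
  have := hasDerivAt_integral_of_dominated_loc_of_deriv_le (μ := volume.restrict (Ioi (0 : ℝ)))
    (F := fun s x => hypIntegrand p q r s x)
    (F' := fun s x => -r * hypIntegrand p q (r + 1) s x) (x₀ := s) (s := Ioi (s / 2))
    (bound := fun x => r * hypIntegrand p q (r + 1) (s / 2) x)
    (Ioi_mem_nhds (by linarith))
    (Eventually.of_forall fun s => (measurable_hypIntegrand ..).aestronglyMeasurable)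
    (integrableOn_hypIntegrand hp hr hpqr hs)
    ((measurable_hypIntegrand ..).const_mul _).aestronglyMeasurable ?_
    ((integrableOn_hypIntegrand hp (by linarith) (by linarith) hs2).const_mul r) ?_
  · have h := this.2
    rwa [integral_const_mul] at h
  · filter_upwards [ae_restrict_mem measurableSet_Ioi] with x hx t ht
    have ht : s / 2 < t := ht
    rw [norm_mul, norm_neg, Real.norm_of_nonneg hr,
      Real.norm_of_nonneg (hypIntegrand_pos (by linarith) hx).le]
    exact mul_le_mul_of_nonneg_left (hypIntegrand_anti (by linarith) hs2.le ht.le hx) hr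
  · filter_upwards [ae_restrict_mem measurableSet_Ioi] with x hx t ht
    have ht : s / 2 < t := ht
    have hx : 0 < x := hx
    have ht0 : 0 < t := hs2.trans ht
    have h1 : HasDerivAt (fun t => x + t) 1 t := (hasDerivAt_id t).const_add x
    have h2 := (h1.rpow_const (p := -r) (Or.inl (by positivity))).const_mul
      (x ^ (p - 1) * (1 + x) ^ q)
    refine h2.congr_deriv ?_
    unfold hypIntegrand
    rw [show -(r + 1) = -r - 1 by ring]
    ring

theorem contDiffOn_hypInt {p q : ℝ} (hp : 0 < p) (k : ℕ) : ∀ {r : ℝ}, 0 ≤ r → p + q < r →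
    ContDiffOn ℝ k (hypInt p q r) (Ioi 0) := by
  induction k with
  | zero =>
    intro r hr hpqr
    refine contDiffOn_zero.2 fun s hs => ?_
    exact (hasDerivAt_hypInt hp hr hpqr hs).continuousAt.continuousWithinAt
  | succ k ih =>
    intro r hr hpqr
    rw [Nat.cast_succ, contDiffOn_succ_iff_deriv_of_isOpen isOpen_Ioi]
    refine ⟨fun s hs => (hasDerivAt_hypInt hp hr hpqr hs).differentiableAt.differentiableWithinAt,
      by simp, ?_⟩
    refine (contDiffOn_const.mul (ih (r := r + 1) (by linarith) (by linarith))).congr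
      fun s hs => (hasDerivAt_hypInt hp hr hpqr hs).deriv

/-- The hypergeometric differential equation. -/
theorem hypInt_ode {A B C s : ℝ} (hA : 0 < A) (hB : 0 < B) (hBC : B < C) (hs : 0 < s) :
    s * (1 - s) * (A * (A + 1) * hypInt B (A - C) (A + 2) s)
      - ((A + 1 - B) * (1 - s) - C * s) * (A * hypInt B (A - C) (A + 1) s)
      - A * (C - B) * hypInt B (A - C) A s = 0 := by
  -- With Y = `hypInt B (A - C) A`, Y' and Y'' are -A and A(A+1) times the integrals with r = A+1
  -- and r = A+2, so the claim reads s(1-s)Y'' + ((A+1-B)(1-s) - Cs)Y' - A(C-B)Y = 0. The combined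
  -- integrand is the exact derivative of `f`, which vanishes at 0 since B > 0 and at infinity since
  -- it is O(x^(B-C)).
  set f : ℝ → ℝ := fun x => A * (x ^ B * (1 + x) ^ (A + 1 - C) * (x + s) ^ (-A - 1)) with hf
  set f' : ℝ → ℝ := fun x => s * (1 - s) * (A * (A + 1) * hypIntegrand B (A - C) (A + 2) s x)
      - ((A + 1 - B) * (1 - s) - C * s) * (A * hypIntegrand B (A - C) (A + 1) s x)
      - A * (C - B) * hypIntegrand B (A - C) A s x with hf'
  have i0 := integrableOn_hypIntegrand (p := B) (q := A - C) (r := A) hB hA.le (by linarith) hs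
  have i1 := integrableOn_hypIntegrand (p := B) (q := A - C) (r := A + 1) hB (by linarith)
    (by linarith) hs
  have i2 := integrableOn_hypIntegrand (p := B) (q := A - C) (r := A + 2) hB (by linarith)
    (by linarith) hs
  have j2 := (i2.const_mul (A * (A + 1))).const_mul (s * (1 - s))
  have j1 := (i1.const_mul A).const_mul ((A + 1 - B) * (1 - s) - C * s)
  have j0 := i0.const_mul (A * (C - B))
  have hderiv : ∀ x ∈ Ioi (0 : ℝ), HasDerivAt f (f' x) x := by
    intro x hx
    have hx : 0 < x := hx
    have h1 : HasDerivAt (fun x : ℝ => x ^ B) (B * x ^ (B - 1)) x :=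
      Real.hasDerivAt_rpow_const (Or.inl hx.ne')
    have h2 := ((hasDerivAt_id x).const_add 1).rpow_const (p := A + 1 - C)
      (Or.inl (by simp; positivity))
    have h3 := ((hasDerivAt_id x).add_const s).rpow_const (p := -A - 1)
      (Or.inl (by simp; positivity))
    refine (((h1.mul h2).mul h3).const_mul A).congr_deriv ?_
    simp only [hf', hypIntegrand, id, Pi.mul_apply]
    have e1 : x ^ B = x ^ (B - 1) * x := by
      rw [← Real.rpow_add_one hx.ne']; congr 1; ring
    have e2 : (1 + x) ^ (A + 1 - C) = (1 + x) ^ (A - C) * (1 + x) := by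
      rw [← Real.rpow_add_one (by positivity)]; congr 1; ring
    have e3 : (x + s) ^ (-(A + 1)) = (x + s) ^ (-(A + 2)) * (x + s) := by
      rw [← Real.rpow_add_one (by positivity)]; congr 1; ring
    have e4 : (x + s) ^ (-A) = (x + s) ^ (-(A + 2)) * (x + s) * (x + s) := by
      rw [← e3, ← Real.rpow_add_one (by positivity)]; congr 1; ring
    rw [show A + 1 - C - 1 = A - C by ring, show -A - 1 - 1 = -(A + 2) by ring,
      show -A - 1 = -(A + 1) by ring, e1, e2, e4, e3]
    ring
  have hlim : Tendsto f atTop (𝓝 0) := by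
    have hb : ∀ᶠ x : ℝ in atTop, ‖f x‖ ≤ A * 2 ^ |A + 1 - C| * x ^ (-(C - B)) := by
      filter_upwards [eventually_ge_atTop (1 : ℝ)] with x hx
      have hx0 : 0 < x := by linarith
      rw [Real.norm_of_nonneg (by simp only [hf]; positivity)]
      have g1 : (1 + x) ^ (A + 1 - C) ≤ 2 ^ |A + 1 - C| * x ^ (A + 1 - C) := by
        rw [show (1 + x) = (1 + x) / x * x by field_simp, Real.mul_rpow (by positivity) hx0.le]
        gcongr
        have hh : 1 ≤ (1 + x) / x := by rw [le_div_iff₀ hx0]; linarith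
        calc ((1 + x) / x) ^ (A + 1 - C) ≤ ((1 + x) / x) ^ |A + 1 - C| :=
              Real.rpow_le_rpow_of_exponent_le hh (le_abs_self _)
          _ ≤ 2 ^ |A + 1 - C| := by
              gcongr
              rw [div_le_iff₀ hx0]; linarith
      have g2 : (x + s) ^ (-A - 1) ≤ x ^ (-A - 1) :=
        Real.rpow_le_rpow_of_nonpos hx0 (by linarith) (by linarith)
      calc f x ≤ A * (x ^ B * (2 ^ |A + 1 - C| * x ^ (A + 1 - C)) * x ^ (-A - 1)) := by
            simp only [hf]; gcongr
        _ = _ := by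
            rw [show -(C - B) = B + (A + 1 - C) + (-A - 1) by ring, Real.rpow_add hx0,
              Real.rpow_add hx0]; ring
    refine squeeze_zero_norm' hb ?_
    simpa using (tendsto_rpow_neg_atTop (sub_pos.2 hBC)).const_mul (A * 2 ^ |A + 1 - C|)
  have hcont : ContinuousWithinAt f (Ici 0) 0 := by
    have h1 : ContinuousAt (fun x : ℝ => x ^ B) 0 :=
      Real.continuousAt_rpow_const _ _ (Or.inr hB.le)
    have h2 : ContinuousAt (fun x : ℝ => (1 + x) ^ (A + 1 - C)) 0 :=
      ContinuousAt.rpow_const (by fun_prop) (Or.inl (by simp))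
    have h3 : ContinuousAt (fun x : ℝ => (x + s) ^ (-A - 1)) 0 :=
      ContinuousAt.rpow_const (by fun_prop) (Or.inl (by simpa using hs.ne'))
    exact (((h1.mul h2).mul h3).const_mul A).continuousWithinAt
  have := integral_Ioi_of_hasDerivAt_of_tendsto hcont hderiv ((j2.sub j1).sub j0) hlim
  have hf0 : f 0 = 0 := by simp [hf, Real.zero_rpow hB.ne']
  rw [hf0, sub_zero] at this
  rw [← this]
  simp only [hf']
  have k1 := integral_sub (j2.sub j1) j0
  simp only [Pi.sub_apply] at k1
  rw [k1, integral_sub j2 j1]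
  simp only [integral_const_mul, hypInt]

/-- The asymptotics of `hypInt` at `0` in the singular range. -/
theorem tendsto_rpow_mul_hypInt {p q r : ℝ} (hp : 0 < p) (hpr : p < r) (hq : q ≤ 0) :
    Tendsto (fun s => s ^ (r - p) * hypInt p q r s) (𝓝[>] 0) (𝓝 (beta p (r - p))) := by
  have hr : 0 < r := hp.trans hpr
  -- Rescaling x to s·x extracts the power of s exactly; what remains depends on s only through
  -- (1+sx)^q, which is at most 1 because q ≤ 0.
  have hsub : ∀ s : ℝ, 0 < s → s ^ (r - p) * hypInt p q r s
      = ∫ x in Ioi (0 : ℝ), x ^ (p - 1) * (1 + s * x) ^ q * (1 + x) ^ (-r) := by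
    intro s hs
    have h := integral_comp_mul_left_Ioi (hypIntegrand p q r s) 0 hs
    rw [mul_zero] at h
    have h' : hypInt p q r s = s * ∫ x in Ioi (0 : ℝ), hypIntegrand p q r s (s * x) := by
      rw [h, smul_eq_mul]; unfold hypInt; field_simp
    rw [h', ← mul_assoc, ← integral_const_mul]
    refine setIntegral_congr_fun measurableSet_Ioi fun x hx => ?_
    have hx : 0 < x := hx
    simp only [hypIntegrand]
    rw [show s * x + s = s * (1 + x) by ring, Real.mul_rpow hs.le hx.le,
      Real.mul_rpow hs.le (by positivity)]
    have : s ^ (r - p) * s * (s ^ (p - 1) * s ^ (-r)) = 1 := by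
      rw [← Real.rpow_add_one hs.ne', ← Real.rpow_add hs, ← Real.rpow_add hs]
      rw [show r - p + 1 + (p - 1 + -r) = 0 by ring, Real.rpow_zero]
    linear_combination (x ^ (p - 1) * (1 + s * x) ^ q * (1 + x) ^ (-r)) * this
  rw [← integral_rpow_mul_one_add_rpow hp (sub_pos.2 hpr)]
  refine Tendsto.congr' (f₁ := fun s =>
    ∫ x in Ioi (0 : ℝ), x ^ (p - 1) * (1 + s * x) ^ q * (1 + x) ^ (-r)) ?_ ?_
  · filter_upwards [self_mem_nhdsWithin] with s hs using (hsub s hs).symm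
  · refine tendsto_integral_filter_of_dominated_convergence _ ?_ ?_
      (integrableOn_rpow_mul_one_add_rpow hp (sub_pos.2 hpr)) ?_
    · exact Eventually.of_forall fun s => Measurable.aestronglyMeasurable (by fun_prop)
    · filter_upwards [self_mem_nhdsWithin] with s hs
      filter_upwards [ae_restrict_mem measurableSet_Ioi] with x hx
      have hx : 0 < x := hx
      have hs : 0 < s := hs
      rw [Real.norm_of_nonneg (by positivity), show -(p + (r - p)) = -r by ring]
      have : (1 + s * x) ^ q ≤ 1 :=
        Real.rpow_le_one_of_one_le_of_nonpos (by nlinarith [mul_pos hs hx]) hq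
      calc x ^ (p - 1) * (1 + s * x) ^ q * (1 + x) ^ (-r)
          ≤ x ^ (p - 1) * 1 * (1 + x) ^ (-r) := by gcongr
        _ = _ := by ring
    · filter_upwards [ae_restrict_mem measurableSet_Ioi] with x hx
      have hx : 0 < x := hx
      refine Tendsto.mono_left ?_ nhdsWithin_le_nhds
      have : ContinuousAt (fun s : ℝ => x ^ (p - 1) * (1 + s * x) ^ q * (1 + x) ^ (-r)) 0 := by
        refine ContinuousAt.mul (ContinuousAt.mul continuousAt_const ?_) continuousAt_const
        exact ContinuousAt.rpow_const (by fun_prop) (Or.inl (by simp))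
      have h := this.tendsto
      simpa [show -(p + (r - p)) = -r by ring] using h

end FinslerHardy

/-! ### The angular problem: extremal profile, sharp inequality, energy of its shifts. -/

namespace FinslerHardy
open Set Filter Topology ProbabilityTheory

/-- The weight `sin^α θ cos^(n-1) θ` of the angular problem. -/
noncomputable def angWeight (n : ℕ) (α θ : ℝ) : ℝ := Real.sin θ ^ α * Real.cos θ ^ (n - 1)

/-- The profile of the extremal function of the angular problem, as a function of `sin² θ`. -/
noncomputable def angProfile (n : ℕ) (α A : ℝ) : ℝ → ℝ := hypInt (A + (1 - α) / 2) (A - n / 2) A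

/-- The derivative of `angProfile`. -/
noncomputable def angProfileDeriv (n : ℕ) (α A : ℝ) (s : ℝ) : ℝ :=
  -A * hypInt (A + (1 - α) / 2) (A - n / 2) (A + 1) s

/-- Half of the flux `angWeight · (angProfile ∘ sin²)'`. -/
noncomputable def angFlux (n : ℕ) (α A θ : ℝ) : ℝ :=
  Real.sin θ ^ (α + 1) * Real.cos θ ^ n * angProfileDeriv n α A (Real.sin θ ^ 2)

/-- The optimal constant of the angular problem. -/
noncomputable def angConst (n : ℕ) (α A : ℝ) : ℝ :=
  2 * A * beta (A + (1 - α) / 2) ((1 + α) / 2) / beta ((1 - α) / 2) (n / 2 - (A + (1 - α) / 2))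

/-- The admissible range of the parameters of the angular problem. -/
structure AngParams (n : ℕ) (α A : ℝ) : Prop where
  one_le : 1 ≤ n
  neg_one_lt : -1 < α
  lt_one : α < 1
  pos : 0 < A
  lt : A + (1 - α) / 2 < n / 2

variable {n : ℕ} {α A : ℝ}

theorem sin_pos_of_mem_Ioo {θ : ℝ} (hθ : θ ∈ Ioo 0 (Real.pi / 2)) : 0 < Real.sin θ :=
  Real.sin_pos_of_pos_of_lt_pi hθ.1 (by linarith [hθ.2, Real.pi_pos])

theorem cos_pos_of_mem_Ioo {θ : ℝ} (hθ : θ ∈ Ioo 0 (Real.pi / 2)) : 0 < Real.cos θ :=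
  Real.cos_pos_of_mem_Ioo ⟨by linarith [hθ.1, Real.pi_pos], hθ.2⟩

theorem angWeight_nonneg (n : ℕ) (α : ℝ) {θ : ℝ} (hθ : θ ∈ Ioo 0 (Real.pi / 2)) :
    0 ≤ angWeight n α θ := by
  have := sin_pos_of_mem_Ioo hθ
  have := cos_pos_of_mem_Ioo hθ
  unfold angWeight
  positivity

theorem measurable_angWeight (n : ℕ) (α : ℝ) : Measurable (angWeight n α) := by
  unfold angWeight; fun_prop

theorem continuousOn_angWeight (n : ℕ) (α : ℝ) :
    ContinuousOn (angWeight n α) (Ioo 0 (Real.pi / 2)) := by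
  unfold angWeight
  refine ContinuousOn.mul ?_ (by fun_prop)
  exact Real.continuous_sin.continuousOn.rpow_const fun θ hθ => Or.inl (sin_pos_of_mem_Ioo hθ).ne'

namespace AngParams

theorem pos' (h : AngParams n α A) : 0 < A + (1 - α) / 2 := by linarith [h.pos, h.lt_one]

theorem hasDerivAt_angProfile (h : AngParams n α A) {s : ℝ} (hs : 0 < s) :
    HasDerivAt (angProfile n α A) (angProfileDeriv n α A s) s :=
  hasDerivAt_hypInt h.pos' h.pos.le (by linarith [h.lt, h.pos]) hs

theorem hasDerivAt_angProfileDeriv (h : AngParams n α A) {s : ℝ} (hs : 0 < s) :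
    HasDerivAt (angProfileDeriv n α A)
      (A * (A + 1) * hypInt (A + (1 - α) / 2) (A - n / 2) (A + 2) s) s := by
  have := (hasDerivAt_hypInt (q := A - n / 2) (r := A + 1) h.pos' (by linarith [h.pos])
    (by linarith [h.lt, h.pos]) hs).const_mul (-A)
  refine this.congr_deriv ?_
  rw [show A + 1 + 1 = A + 2 by ring]; ring

theorem contDiffAt_angProfile (h : AngParams n α A) {s : ℝ} (hs : 0 < s) :
    ContDiffAt ℝ ∞ (angProfile n α A) s :=
  contDiffAt_infty.2 fun k => (contDiffOn_hypInt h.pos' k h.pos.le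
    (by linarith [h.lt, h.pos])).contDiffAt (Ioi_mem_nhds hs)

theorem angProfile_pos (h : AngParams n α A) {s : ℝ} (hs : 0 ≤ s) : 0 < angProfile n α A s :=
  hypInt_pos_of_integrableOn hs (integrableOn_hypIntegrand_of_nonneg h.pos.le
    (by linarith [h.lt_one]) (by linarith [h.lt]) hs)

theorem angProfile_anti (h : AngParams n α A) {s t : ℝ} (hs : 0 ≤ s) (hst : s ≤ t) :
    angProfile n α A t ≤ angProfile n α A s :=
  hypInt_anti h.pos.le hs hst
    (integrableOn_hypIntegrand_of_nonneg h.pos.le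
      (by linarith [h.lt_one]) (by linarith [h.lt]) hs)
    (integrableOn_hypIntegrand_of_nonneg h.pos.le
      (by linarith [h.lt_one]) (by linarith [h.lt]) (hs.trans hst))

theorem angProfileDeriv_nonpos (h : AngParams n α A) {s : ℝ} (hs : 0 < s) :
    angProfileDeriv n α A s ≤ 0 := by
  have := hypInt_pos_of_integrableOn hs.le (integrableOn_hypIntegrand (r := A + 1)
    (q := A - n / 2) h.pos' (by linarith [h.pos]) (by linarith [h.lt]) hs)
  unfold angProfileDeriv
  nlinarith [h.pos]

/-- The integral with r = A+1 decreases in s and carries the factor -A. Together with the negative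
sign of the derivative, this makes its square decrease in s. -/
theorem angProfileDeriv_mono (h : AngParams n α A) {s t : ℝ} (hs : 0 < s) (hst : s ≤ t) :
    angProfileDeriv n α A s ≤ angProfileDeriv n α A t := by
  have hA := h.pos
  have := hypInt_anti (r := A + 1) (by linarith) hs.le hst
    (integrableOn_hypIntegrand (q := A - n / 2) h.pos' (by linarith) (by linarith [h.lt]) hs)
    (integrableOn_hypIntegrand (q := A - n / 2) h.pos' (by linarith) (by linarith [h.lt])
      (hs.trans_le hst))
  unfold angProfileDeriv
  nlinarith

theorem tendsto_angProfile_zero (h : AngParams n α A) :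
    Tendsto (angProfile n α A) (𝓝[≥] 0) (𝓝 (angProfile n α A 0)) :=
  continuousWithinAt_hypInt_zero h.pos.le (by linarith [h.lt_one]) (by linarith [h.lt])

theorem angProfile_zero (h : AngParams n α A) :
    angProfile n α A 0 = beta ((1 - α) / 2) (n / 2 - (A + (1 - α) / 2)) := by
  unfold angProfile
  rw [hypInt_zero_right (by linarith [h.lt_one]) (by linarith [h.lt])]
  congr 1 <;> ring

/-- This is the hypergeometric equation after the substitution s = sin²θ, that is, (wP')' = λwP. The
factor 2 from the derivative of sin² is left out of `angFlux`, hence the half flux. -/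
theorem hasDerivAt_angFlux (h : AngParams n α A) {θ : ℝ} (hθ : θ ∈ Ioo 0 (Real.pi / 2)) :
    HasDerivAt (angFlux n α A) (2 * angWeight n α θ * (A * (n / 2 - (A + (1 - α) / 2)))
      * angProfile n α A (Real.sin θ ^ 2)) θ := by
  have hs := sin_pos_of_mem_Ioo hθ
  have hs2 : 0 < Real.sin θ ^ 2 := by positivity
  have h1 := (Real.hasDerivAt_sin θ).rpow_const (p := α + 1) (Or.inl hs.ne')
  have h2 := (Real.hasDerivAt_cos θ).pow n
  have h3 := (h.hasDerivAt_angProfileDeriv hs2).comp θ ((Real.hasDerivAt_sin θ).pow 2)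
  have ode := hypInt_ode h.pos h.pos' h.lt hs2
  refine ((h1.mul h2).mul h3).congr_deriv ?_
  obtain ⟨k, rfl⟩ : ∃ k, n = k + 1 := ⟨n - 1, by have := h.one_le; omega⟩
  simp only [angWeight, angProfile, angProfileDeriv, Function.comp, Pi.mul_apply, Pi.pow_apply,
    Nat.add_sub_cancel] at ode ⊢
  rw [show α + 1 - 1 = α by ring, Real.rpow_add_one hs.ne']
  set S := Real.sin θ
  set c := Real.cos θ
  have hc : c ^ 2 = 1 - S ^ 2 := by linarith [Real.sin_sq_add_cos_sq θ]
  set Y := hypInt (A + (1 - α) / 2) (A - ↑(k + 1) / 2) A (S ^ 2)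
  set Y1 := hypInt (A + (1 - α) / 2) (A - ↑(k + 1) / 2) (A + 1) (S ^ 2)
  set Y2 := hypInt (A + (1 - α) / 2) (A - ↑(k + 1) / 2) (A + 2) (S ^ 2)
  rw [← hc] at ode
  push_cast
  push_cast at ode
  have e : c ^ (k + 1) = c ^ k * c := pow_succ ..
  rw [e]
  simp only [pow_one]
  linear_combination (2 * S ^ α * c ^ k) * ode

theorem tendsto_sin_sq_zero : Tendsto (fun θ => Real.sin θ ^ 2) (𝓝[>] 0) (𝓝[>] 0) := by
  refine tendsto_nhdsWithin_iff.2 ⟨?_, ?_⟩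
  · have : ContinuousAt (fun θ => Real.sin θ ^ 2) 0 := by fun_prop
    simpa using this.tendsto.mono_left nhdsWithin_le_nhds
  · filter_upwards [Ioo_mem_nhdsGT (show (0 : ℝ) < Real.pi / 2 by positivity)] with θ hθ
    exact pow_pos (sin_pos_of_mem_Ioo hθ) 2

/-- The derivative of the profile blows up like s^(-(1+α)/2) at s = 0, exactly compensating
sin^(α+1). The nonzero limit is the numerator of the sharp constant, up to the factor -2. -/
theorem tendsto_angFlux_zero (h : AngParams n α A) :
    Tendsto (angFlux n α A) (𝓝[>] 0)
      (𝓝 (-(A * beta (A + (1 - α) / 2) ((1 + α) / 2)))) := by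
  have h1 := (tendsto_rpow_mul_hypInt (p := A + (1 - α) / 2) (q := A - n / 2) (r := A + 1)
    h.pos' (by linarith [h.neg_one_lt]) (by linarith [h.lt, h.lt_one])).comp tendsto_sin_sq_zero
  rw [show A + 1 - (A + (1 - α) / 2) = (1 + α) / 2 by ring] at h1
  have h2 : Tendsto (fun θ => Real.cos θ ^ n) (𝓝[>] 0) (𝓝 1) := by
    have : ContinuousAt (fun θ => Real.cos θ ^ n) 0 := by fun_prop
    simpa using this.tendsto.mono_left nhdsWithin_le_nhds
  have h3 := (h1.mul h2).const_mul (-A)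
  rw [mul_one] at h3
  rw [← neg_mul]
  refine h3.congr' ?_
  filter_upwards [Ioo_mem_nhdsGT (show (0 : ℝ) < Real.pi / 2 by positivity)] with θ hθ
  have hs := sin_pos_of_mem_Ioo hθ
  simp only [angFlux, angProfileDeriv, Function.comp]
  rw [← Real.rpow_natCast (Real.sin θ) 2, ← Real.rpow_mul hs.le]
  rw [show ((2 : ℕ) : ℝ) * ((1 + α) / 2) = α + 1 by push_cast; ring]
  ring

theorem tendsto_angFlux_pi_div_two (h : AngParams n α A) :
    Tendsto (angFlux n α A) (𝓝 (Real.pi / 2)) (𝓝 0) := by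
  have hc : ContinuousAt (angFlux n α A) (Real.pi / 2) := by
    unfold angFlux
    refine ContinuousAt.mul (ContinuousAt.mul ?_ (by fun_prop)) ?_
    · exact ContinuousAt.rpow_const (by fun_prop) (Or.inl (by simp))
    · refine ContinuousAt.comp (g := angProfileDeriv n α A) (f := fun θ => Real.sin θ ^ 2) ?_
        (by fun_prop)
      exact (h.hasDerivAt_angProfileDeriv (by simp)).continuousAt
  have h0 : angFlux n α A (Real.pi / 2) = 0 := by
    have : n ≠ 0 := by have := h.one_le; omega
    simp [angFlux, this]
  simpa [h0] using hc.tendsto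

theorem tendsto_angProfile_sin_sq_zero (h : AngParams n α A) :
    Tendsto (fun θ => angProfile n α A (Real.sin θ ^ 2)) (𝓝[>] 0) (𝓝 (angProfile n α A 0)) :=
  h.tendsto_angProfile_zero.comp
    (tendsto_sin_sq_zero.mono_right (nhdsWithin_mono _ Ioi_subset_Ici_self))

theorem hasDerivAt_angProfile_sin_sq (h : AngParams n α A) {θ : ℝ}
    (hθ : 0 < Real.sin θ ^ 2) :
    HasDerivAt (fun θ => angProfile n α A (Real.sin θ ^ 2))
      (angProfileDeriv n α A (Real.sin θ ^ 2) * (2 * Real.sin θ * Real.cos θ)) θ := by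
  have := (h.hasDerivAt_angProfile hθ).comp θ ((Real.hasDerivAt_sin θ).pow 2)
  refine this.congr_deriv ?_
  simp

theorem angConst_eq (h : AngParams n α A) :
    angConst n α A
      = 2 * (A * beta (A + (1 - α) / 2) ((1 + α) / 2)) / angProfile n α A 0 := by
  rw [h.angProfile_zero, angConst, mul_assoc]

theorem tendsto_half_pi_sub :
    Tendsto (fun ε : ℝ => Real.pi / 2 - ε) (𝓝[>] 0) (𝓝 (Real.pi / 2)) := by
  have : ContinuousAt (fun ε : ℝ => Real.pi / 2 - ε) 0 := by fun_prop
  simpa using this.tendsto.mono_left nhdsWithin_le_nhds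

theorem eventually_lt_pi_div_four : ∀ᶠ ε : ℝ in 𝓝[>] 0, ε ∈ Ioo 0 (Real.pi / 4) :=
  Ioo_mem_nhdsGT (by positivity)

theorem Icc_subset_Ioo_of_lt_pi_div_four {ε : ℝ} (hε : ε ∈ Ioo 0 (Real.pi / 4)) :
    Icc ε (Real.pi / 2 - ε) ⊆ Ioo 0 (Real.pi / 2) :=
  fun _ hθ => ⟨hε.1.trans_le hθ.1, hθ.2.trans_lt (by linarith [hε.1])⟩

/-- The sharp trace inequality on the quarter circle. -/
theorem angular_inequality (h : AngParams n α A) {g g' : ℝ → ℝ}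
    (hg : ∀ θ, HasDerivAt g (g' θ) θ) (hg' : Continuous g') :
    ENNReal.ofReal (angConst n α A * g 0 ^ 2) ≤ ∫⁻ θ in Ioo 0 (Real.pi / 2),
      ENNReal.ofReal (angWeight n α θ *
        (g' θ ^ 2 + 4 * (A * (n / 2 - (A + (1 - α) / 2))) * g θ ^ 2)) := by
  have hgc : Continuous g := continuous_iff_continuousAt.2 fun θ => (hg θ).continuousAt
  set lam := 4 * (A * (n / 2 - (A + (1 - α) / 2))) with hlam
  have hlam0 : 0 ≤ lam := by
    have := h.pos
    have : 0 ≤ n / 2 - (A + (1 - α) / 2) := by linarith [h.lt]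
    positivity
  set P : ℝ → ℝ := fun θ => angProfile n α A (Real.sin θ ^ 2) with hP
  -- `F` is -(wP'/P)g². Jacobi's identity: f + F' equals the weighted square w(g' - (P'/P)g)²,
  -- whence f ≥ -F'.
  set F : ℝ → ℝ := fun θ => -2 * angFlux n α A θ / P θ * g θ ^ 2 with hF
  set f : ℝ → ℝ := fun θ => angWeight n α θ * (g' θ ^ 2 + lam * g θ ^ 2) with hf
  have hf0 : ∀ θ ∈ Ioo 0 (Real.pi / 2), 0 ≤ f θ := fun θ hθ =>
    mul_nonneg (angWeight_nonneg n α hθ) (by positivity)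
  have hfc : ContinuousOn f (Ioo 0 (Real.pi / 2)) :=
    (continuousOn_angWeight n α).mul (by fun_prop)
  have hP0 : ∀ θ, P θ ≠ 0 := fun θ => (h.angProfile_pos (sq_nonneg _)).ne'
  have hderiv : ∀ θ ∈ Ioo 0 (Real.pi / 2), ∃ F', HasDerivAt F F' θ ∧ -F' ≤ f θ := by
    intro θ hθ
    have hs := sin_pos_of_mem_Ioo hθ
    have h1 := (((h.hasDerivAt_angFlux hθ).const_mul (-2)).div
      (h.hasDerivAt_angProfile_sin_sq (by positivity)) (hP0 θ)).mul ((hg θ).pow 2)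
    refine ⟨_, h1, ?_⟩
    have key : f θ - angWeight n α θ * (g' θ - 2 * Real.sin θ * Real.cos θ
        * angProfileDeriv n α A (Real.sin θ ^ 2) / P θ * g θ) ^ 2 = - (((-2) *
        (2 * angWeight n α θ * (A * (n / 2 - (A + (1 - α) / 2))) * P θ) * P θ
        - -2 * angFlux n α A θ * (angProfileDeriv n α A (Real.sin θ ^ 2) *
        (2 * Real.sin θ * Real.cos θ))) / P θ ^ 2 * g θ ^ 2
        + -2 * angFlux n α A θ / P θ * (2 * g θ * g' θ)) := by
      have hfl : angFlux n α A θ = angWeight n α θ * Real.sin θ * Real.cos θ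
          * angProfileDeriv n α A (Real.sin θ ^ 2) := by
        obtain ⟨k, rfl⟩ : ∃ k, n = k + 1 := ⟨n - 1, by have := h.one_le; omega⟩
        simp only [angFlux, angWeight, Nat.add_sub_cancel]
        rw [Real.rpow_add_one hs.ne', pow_succ]; ring
      rw [hfl]
      simp only [hf, hlam]
      have := hP0 θ
      field_simp
      ring
    have hsq := mul_nonneg (angWeight_nonneg n α hθ) (sq_nonneg (g' θ - 2 * Real.sin θ
      * Real.cos θ * angProfileDeriv n α A (Real.sin θ ^ 2) / P θ * g θ))
    simp only [Pi.pow_apply, Pi.div_apply, Nat.cast_ofNat, Nat.add_one_sub_one, pow_one, hP]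
      at key hsq ⊢
    linarith
  choose! F' hF1 hF2 using hderiv
  -- Profile and weight are controlled only inside the open interval, so the estimate is integrated
  -- over [ε, π/2-ε] and the endpoints are reached through the limits of `F`.
  have hle : ∀ ε ∈ Ioo 0 (Real.pi / 4),
      ENNReal.ofReal (F ε - F (Real.pi / 2 - ε))
        ≤ ∫⁻ θ in Ioo 0 (Real.pi / 2), ENNReal.ofReal (f θ) := by
    intro ε hε
    have hsub := Icc_subset_Ioo_of_lt_pi_div_four hε
    have hab : ε ≤ Real.pi / 2 - ε := by linarith [hε.2]
    have hfi : IntegrableOn f (Icc ε (Real.pi / 2 - ε)) :=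
      (hfc.mono hsub).integrableOn_compact isCompact_Icc
    have h1 := intervalIntegral.sub_le_integral_of_hasDeriv_right_of_le (g := fun θ => -F θ)
      (g' := fun θ => -F' θ) (φ := f) hab
      (fun θ hθ => (hF1 θ (hsub hθ)).continuousAt.continuousWithinAt.neg)
      (fun θ hθ => (hF1 θ (hsub (Ioo_subset_Icc_self hθ))).neg.hasDerivWithinAt) hfi
      (fun θ hθ => hF2 θ (hsub (Ioo_subset_Icc_self hθ)))
    rw [intervalIntegral.integral_of_le hab] at h1
    calc ENNReal.ofReal (F ε - F (Real.pi / 2 - ε))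
        ≤ ENNReal.ofReal (∫ θ in Ioc ε (Real.pi / 2 - ε), f θ) :=
          ENNReal.ofReal_le_ofReal (by linarith)
      _ = ∫⁻ θ in Ioc ε (Real.pi / 2 - ε), ENNReal.ofReal (f θ) := by
          refine ofReal_integral_eq_lintegral_ofReal (hfi.mono_set Ioc_subset_Icc_self) ?_
          filter_upwards [ae_restrict_mem measurableSet_Ioc] with θ hθ
          exact hf0 θ (hsub (Ioc_subset_Icc_self hθ))
      _ ≤ _ := lintegral_mono_set (Ioc_subset_Icc_self.trans hsub)
  refine le_of_tendsto ?_ (eventually_lt_pi_div_four.mono hle)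
  refine (ENNReal.continuous_ofReal.tendsto _).comp ?_
  have t1 : Tendsto F (𝓝[>] 0) (𝓝 (angConst n α A * g 0 ^ 2)) := by
    have := ((h.tendsto_angFlux_zero.const_mul (-2)).div h.tendsto_angProfile_sin_sq_zero
      (h.angProfile_pos le_rfl).ne').mul
      (((hgc.pow 2).tendsto 0).mono_left nhdsWithin_le_nhds)
    rw [show angConst n α A * g 0 ^ 2 = -2 * -(A * beta (A + (1 - α) / 2) ((1 + α) / 2))
      / angProfile n α A 0 * (g ^ 2) 0 by rw [h.angConst_eq]; simp]
    exact this
  have t2 : Tendsto F (𝓝 (Real.pi / 2)) (𝓝 0) := by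
    have hs1 : 0 < Real.sin (Real.pi / 2) ^ 2 := by simp
    have := ((h.tendsto_angFlux_pi_div_two.const_mul (-2)).div
      (h.hasDerivAt_angProfile_sin_sq hs1).continuousAt.tendsto
      (hP0 _)).mul ((hgc.pow 2).tendsto (Real.pi / 2))
    rw [mul_zero, zero_div, zero_mul] at this
    exact this
  simpa using t1.sub (t2.comp tendsto_half_pi_sub)

/-- Shifts of the extremal function are almost optimal in the angular problem. -/
theorem angular_energy_le (h : AngParams n α A) {δ : ℝ} (hδ : 0 ≤ δ) :
    ∫⁻ θ in Ioo 0 (Real.pi / 2), ENNReal.ofReal (angWeight n α θ *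
        ((angProfileDeriv n α A (Real.sin θ ^ 2 + δ) * (2 * Real.sin θ * Real.cos θ)) ^ 2
        + 4 * (A * (n / 2 - (A + (1 - α) / 2))) * angProfile n α A (Real.sin θ ^ 2 + δ) ^ 2))
      ≤ ENNReal.ofReal (angConst n α A * angProfile n α A 0 ^ 2) := by
  set lam := 4 * (A * (n / 2 - (A + (1 - α) / 2))) with hlam
  have hlam0 : 0 ≤ lam := by
    have := h.pos
    have : 0 ≤ n / 2 - (A + (1 - α) / 2) := by linarith [h.lt]
    positivity
  set f : ℝ → ℝ := fun θ => angWeight n α θ *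
        ((angProfileDeriv n α A (Real.sin θ ^ 2) * (2 * Real.sin θ * Real.cos θ)) ^ 2
        + lam * angProfile n α A (Real.sin θ ^ 2) ^ 2) with hf
  -- By the equation, wP'P is a primitive of the energy density of P, so the unshifted energy is a
  -- boundary term.
  set F : ℝ → ℝ := fun θ => 2 * angFlux n α A θ * angProfile n α A (Real.sin θ ^ 2) with hF
  have hf0 : ∀ θ ∈ Ioo 0 (Real.pi / 2), 0 ≤ f θ := fun θ hθ =>
    mul_nonneg (angWeight_nonneg n α hθ) (by positivity)
  have hderiv : ∀ θ ∈ Ioo 0 (Real.pi / 2), HasDerivAt F (f θ) θ := by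
    intro θ hθ
    have hs := sin_pos_of_mem_Ioo hθ
    refine (((h.hasDerivAt_angFlux hθ).const_mul 2).mul
      (h.hasDerivAt_angProfile_sin_sq (by positivity))).congr_deriv ?_
    have hfl : angFlux n α A θ = angWeight n α θ * Real.sin θ * Real.cos θ
        * angProfileDeriv n α A (Real.sin θ ^ 2) := by
      obtain ⟨k, rfl⟩ : ∃ k, n = k + 1 := ⟨n - 1, by have := h.one_le; omega⟩
      simp only [angFlux, angWeight, Nat.add_sub_cancel]
      rw [Real.rpow_add_one hs.ne', pow_succ]; ring
    rw [hfl]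
    simp only [hf, hlam]
    ring
  have hfc : ContinuousOn f (Ioo 0 (Real.pi / 2)) := by
    intro θ hθ
    have hs := sin_pos_of_mem_Ioo hθ
    have h1 := (h.hasDerivAt_angProfile_sin_sq (θ := θ) (by positivity)).continuousAt
    have h2 : ContinuousAt (fun θ => angProfileDeriv n α A (Real.sin θ ^ 2)) θ :=
      ContinuousAt.comp (g := angProfileDeriv n α A) (f := fun θ => Real.sin θ ^ 2)
        (h.hasDerivAt_angProfileDeriv (by positivity)).continuousAt (by fun_prop)
    refine (continuousOn_angWeight n α θ hθ).mul (ContinuousAt.continuousWithinAt ?_)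
    fun_prop
  calc _ ≤ ∫⁻ θ in Ioo 0 (Real.pi / 2), ENNReal.ofReal (f θ) := by
        refine setLIntegral_mono' measurableSet_Ioo fun θ hθ => ENNReal.ofReal_le_ofReal ?_
        have hs := sin_pos_of_mem_Ioo hθ
        have hs2 : 0 < Real.sin θ ^ 2 := by positivity
        simp only [hf]
        refine mul_le_mul_of_nonneg_left ?_ (angWeight_nonneg n α hθ)
        -- P is positive and decreasing, its derivative is nonpositive and increasing: a shift to
        -- the right diminishes both squares pointwise.
        have e1 : angProfileDeriv n α A (Real.sin θ ^ 2 + δ) ^ 2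
            ≤ angProfileDeriv n α A (Real.sin θ ^ 2) ^ 2 := by
          have := h.angProfileDeriv_mono hs2 (show Real.sin θ ^ 2 ≤ Real.sin θ ^ 2 + δ by linarith)
          have := h.angProfileDeriv_nonpos (show 0 < Real.sin θ ^ 2 + δ by linarith)
          nlinarith
        have e2 : angProfile n α A (Real.sin θ ^ 2 + δ) ^ 2
            ≤ angProfile n α A (Real.sin θ ^ 2) ^ 2 := by
          have := h.angProfile_anti hs2.le (show Real.sin θ ^ 2 ≤ Real.sin θ ^ 2 + δ by linarith)
          have := h.angProfile_pos (show 0 ≤ Real.sin θ ^ 2 + δ by linarith)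
          gcongr
        rw [mul_pow, mul_pow (angProfileDeriv n α A (Real.sin θ ^ 2))]
        gcongr
    _ ≤ _ := by
        have hcov := aecover_Ioo_of_Icc (μ := volume) (A := (0 : ℝ)) (B := Real.pi / 2)
          (l := 𝓝[>] (0 : ℝ)) (a := fun ε => ε) (b := fun ε => Real.pi / 2 - ε)
          (tendsto_id.mono_left nhdsWithin_le_nhds) tendsto_half_pi_sub
        have hmeas : AEMeasurable (fun θ => ENNReal.ofReal (f θ))
            (volume.restrict (Ioo 0 (Real.pi / 2))) :=
          (hfc.aemeasurable measurableSet_Ioo).ennreal_ofReal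
        have hlim := hcov.lintegral_tendsto_of_countably_generated hmeas
        have hval : ∀ᶠ ε in 𝓝[>] (0 : ℝ), ENNReal.ofReal (F (Real.pi / 2 - ε) - F ε)
            = ∫⁻ θ in Icc ε (Real.pi / 2 - ε), ENNReal.ofReal (f θ)
              ∂(volume.restrict (Ioo 0 (Real.pi / 2))) := by
          filter_upwards [eventually_lt_pi_div_four] with ε hε
          have hsub := Icc_subset_Ioo_of_lt_pi_div_four hε
          have hab : ε ≤ Real.pi / 2 - ε := by linarith [hε.2]
          have hfi : IntegrableOn f (Icc ε (Real.pi / 2 - ε)) :=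
            (hfc.mono hsub).integrableOn_compact isCompact_Icc
          rw [Measure.restrict_restrict measurableSet_Icc, inter_eq_left.2 hsub,
            ← ofReal_integral_eq_lintegral_ofReal hfi, integral_Icc_eq_integral_Ioc,
            ← intervalIntegral.integral_of_le hab,
            intervalIntegral.integral_eq_sub_of_hasDerivAt]
          · intro θ hθ
            rw [uIcc_of_le hab] at hθ
            exact hderiv θ (hsub hθ)
          · exact (intervalIntegrable_iff_integrableOn_Icc_of_le hab).2 hfi
          · filter_upwards [ae_restrict_mem measurableSet_Icc] with θ hθ
            exact hf0 θ (hsub hθ)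
        have hlim2 := hlim.congr' (hval.mono fun _ => Eq.symm)
        refine (tendsto_nhds_unique hlim2 ?_).le
        refine (ENNReal.continuous_ofReal.tendsto _).comp ?_
        have t1 := (h.tendsto_angFlux_zero.const_mul 2).mul h.tendsto_angProfile_sin_sq_zero
        have t2 := (h.tendsto_angFlux_pi_div_two.const_mul 2).mul
          (h.hasDerivAt_angProfile_sin_sq (θ := Real.pi / 2) (by simp)).continuousAt.tendsto
        have t3 := (t2.comp tendsto_half_pi_sub).sub t1
        have hne := (h.angProfile_pos le_rfl).ne'
        rw [show angConst n α A * angProfile n α A 0 ^ 2 = 2 * 0 *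
          angProfile n α A (Real.sin (Real.pi / 2) ^ 2) - 2 * -(A * beta (A + (1 - α) / 2)
          ((1 + α) / 2)) * angProfile n α A 0 by rw [h.angConst_eq]; field_simp; ring]
        exact t3

end AngParams
end FinslerHardy

/-! ### The weighted Hardy inequality on the half line and its almost extremals. -/

namespace FinslerHardy
open Set Filter Topology ProbabilityTheory

theorem integrableOn_continuous_mul_rpow {f : ℝ → ℝ} (hf : Continuous f) {s : ℝ} (hs : -1 < s)
    {R : ℝ} (hR : 0 ≤ R) : IntegrableOn (fun x => f x * x ^ s) (Icc 0 R) := by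
  have h1 : IntervalIntegrable (fun x : ℝ => x ^ s) volume 0 R :=
    intervalIntegral.intervalIntegrable_rpow' hs
  have h2 := h1.continuousOn_mul (g := f) hf.continuousOn
  exact (intervalIntegrable_iff_integrableOn_Icc_of_le hR).1 h2

/-- The weighted Hardy inequality on the half line. -/
theorem radial_hardy {γ : ℝ} (hγ : 0 < γ) {φ φ' : ℝ → ℝ} (hφ : ∀ ρ, HasDerivAt φ (φ' ρ) ρ)
    (hφ' : Continuous φ') {R : ℝ} (hR : 0 < R) (hsupp : ∀ ρ, R ≤ ρ → φ ρ = 0) :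
    ∫⁻ ρ in Ioi (0 : ℝ), ENNReal.ofReal (γ ^ 2 * φ ρ ^ 2 * ρ ^ (2 * γ - 1))
      ≤ ∫⁻ ρ in Ioi (0 : ℝ), ENNReal.ofReal (φ' ρ ^ 2 * ρ ^ (2 * γ + 1)) := by
  have hc : Continuous φ := continuous_iff_continuousAt.2 fun θ => (hφ θ).continuousAt
  have i1 := integrableOn_continuous_mul_rpow (f := fun ρ => γ ^ 2 * φ ρ ^ 2) (by fun_prop)
    (s := 2 * γ - 1) (by linarith) hR.le
  have i2 := integrableOn_continuous_mul_rpow (f := fun ρ => φ' ρ ^ 2) (by fun_prop)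
    (s := 2 * γ + 1) (by linarith) hR.le
  -- The derivative of γφ²ρ^(2γ) exceeds the difference of the two densities by the square
  -- ρ^(2γ-1)(ρφ' + γφ)². The primitive vanishes at 0 because γ > 0 and at R because φ does.
  have key := intervalIntegral.integral_le_sub_of_hasDeriv_right_of_le hR.le
    (g := fun ρ => γ * φ ρ ^ 2 * ρ ^ (2 * γ))
    (g' := fun ρ => γ * (2 * φ ρ * φ' ρ) * ρ ^ (2 * γ)
      + γ * φ ρ ^ 2 * (2 * γ * ρ ^ (2 * γ - 1)))
    (φ := fun ρ => γ ^ 2 * φ ρ ^ 2 * ρ ^ (2 * γ - 1) - φ' ρ ^ 2 * ρ ^ (2 * γ + 1)) ?_ ?_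
    (i1.sub i2) ?_
  · have hz : φ R = 0 := hsupp R le_rfl
    rw [hz, Real.zero_rpow (by positivity)] at key
    rw [intervalIntegral.integral_of_le hR.le] at key
    have j1 := i1.mono_set Ioc_subset_Icc_self
    have j2 := i2.mono_set Ioc_subset_Icc_self
    rw [integral_sub j1 j2] at key
    calc ∫⁻ ρ in Ioi (0 : ℝ), ENNReal.ofReal (γ ^ 2 * φ ρ ^ 2 * ρ ^ (2 * γ - 1))
        = ∫⁻ ρ in Ioc 0 R, ENNReal.ofReal (γ ^ 2 * φ ρ ^ 2 * ρ ^ (2 * γ - 1)) := by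
          rw [← Ioc_union_Ioi_eq_Ioi hR.le, lintegral_union measurableSet_Ioi
            (Ioc_disjoint_Ioi le_rfl), setLIntegral_congr_fun (g := fun _ => 0) measurableSet_Ioi]
          · simp
          · intro ρ hρ
            simp [hsupp ρ (le_of_lt hρ)]
      _ = ENNReal.ofReal (∫ ρ in Ioc 0 R, γ ^ 2 * φ ρ ^ 2 * ρ ^ (2 * γ - 1)) := by
          refine (ofReal_integral_eq_lintegral_ofReal j1 ?_).symm
          filter_upwards [ae_restrict_mem measurableSet_Ioc] with ρ hρ
          have := hρ.1
          positivity
      _ ≤ ENNReal.ofReal (∫ ρ in Ioc 0 R, φ' ρ ^ 2 * ρ ^ (2 * γ + 1)) :=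
          ENNReal.ofReal_le_ofReal (by linarith)
      _ = ∫⁻ ρ in Ioc 0 R, ENNReal.ofReal (φ' ρ ^ 2 * ρ ^ (2 * γ + 1)) := by
          refine (ofReal_integral_eq_lintegral_ofReal j2 ?_)
          filter_upwards [ae_restrict_mem measurableSet_Ioc] with ρ hρ
          have := hρ.1
          positivity
      _ ≤ _ := lintegral_mono_set Ioc_subset_Ioi_self
  · refine ContinuousOn.mul (by fun_prop) ?_
    exact continuousOn_id.rpow_const fun _ _ => Or.inr (by positivity)
  · intro ρ hρ
    have h1 := (((hφ ρ).pow 2).const_mul γ).mul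
      (Real.hasDerivAt_rpow_const (x := ρ) (p := 2 * γ) (Or.inl hρ.1.ne'))
    refine (h1.congr_deriv ?_).hasDerivWithinAt
    simp
  · intro ρ hρ
    have hρ0 := hρ.1
    have e1 : ρ ^ (2 * γ) = ρ ^ (2 * γ - 1) * ρ := by
      rw [← Real.rpow_add_one hρ0.ne']; congr 1; ring
    have e2 : ρ ^ (2 * γ + 1) = ρ ^ (2 * γ - 1) * ρ ^ 2 := by
      rw [Real.rpow_add_one hρ0.ne', e1]; ring
    rw [e1, e2]
    have : 0 ≤ ρ ^ (2 * γ - 1) * (φ' ρ * ρ + γ * φ ρ) ^ 2 := by positivity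
    nlinarith

/-- With t = log ρ the dilation-invariant Hardy quotient becomes a translation-invariant one on the
line. -/
theorem integral_Ioi_comp_log (f : ℝ → ℝ) :
    ∫ ρ in Ioi (0 : ℝ), f ρ = ∫ t, Real.exp t * f (Real.exp t) := by
  have h := integral_image_eq_integral_abs_deriv_smul (s := univ) (f := Real.exp)
    (f' := Real.exp) MeasurableSet.univ
    (fun x _ => (Real.hasDerivAt_exp x).hasDerivWithinAt) Real.exp_injective.injOn f
  rw [image_univ, Real.range_exp] at h
  rw [h]
  simp [abs_of_pos (Real.exp_pos _)]

/-- A smooth compactly supported function transplanted to the half line, logarithmically. -/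
noncomputable def logTransplant (γ : ℝ) (ψ : ℝ → ℝ) (ρ : ℝ) : ℝ := ρ ^ (-γ) * ψ (Real.log ρ)

theorem logTransplant_eq_zero {γ : ℝ} (hγ : 0 < γ) {ψ : ℝ → ℝ} {M : ℝ}
    (hM : ∀ t, M ≤ |t| → ψ t = 0) {ρ : ℝ} (hρ : |ρ| < Real.exp (-M) ∨ Real.exp M < |ρ|) :
    logTransplant γ ψ ρ = 0 := by
  unfold logTransplant
  rcases eq_or_ne ρ 0 with rfl | h0
  · rw [Real.zero_rpow (by linarith), zero_mul]
  · rw [hM, mul_zero]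
    have hpos : 0 < |ρ| := abs_pos.2 h0
    rw [← Real.log_abs ρ]
    rcases hρ with h | h
    · have := (Real.log_lt_iff_lt_exp hpos).2 h
      exact le_trans (by linarith) (neg_le_abs _)
    · have := (Real.lt_log_iff_exp_lt hpos).2 h
      exact this.le.trans (le_abs_self _)

theorem contDiff_logTransplant {γ : ℝ} (hγ : 0 < γ) {ψ : ℝ → ℝ} (hψ : ContDiff ℝ ∞ ψ) {M : ℝ}
    (hM : ∀ t, M ≤ |t| → ψ t = 0) : ContDiff ℝ ∞ (logTransplant γ ψ) := by
  rw [contDiff_iff_contDiffAt]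
  intro ρ
  rcases eq_or_ne ρ 0 with rfl | h0
  · refine (contDiffAt_const (c := (0 : ℝ))).congr_of_eventuallyEq ?_
    have : Metric.ball (0 : ℝ) (Real.exp (-M)) ∈ 𝓝 (0 : ℝ) := Metric.ball_mem_nhds _ (by positivity)
    filter_upwards [this] with ρ hρ
    exact logTransplant_eq_zero hγ hM (Or.inl (by simpa using hρ))
  · exact (Real.contDiffAt_rpow_const_of_ne h0).mul
      (hψ.contDiffAt.comp ρ (Real.contDiffAt_log.2 h0))

theorem deriv_logTransplant {γ : ℝ} {ψ : ℝ → ℝ} (hψ : ContDiff ℝ ∞ ψ) {ρ : ℝ} (hρ : 0 < ρ) :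
    deriv (logTransplant γ ψ) ρ
      = ρ ^ (-γ - 1) * (deriv ψ (Real.log ρ) - γ * ψ (Real.log ρ)) := by
  have h1 := Real.hasDerivAt_rpow_const (x := ρ) (p := -γ) (Or.inl hρ.ne')
  have h2 := ((hψ.differentiable (by simp)) (Real.log ρ)).hasDerivAt.comp ρ
    (Real.hasDerivAt_log hρ.ne')
  refine ((h1.mul h2).congr_deriv ?_).deriv
  have : ρ ^ (-γ) = ρ ^ (-γ - 1) * ρ := by
    rw [← Real.rpow_add_one hρ.ne']; congr 1; ring
  simp only [Function.comp, this]
  field_simp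
  ring

theorem integral_logTransplant_sq {γ : ℝ} {ψ : ℝ → ℝ} :
    ∫ ρ in Ioi (0 : ℝ), logTransplant γ ψ ρ ^ 2 * ρ ^ (2 * γ - 1) = ∫ t, ψ t ^ 2 := by
  rw [integral_Ioi_comp_log]
  refine integral_congr_ae (Eventually.of_forall fun t => ?_)
  simp only [logTransplant, Real.log_exp, ← Real.exp_mul, mul_pow, ← Real.exp_nat_mul]
  have : Real.exp t * (Real.exp (((2 : ℕ) : ℝ) * (t * -γ)) * Real.exp (t * (2 * γ - 1))) = 1 := by
    rw [← Real.exp_add, ← Real.exp_add, Real.exp_eq_one_iff]; push_cast; ring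
  linear_combination (ψ t ^ 2) * this

/-- In the variable t the left side is ∫(ψ' - γψ)², and the cross term is the integral of the
derivative of ψ². Hence the Hardy deficit of the transplant is just ∫ψ'². -/
theorem integral_deriv_logTransplant_sq {γ : ℝ} {ψ : ℝ → ℝ} (hψ : ContDiff ℝ ∞ ψ)
    (hc : HasCompactSupport ψ) :
    ∫ ρ in Ioi (0 : ℝ), deriv (logTransplant γ ψ) ρ ^ 2 * ρ ^ (2 * γ + 1)
      = (∫ t, deriv ψ t ^ 2) + γ ^ 2 * ∫ t, ψ t ^ 2 := by
  have hd : Continuous (deriv ψ) := hψ.continuous_deriv (by simp)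
  have hψc := hψ.continuous
  have i1 : Integrable fun t => deriv ψ t ^ 2 := by
    refine Continuous.integrable_of_hasCompactSupport (by fun_prop) ?_
    exact hc.deriv.comp_left (g := fun x : ℝ => x ^ 2) (by simp)
  have i2 : Integrable fun t => ψ t ^ 2 := by
    refine Continuous.integrable_of_hasCompactSupport (by fun_prop) ?_
    exact hc.comp_left (g := fun x : ℝ => x ^ 2) (by simp)
  have i3 : Integrable fun t => 2 * ψ t * deriv ψ t := by
    refine Continuous.integrable_of_hasCompactSupport (by fun_prop) ?_
    exact (hc.deriv).mul_left
  have hz : ∫ t, 2 * ψ t * deriv ψ t = 0 := by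
    refine integral_eq_zero_of_hasDerivAt_of_integrable (f := fun t => ψ t ^ 2) ?_ i3 i2
    intro t
    refine (((hψ.differentiable (by simp)) t).hasDerivAt.pow 2).congr_deriv ?_
    simp
  have e : ∫ ρ in Ioi (0 : ℝ), deriv (logTransplant γ ψ) ρ ^ 2 * ρ ^ (2 * γ + 1)
      = ∫ t, ((deriv ψ t ^ 2 + γ ^ 2 * ψ t ^ 2) - γ * (2 * ψ t * deriv ψ t)) := by
    rw [integral_Ioi_comp_log]
    refine integral_congr_ae (Eventually.of_forall fun t => ?_)
    simp only [deriv_logTransplant hψ (Real.exp_pos t), Real.log_exp, ← Real.exp_mul, mul_pow,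
      ← Real.exp_nat_mul]
    have : Real.exp t * (Real.exp (((2 : ℕ) : ℝ) * (t * (-γ - 1))) * Real.exp (t * (2 * γ + 1)))
        = 1 := by
      rw [← Real.exp_add, ← Real.exp_add, Real.exp_eq_one_iff]; push_cast; ring
    linear_combination ((deriv ψ t - γ * ψ t) ^ 2) * this
  have e' := integral_sub (i1.add (i2.const_mul (γ ^ 2))) (i3.const_mul γ)
  simp only [Pi.add_apply] at e'
  rw [e, e', integral_add i1 (i2.const_mul _), integral_const_mul, integral_const_mul, hz]
  ring

/-- Stretching a bump by k multiplies ∫ψ² by k and divides ∫ψ'² by k, so the quotient approaches γ².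
Transplants of compactly supported ψ vanish near 0 and near infinity. -/
theorem exists_radial_almost_optimal {γ η : ℝ} (hγ : 0 < γ) (hη : 0 < η) :
    ∃ φ : ℝ → ℝ, ContDiff ℝ ∞ φ ∧ (∃ ε > 0, ∀ ρ, |ρ| < ε → φ ρ = 0) ∧
      (∃ R > 0, ∀ ρ, R < |ρ| → φ ρ = 0) ∧
      0 < ∫ ρ in Ioi (0 : ℝ), φ ρ ^ 2 * ρ ^ (2 * γ - 1) ∧
      ∫ ρ in Ioi (0 : ℝ), deriv φ ρ ^ 2 * ρ ^ (2 * γ + 1)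
        ≤ (γ ^ 2 + η) * ∫ ρ in Ioi (0 : ℝ), φ ρ ^ 2 * ρ ^ (2 * γ - 1) := by
  let χ : ContDiffBump (0 : ℝ) := ⟨1, 2, by norm_num, by norm_num⟩
  have hχ : ContDiff ℝ ∞ χ := χ.contDiff
  have hχc : Continuous χ := hχ.continuous
  have hpos : 0 < ∫ t, χ t ^ 2 := by
    refine Continuous.integral_pos_of_hasCompactSupport_nonneg_nonzero (x := 0) (by fun_prop)
      ?_ (fun t => sq_nonneg _) ?_
    · exact χ.hasCompactSupport.comp_left (g := fun x : ℝ => x ^ 2) (by simp)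
    · have : χ 0 = 1 := χ.one_of_mem_closedBall (by simp [χ.rIn_pos.le])
      simp [this]
  set I := ∫ t, χ t ^ 2 with hI
  set J := ∫ t, deriv χ t ^ 2 with hJ
  have hJ0 : 0 ≤ J := integral_nonneg fun t => sq_nonneg _
  -- The summand 1 secures k ≥ 1, so that J ≤ ηIk implies J/k ≤ ηkI.
  obtain ⟨k, hk⟩ := exists_nat_gt (J / (η * I) + 1)
  have hq : 0 ≤ J / (η * I) := by positivity
  have hk1 : (1 : ℝ) ≤ k := by linarith
  have hk0 : (0 : ℝ) < k := by linarith
  set ψ : ℝ → ℝ := fun t => χ (t / k) with hψ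
  have hψs : ContDiff ℝ ∞ ψ := hχ.comp (contDiff_id.div_const _)
  have hψz : ∀ t, 2 * (k : ℝ) ≤ |t| → ψ t = 0 := by
    intro t ht
    refine χ.zero_of_le_dist ?_
    rw [dist_zero_right, Real.norm_eq_abs, abs_div, abs_of_pos hk0, le_div_iff₀ hk0]
    exact ht
  have hψc : HasCompactSupport ψ := by
    refine HasCompactSupport.of_support_subset_isCompact
      (isCompact_closedBall (0 : ℝ) (2 * k)) fun t ht => ?_
    rw [Metric.mem_closedBall, dist_zero_right, Real.norm_eq_abs]
    by_contra hlt
    exact ht (hψz t (not_le.1 hlt).le)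
  have e1 : ∫ t, ψ t ^ 2 = k * I := by
    have := Measure.integral_comp_div (fun t => χ t ^ 2) (k : ℝ)
    rw [abs_of_pos hk0, smul_eq_mul] at this
    exact this
  have e2 : ∫ t, deriv ψ t ^ 2 = J / k := by
    have hd : ∀ t, deriv ψ t = deriv χ (t / k) / k := by
      intro t
      have h1 := ((hχ.differentiable (by simp)) (t / k)).hasDerivAt.comp t
        ((hasDerivAt_id t).div_const (k : ℝ))
      refine (h1.congr_deriv ?_).deriv
      ring
    simp_rw [hd, div_pow]
    rw [integral_div, Measure.integral_comp_div (fun t => deriv χ t ^ 2) (k : ℝ),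
      abs_of_pos hk0, smul_eq_mul]
    field_simp
    rfl
  refine ⟨logTransplant γ ψ, contDiff_logTransplant hγ hψs hψz,
    ⟨Real.exp (-(2 * k)), Real.exp_pos _, fun ρ hρ => logTransplant_eq_zero hγ hψz (Or.inl hρ)⟩,
    ⟨Real.exp (2 * k), Real.exp_pos _, fun ρ hρ => logTransplant_eq_zero hγ hψz (Or.inr hρ)⟩,
    ?_, ?_⟩
  · rw [integral_logTransplant_sq, e1]; positivity
  · rw [integral_logTransplant_sq, integral_deriv_logTransplant_sq hψs hψc, e1, e2]
    have h1 : J ≤ η * I * k := by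
      have : J / (η * I) ≤ k := by linarith
      rwa [div_le_iff₀ (by positivity), mul_comm] at this
    have h2 : J / k ≤ η * (k * I) := by
      rw [div_le_iff₀ hk0]
      have : 0 ≤ η * I * k := by positivity
      nlinarith
    linarith

end FinslerHardy

/-! ### Polar coordinates in the quadrant and the two-dimensional inequality. -/

namespace FinslerHardy
open Set Filter Topology ProbabilityTheory

theorem quadrant_polar_mem {ρ θ : ℝ} (hρ : 0 < ρ) (hθ : θ ∈ Ioo (-Real.pi) Real.pi) :
    (0 < ρ * Real.cos θ ∧ 0 < ρ * Real.sin θ) ↔ θ ∈ Ioo 0 (Real.pi / 2) := by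
  rw [mul_pos_iff_of_pos_left hρ, mul_pos_iff_of_pos_left hρ]
  constructor
  · rintro ⟨hc, hs⟩
    have h0 : 0 < θ := by
      by_contra h
      have := Real.sin_nonpos_of_nonpos_of_neg_pi_le (not_lt.1 h) hθ.1.le
      linarith
    refine ⟨h0, ?_⟩
    by_contra h
    have := Real.cos_nonpos_of_pi_div_two_le_of_le (not_lt.1 h) (by linarith [hθ.2, Real.pi_pos])
    linarith
  · intro h
    exact ⟨cos_pos_of_mem_Ioo h, sin_pos_of_mem_Ioo h⟩

theorem Ioo_zero_pi_div_two_subset : Ioo 0 (Real.pi / 2) ⊆ Ioo (-Real.pi) Real.pi := fun _ hθ =>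
  ⟨by linarith [hθ.1, Real.pi_pos], by linarith [hθ.2, Real.pi_pos]⟩

/-- Polar coordinates in the quadrant. -/
theorem lintegral_quadrant_polar {f : ℝ → ℝ → ENNReal} (hf : Measurable (Function.uncurry f)) :
    ∫⁻ r in Ioi (0 : ℝ), ∫⁻ y in Ioi (0 : ℝ), f r y
      = ∫⁻ ρ in Ioi (0 : ℝ), ∫⁻ θ in Ioo 0 (Real.pi / 2),
          ENNReal.ofReal ρ * f (ρ * Real.cos θ) (ρ * Real.sin θ) := by
  have hQ : MeasurableSet ((Ioi (0 : ℝ)) ×ˢ (Ioi (0 : ℝ))) := measurableSet_Ioi.prod measurableSet_Ioi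
  have h1 : ∫⁻ r in Ioi (0 : ℝ), ∫⁻ y in Ioi (0 : ℝ), f r y
      = ∫⁻ p : ℝ × ℝ, (Ioi (0 : ℝ) ×ˢ Ioi (0 : ℝ)).indicator (Function.uncurry f) p := by
    rw [lintegral_indicator hQ, Measure.volume_eq_prod,
      setLIntegral_prod _ hf.aemeasurable]
    rfl
  rw [h1, ← lintegral_comp_polarCoord_symm]
  have h2 : ∀ p ∈ polarCoord.target, ENNReal.ofReal p.1 •
      (Ioi (0 : ℝ) ×ˢ Ioi (0 : ℝ)).indicator (Function.uncurry f) (polarCoord.symm p)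
      = (univ ×ˢ Ioo 0 (Real.pi / 2)).indicator (fun p : ℝ × ℝ => ENNReal.ofReal p.1 *
          f (p.1 * Real.cos p.2) (p.1 * Real.sin p.2)) p := by
    rintro ⟨ρ, θ⟩ hp
    rw [polarCoord_target] at hp
    have := quadrant_polar_mem hp.1 hp.2
    by_cases h : θ ∈ Ioo 0 (Real.pi / 2)
    · rw [indicator_of_mem, indicator_of_mem]
      · rfl
      · exact ⟨mem_univ _, h⟩
      · exact this.2 h
    · rw [indicator_of_notMem, indicator_of_notMem, smul_zero]
      · exact fun h' => h h'.2
      · exact fun h' => h (this.1 h')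
  have hmeas : Measurable (fun p : ℝ × ℝ => ENNReal.ofReal p.1 *
      f (p.1 * Real.cos p.2) (p.1 * Real.sin p.2)) := by
    have : Measurable fun p : ℝ × ℝ => (p.1 * Real.cos p.2, p.1 * Real.sin p.2) := by fun_prop
    exact (by fun_prop : Measurable fun p : ℝ × ℝ => ENNReal.ofReal p.1).mul (hf.comp this)
  rw [setLIntegral_congr_fun polarCoord.open_target.measurableSet h2,
    setLIntegral_indicator (MeasurableSet.univ.prod measurableSet_Ioo), polarCoord_target,
    prod_inter_prod, univ_inter, inter_eq_left.2 Ioo_zero_pi_div_two_subset,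
    Measure.volume_eq_prod, setLIntegral_prod _ hmeas.aemeasurable]

variable {n : ℕ} {α A : ℝ}

/-- Separation of the homogeneous factors of the weight in polar coordinates. -/
theorem polar_weight {ρ θ : ℝ} (hn : 1 ≤ n) (hρ : 0 < ρ) (hθ : θ ∈ Ioo 0 (Real.pi / 2)) :
    ρ * ((ρ * Real.cos θ) ^ (n - 1) * (ρ * Real.sin θ) ^ α)
      = angWeight n α θ * ρ ^ (n + α) := by
  have hs := sin_pos_of_mem_Ioo hθ
  rw [Real.mul_rpow hρ.le hs.le, mul_pow, Real.rpow_add hρ, Real.rpow_natCast, angWeight]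
  obtain ⟨k, rfl⟩ : ∃ k, n = k + 1 := ⟨n - 1, by omega⟩
  simp only [Nat.add_sub_cancel]
  rw [pow_succ]; ring

theorem rpow_add_eq_mul_sq {ρ : ℝ} (hρ : 0 < ρ) (s : ℝ) : ρ ^ s = ρ ^ (s - 2) * ρ ^ 2 := by
  rw [← Real.rpow_natCast ρ 2, ← Real.rpow_add hρ]; congr 1; push_cast; ring

/-- The radial derivative of `U`, in polar coordinates. -/
noncomputable def polarRadial (U : ℝ × ℝ → ℝ) (ρ θ : ℝ) : ℝ :=
  Real.cos θ * fderiv ℝ U (ρ * Real.cos θ, ρ * Real.sin θ) (1, 0)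
    + Real.sin θ * fderiv ℝ U (ρ * Real.cos θ, ρ * Real.sin θ) (0, 1)

/-- The angular derivative of `U`, in polar coordinates. -/
noncomputable def polarAngular (U : ℝ × ℝ → ℝ) (ρ θ : ℝ) : ℝ :=
  ρ * (-Real.sin θ * fderiv ℝ U (ρ * Real.cos θ, ρ * Real.sin θ) (1, 0)
    + Real.cos θ * fderiv ℝ U (ρ * Real.cos θ, ρ * Real.sin θ) (0, 1))

theorem hasDerivAt_polar_radius {U : ℝ × ℝ → ℝ} (hU : Differentiable ℝ U) (ρ θ : ℝ) :
    HasDerivAt (fun ρ => U (ρ * Real.cos θ, ρ * Real.sin θ)) (polarRadial U ρ θ) ρ := by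
  have h1 : HasDerivAt (fun ρ => (ρ * Real.cos θ, ρ * Real.sin θ)) (Real.cos θ, Real.sin θ) ρ := by
    simpa using ((hasDerivAt_id ρ).mul_const (Real.cos θ)).prodMk
      ((hasDerivAt_id ρ).mul_const (Real.sin θ))
  refine ((hU _).hasFDerivAt.comp_hasDerivAt ρ h1).congr_deriv ?_
  rw [show (Real.cos θ, Real.sin θ) = Real.cos θ • ((1 : ℝ), (0 : ℝ))
    + Real.sin θ • ((0 : ℝ), (1 : ℝ)) by simp, map_add, map_smul, map_smul, smul_eq_mul, smul_eq_mul,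
    polarRadial]

theorem hasDerivAt_polar_angle {U : ℝ × ℝ → ℝ} (hU : Differentiable ℝ U) (ρ θ : ℝ) :
    HasDerivAt (fun θ => U (ρ * Real.cos θ, ρ * Real.sin θ)) (polarAngular U ρ θ) θ := by
  have h1 : HasDerivAt (fun θ => (ρ * Real.cos θ, ρ * Real.sin θ))
      (ρ * -Real.sin θ, ρ * Real.cos θ) θ :=
    ((Real.hasDerivAt_cos θ).const_mul ρ).prodMk ((Real.hasDerivAt_sin θ).const_mul ρ)
  refine ((hU _).hasFDerivAt.comp_hasDerivAt θ h1).congr_deriv ?_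
  rw [show (ρ * -Real.sin θ, ρ * Real.cos θ) = (ρ * -Real.sin θ) • ((1 : ℝ), (0 : ℝ))
    + (ρ * Real.cos θ) • ((0 : ℝ), (1 : ℝ)) by simp, map_add, map_smul, map_smul, smul_eq_mul,
    smul_eq_mul, polarAngular]
  ring

theorem continuous_comp_polar {f : ℝ × ℝ → ℝ} (hf : Continuous f) :
    Continuous fun p : ℝ × ℝ => f (p.1 * Real.cos p.2, p.1 * Real.sin p.2) :=
  hf.comp (by fun_prop : Continuous fun p : ℝ × ℝ => (p.1 * Real.cos p.2, p.1 * Real.sin p.2))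

theorem continuous_fderiv_apply {U : ℝ × ℝ → ℝ} (hU : ContDiff ℝ 1 U) (v : ℝ × ℝ) :
    Continuous fun p => fderiv ℝ U p v :=
  (hU.continuous_fderiv (by simp)).clm_apply continuous_const

theorem continuous_polarRadial {U : ℝ × ℝ → ℝ} (hU : ContDiff ℝ 1 U) :
    Continuous fun p : ℝ × ℝ => polarRadial U p.1 p.2 := by
  have := continuous_comp_polar (continuous_fderiv_apply hU (1, 0))
  have := continuous_comp_polar (continuous_fderiv_apply hU (0, 1))
  unfold polarRadial
  fun_prop

theorem continuous_polarAngular {U : ℝ × ℝ → ℝ} (hU : ContDiff ℝ 1 U) :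
    Continuous fun p : ℝ × ℝ => polarAngular U p.1 p.2 := by
  have := continuous_comp_polar (continuous_fderiv_apply hU (1, 0))
  have := continuous_comp_polar (continuous_fderiv_apply hU (0, 1))
  unfold polarAngular
  fun_prop

theorem measurable_quadrant_density {G : ℝ × ℝ → ℝ} (hG : Measurable G) :
    Measurable (Function.uncurry fun r y : ℝ =>
      ENNReal.ofReal (r ^ (n - 1) * y ^ α * G (r, y))) := by
  refine Measurable.ennreal_ofReal ?_
  exact (by fun_prop : Measurable fun p : ℝ × ℝ => p.1 ^ (n - 1) * p.2 ^ α).mul hG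

theorem sq_polar_add_sq_polar (ρ θ : ℝ) :
    (ρ * Real.cos θ) ^ 2 + (ρ * Real.sin θ) ^ 2 = ρ ^ 2 := by
  linear_combination ρ ^ 2 * Real.sin_sq_add_cos_sq θ

/-- The energy in polar coordinates. -/
theorem lintegral_quadrant_energy (hn : 1 ≤ n) {U : ℝ × ℝ → ℝ} (hU : ContDiff ℝ 1 U) :
    ∫⁻ r in Ioi (0 : ℝ), ∫⁻ y in Ioi (0 : ℝ), ENNReal.ofReal (r ^ (n - 1) * y ^ α
          * (fderiv ℝ U (r, y) (1, 0) ^ 2 + fderiv ℝ U (r, y) (0, 1) ^ 2))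
      = (∫⁻ ρ in Ioi (0 : ℝ), ∫⁻ θ in Ioo 0 (Real.pi / 2),
          ENNReal.ofReal (angWeight n α θ)
            * ENNReal.ofReal (polarRadial U ρ θ ^ 2 * ρ ^ (n + α)))
        + ∫⁻ ρ in Ioi (0 : ℝ), ∫⁻ θ in Ioo 0 (Real.pi / 2),
          ENNReal.ofReal (angWeight n α θ * polarAngular U ρ θ ^ 2 * ρ ^ (n + α - 2)) := by
  have hm := measurable_angWeight n α
  have cV1 := continuous_polarRadial hU
  rw [lintegral_quadrant_polar (measurable_quadrant_density (G := fun p =>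
      fderiv ℝ U p (1, 0) ^ 2 + fderiv ℝ U p (0, 1) ^ 2)
      (by have := (continuous_fderiv_apply hU (1, 0)).measurable
          have := (continuous_fderiv_apply hU (0, 1)).measurable
          fun_prop)), ← lintegral_add_left]
  · refine setLIntegral_congr_fun measurableSet_Ioi fun ρ hρ => ?_
    have hρ : 0 < ρ := hρ
    rw [← lintegral_add_left]
    · refine setLIntegral_congr_fun measurableSet_Ioo fun θ hθ => ?_
      have hw := angWeight_nonneg n α hθ
      rw [← ENNReal.ofReal_mul hρ.le, ← ENNReal.ofReal_mul hw,
        ← ENNReal.ofReal_add (by positivity) (by positivity), ← mul_assoc,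
        polar_weight hn hρ hθ]
      congr 1
      rw [rpow_add_eq_mul_sq hρ (n + α)]
      simp only [polarRadial, polarAngular]
      set a := fderiv ℝ U (ρ * Real.cos θ, ρ * Real.sin θ) (1, 0)
      set b := fderiv ℝ U (ρ * Real.cos θ, ρ * Real.sin θ) (0, 1)
      linear_combination (-angWeight n α θ * ρ ^ (n + α - 2) * ρ ^ 2 * (a ^ 2 + b ^ 2))
        * Real.sin_sq_add_cos_sq θ
    · have : Measurable fun θ => polarRadial U ρ θ := (cV1.comp (by fun_prop :
        Continuous fun θ : ℝ => (ρ, θ))).measurable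
      fun_prop
  · have := cV1.measurable
    refine Measurable.lintegral_prod_right' (f := fun p : ℝ × ℝ => ENNReal.ofReal
      (angWeight n α p.2) * ENNReal.ofReal (polarRadial U p.1 p.2 ^ 2 * p.1 ^ (n + α))) ?_
    fun_prop

/-- The Hardy term in polar coordinates. -/
theorem lintegral_quadrant_hardy (hn : 1 ≤ n) {U : ℝ × ℝ → ℝ} (hU : Measurable U) :
    ∫⁻ r in Ioi (0 : ℝ), ∫⁻ y in Ioi (0 : ℝ),
        ENNReal.ofReal (r ^ (n - 1) * y ^ α * (U (r, y) ^ 2 / (r ^ 2 + y ^ 2)))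
      = ∫⁻ ρ in Ioi (0 : ℝ), ∫⁻ θ in Ioo 0 (Real.pi / 2), ENNReal.ofReal (angWeight n α θ
          * U (ρ * Real.cos θ, ρ * Real.sin θ) ^ 2 * ρ ^ (n + α - 2)) := by
  rw [lintegral_quadrant_polar (measurable_quadrant_density
    (G := fun p => U p ^ 2 / (p.1 ^ 2 + p.2 ^ 2)) (by fun_prop))]
  refine setLIntegral_congr_fun measurableSet_Ioi fun ρ hρ => ?_
  have hρ : 0 < ρ := hρ
  refine setLIntegral_congr_fun measurableSet_Ioo fun θ hθ => ?_
  rw [← ENNReal.ofReal_mul hρ.le, ← mul_assoc, polar_weight hn hρ hθ]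
  congr 1
  rw [rpow_add_eq_mul_sq hρ (n + α), sq_polar_add_sq_polar]
  field_simp

/-- The trace Hardy inequality for functions on the quadrant. -/
theorem quadrant_inequality (h : AngParams n α A) {U : ℝ × ℝ → ℝ} (hU : ContDiff ℝ 1 U)
    {R : ℝ} (hR : 0 < R) (hsupp : ∀ r y, R ^ 2 ≤ r ^ 2 + y ^ 2 → U (r, y) = 0) :
    ENNReal.ofReal (angConst n α A)
        * (∫⁻ r in Ioi (0 : ℝ), ENNReal.ofReal (r ^ (n + α - 2) * U (r, 0) ^ 2))
      + ENNReal.ofReal (((n + α - 1) / 2 - 2 * A) ^ 2)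
        * (∫⁻ r in Ioi (0 : ℝ), ∫⁻ y in Ioi (0 : ℝ),
          ENNReal.ofReal (r ^ (n - 1) * y ^ α * (U (r, y) ^ 2 / (r ^ 2 + y ^ 2))))
      ≤ ∫⁻ r in Ioi (0 : ℝ), ∫⁻ y in Ioi (0 : ℝ), ENNReal.ofReal (r ^ (n - 1) * y ^ α
          * (fderiv ℝ U (r, y) (1, 0) ^ 2 + fderiv ℝ U (r, y) (0, 1) ^ 2)) := by
  have hUd := hU.differentiable (by simp)
  set V : ℝ → ℝ → ℝ := fun ρ θ => U (ρ * Real.cos θ, ρ * Real.sin θ) with hV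
  set V1 : ℝ → ℝ → ℝ := polarRadial U
  set V2 : ℝ → ℝ → ℝ := polarAngular U
  have cV : Continuous fun p : ℝ × ℝ => V p.1 p.2 := continuous_comp_polar hU.continuous
  have cV1 : Continuous fun p : ℝ × ℝ => V1 p.1 p.2 := continuous_polarRadial hU
  have cV2 : Continuous fun p : ℝ × ℝ => V2 p.1 p.2 := continuous_polarAngular hU
  have hm := measurable_angWeight n α
  set D := (n : ℝ) / 2 - (A + (1 - α) / 2) with hD
  have hD0 : 0 < D := by linarith [h.lt]
  have hA := h.pos
  set γ := ((n : ℝ) + α - 1) / 2 with hγ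
  have hγ0 : 0 < γ := by linarith
  set lam := 4 * (A * D) with hlam
  have hlam0 : 0 ≤ lam := by positivity
  -- The radial Hardy constant is shared out: (γ-2A)² pays for the Hardy term, and λ supplies the
  -- zero-order term of the angular inequality.
  have hsplit : γ ^ 2 = (γ - 2 * A) ^ 2 + lam := by
    rw [hlam, hD, hγ]; ring
  have hpow1 : (n : ℝ) + α - 2 = 2 * γ - 1 := by rw [hγ]; ring
  have hpow2 : (n : ℝ) + α = 2 * γ + 1 := by rw [hγ]; ring
  rw [lintegral_quadrant_energy h.one_le hU,
    lintegral_quadrant_hardy h.one_le hU.continuous.measurable, hpow1, hpow2]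
  -- the radial inequality
  have hrad : ∫⁻ ρ in Ioi (0 : ℝ), ∫⁻ θ in Ioo 0 (Real.pi / 2),
        ENNReal.ofReal (angWeight n α θ) * ENNReal.ofReal (γ ^ 2 * V ρ θ ^ 2 * ρ ^ (2 * γ - 1))
      ≤ ∫⁻ ρ in Ioi (0 : ℝ), ∫⁻ θ in Ioo 0 (Real.pi / 2),
        ENNReal.ofReal (angWeight n α θ) * ENNReal.ofReal (V1 ρ θ ^ 2 * ρ ^ (2 * γ + 1)) := by
    have mV := cV.measurable
    have mV1 := cV1.measurable
    conv_lhs => rw [lintegral_lintegral_swap (by unfold Function.uncurry; fun_prop)]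
    conv_rhs => rw [lintegral_lintegral_swap (by unfold Function.uncurry; fun_prop)]
    refine lintegral_mono fun θ => ?_
    simp only
    rw [lintegral_const_mul' _ _ ENNReal.ofReal_ne_top,
      lintegral_const_mul' _ _ ENNReal.ofReal_ne_top]
    refine mul_le_mul_right (radial_hardy hγ0 (hasDerivAt_polar_radius hUd · θ) ?_ hR ?_) _
    · exact cV1.comp (by fun_prop : Continuous fun ρ : ℝ => (ρ, θ))
    · intro ρ hρ
      refine hsupp _ _ ?_
      rw [sq_polar_add_sq_polar]
      gcongr
  -- the angular inequality
  have hang : ENNReal.ofReal (angConst n α A)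
        * (∫⁻ r in Ioi (0 : ℝ), ENNReal.ofReal (r ^ (2 * γ - 1) * U (r, 0) ^ 2))
      ≤ ∫⁻ ρ in Ioi (0 : ℝ), ∫⁻ θ in Ioo 0 (Real.pi / 2), ENNReal.ofReal (ρ ^ (2 * γ - 1)) *
          ENNReal.ofReal (angWeight n α θ * (V2 ρ θ ^ 2 + lam * V ρ θ ^ 2)) := by
    rw [← lintegral_const_mul' _ _ ENNReal.ofReal_ne_top]
    refine setLIntegral_mono' measurableSet_Ioi fun ρ hρ => ?_
    have hρ : 0 < ρ := hρ
    rw [lintegral_const_mul' _ _ ENNReal.ofReal_ne_top]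
    have := h.angular_inequality (hasDerivAt_polar_angle hUd ρ)
      (cV2.comp (by fun_prop : Continuous fun θ : ℝ => (ρ, θ)))
    refine le_trans (le_of_eq ?_) (mul_le_mul_right this _)
    rw [ENNReal.ofReal_mul (p := ρ ^ (2 * γ - 1)) (by positivity), mul_left_comm,
      ENNReal.ofReal_mul' (sq_nonneg _)]
    simp
  have mV := cV.measurable
  have mV2 := cV2.measurable
  calc _ ≤ (∫⁻ ρ in Ioi (0 : ℝ), ∫⁻ θ in Ioo 0 (Real.pi / 2), ENNReal.ofReal (ρ ^ (2 * γ - 1)) *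
          ENNReal.ofReal (angWeight n α θ * (V2 ρ θ ^ 2 + lam * V ρ θ ^ 2)))
        + ∫⁻ ρ in Ioi (0 : ℝ), ∫⁻ θ in Ioo 0 (Real.pi / 2), ENNReal.ofReal ((γ - 2 * A) ^ 2) *
          ENNReal.ofReal (angWeight n α θ * V ρ θ ^ 2 * ρ ^ (2 * γ - 1)) := by
        refine add_le_add hang (le_of_eq ?_)
        simp_rw [lintegral_const_mul' _ _ (ENNReal.ofReal_ne_top (r := (γ - 2 * A) ^ 2))]
        rfl
    _ = (∫⁻ ρ in Ioi (0 : ℝ), ∫⁻ θ in Ioo 0 (Real.pi / 2),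
          ENNReal.ofReal (angWeight n α θ) * ENNReal.ofReal (γ ^ 2 * V ρ θ ^ 2 * ρ ^ (2 * γ - 1)))
        + ∫⁻ ρ in Ioi (0 : ℝ), ∫⁻ θ in Ioo 0 (Real.pi / 2),
          ENNReal.ofReal (angWeight n α θ * V2 ρ θ ^ 2 * ρ ^ (2 * γ - 1)) := by
        have hmeas : ∀ {G : ℝ × ℝ → ENNReal}, Measurable G →
            Measurable fun ρ => ∫⁻ θ in Ioo 0 (Real.pi / 2), G (ρ, θ) :=
          fun hG => hG.lintegral_prod_right'
        rw [← lintegral_add_left (hmeas (G := fun p => ENNReal.ofReal (p.1 ^ (2 * γ - 1)) *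
          ENNReal.ofReal (angWeight n α p.2 * (V2 p.1 p.2 ^ 2 + lam * V p.1 p.2 ^ 2)))
          (by fun_prop)),
          ← lintegral_add_left (hmeas (G := fun p => ENNReal.ofReal (angWeight n α p.2) *
            ENNReal.ofReal (γ ^ 2 * V p.1 p.2 ^ 2 * p.1 ^ (2 * γ - 1))) (by fun_prop))]
        refine setLIntegral_congr_fun measurableSet_Ioi fun ρ hρ => ?_
        have hρ : 0 < ρ := hρ
        have mVρ : Measurable fun θ => V ρ θ :=
          (cV.comp (by fun_prop : Continuous fun θ : ℝ => (ρ, θ))).measurable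
        have mV2ρ : Measurable fun θ => V2 ρ θ :=
          (cV2.comp (by fun_prop : Continuous fun θ : ℝ => (ρ, θ))).measurable
        simp only
        rw [← lintegral_add_left (by fun_prop), ← lintegral_add_left (by fun_prop)]
        refine setLIntegral_congr_fun measurableSet_Ioo fun θ hθ => ?_
        have hw := angWeight_nonneg n α hθ
        rw [← ENNReal.ofReal_mul (by positivity), ← ENNReal.ofReal_mul (by positivity),
          ← ENNReal.ofReal_mul hw, ← ENNReal.ofReal_add (by positivity) (by positivity),
          ← ENNReal.ofReal_add (by positivity) (by positivity)]
        congr 1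
        rw [hsplit]
        ring
    _ ≤ _ := add_le_add hrad le_rfl

end FinslerHardy

namespace FinslerHardy
open Set Filter Topology ProbabilityTheory

/-! ### The dual norm and biduality. -/

section DualNorm

variable {n : ℕ} {H : Seminorm ℝ (EuclideanSpace ℝ (Fin n))}

theorem continuous_seminorm (H : Seminorm ℝ (EuclideanSpace ℝ (Fin n))) :
    Continuous fun ξ => H ξ := by
  rw [← continuousOn_univ]
  exact H.convexOn.continuousOn isOpen_univ

theorem exists_pos_mul_norm_le (hH : ∀ ξ, H ξ = 0 → ξ = 0) :
    ∃ c > 0, ∀ ξ, c * ‖ξ‖ ≤ H ξ := by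
  -- The sphere is empty when n = 0; otherwise the minimum of H on it serves as c.
  rcases (Metric.sphere (0 : EuclideanSpace ℝ (Fin n)) 1).eq_empty_or_nonempty with he | hne
  · refine ⟨1, one_pos, fun ξ => ?_⟩
    have : ξ = 0 := by
      by_contra h0
      have : ‖ξ‖⁻¹ • ξ ∈ Metric.sphere (0 : EuclideanSpace ℝ (Fin n)) 1 := by
        simp [norm_smul, h0]
      rw [he] at this
      exact this
    simp [this]
  · obtain ⟨ξ₀, hξ₀, hmin⟩ := (isCompact_sphere (0 : EuclideanSpace ℝ (Fin n)) 1).exists_isMinOn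
      hne (continuous_seminorm H).continuousOn
    have h0 : ξ₀ ≠ 0 := by
      rintro rfl
      simp at hξ₀
    refine ⟨H ξ₀, lt_of_le_of_ne (apply_nonneg H _) fun h => h0 (hH _ h.symm), fun ξ => ?_⟩
    rcases eq_or_ne ξ 0 with rfl | hξ
    · simp
    · have hn : 0 < ‖ξ‖ := norm_pos_iff.2 hξ
      have h1 : H ξ₀ ≤ H (‖ξ‖⁻¹ • ξ) := hmin (by simp [norm_smul, hξ])
      rw [map_smul_eq_mul, norm_inv, norm_norm] at h1
      calc H ξ₀ * ‖ξ‖ ≤ ‖ξ‖⁻¹ * H ξ * ‖ξ‖ := by gcongr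
        _ = H ξ := by field_simp

theorem seminorm_pos (hH : ∀ ξ, H ξ = 0 → ξ = 0) {ξ : EuclideanSpace ℝ (Fin n)} (hξ : ξ ≠ 0) :
    0 < H ξ := lt_of_le_of_ne (apply_nonneg H _) fun h => hξ (hH _ h.symm)

theorem bddAbove_dualNorm (hH : ∀ ξ, H ξ = 0 → ξ = 0) (x : EuclideanSpace ℝ (Fin n)) :
    BddAbove (range fun ξ : {ξ : EuclideanSpace ℝ (Fin n) // ξ ≠ 0} =>
      ⟪x, (ξ : EuclideanSpace ℝ (Fin n))⟫ / H ξ) := by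
  obtain ⟨c, hc, hcH⟩ := exists_pos_mul_norm_le hH
  refine ⟨‖x‖ / c, ?_⟩
  rintro _ ⟨⟨ξ, hξ⟩, rfl⟩
  simp only
  rw [div_le_div_iff₀ (seminorm_pos hH hξ) hc]
  calc ⟪x, ξ⟫ * c ≤ ‖x‖ * ‖ξ‖ * c := by gcongr; exact real_inner_le_norm x ξ
    _ = ‖x‖ * (c * ‖ξ‖) := by ring
    _ ≤ ‖x‖ * H ξ := by gcongr; exact hcH ξ

theorem inner_le_dualNorm_mul (hH : ∀ ξ, H ξ = 0 → ξ = 0) (x ξ : EuclideanSpace ℝ (Fin n)) :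
    ⟪x, ξ⟫ ≤ dualNorm H x * H ξ := by
  rcases eq_or_ne ξ 0 with rfl | hξ
  · simp
  · rw [← div_le_iff₀ (seminorm_pos hH hξ)]
    exact le_ciSup (bddAbove_dualNorm hH x) ⟨ξ, hξ⟩

theorem dualNorm_le_of_forall {x : EuclideanSpace ℝ (Fin n)} {C : ℝ} (hC : 0 ≤ C)
    (h : ∀ ξ, ⟪x, ξ⟫ ≤ C * H ξ) : dualNorm H x ≤ C := by
  refine Real.iSup_le (fun ξ => ?_) hC
  rcases (apply_nonneg H (ξ : EuclideanSpace ℝ (Fin n))).eq_or_lt with h0 | h0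
  · rw [← h0, div_zero]; exact hC
  · rw [div_le_iff₀ h0]; exact h _

theorem dualNorm_nonneg (hH : ∀ ξ, H ξ = 0 → ξ = 0) (x : EuclideanSpace ℝ (Fin n)) :
    0 ≤ dualNorm H x := by
  rcases eq_or_ne x 0 with rfl | hx
  · simp [dualNorm]
  · have h := inner_le_dualNorm_mul hH x x
    rw [real_inner_self_eq_norm_sq] at h
    have h1 : 0 < ‖x‖ := norm_pos_iff.2 hx
    have := seminorm_pos hH hx
    by_contra hneg
    nlinarith

theorem dualNorm_pos (hH : ∀ ξ, H ξ = 0 → ξ = 0) {x : EuclideanSpace ℝ (Fin n)} (hx : x ≠ 0) :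
    0 < dualNorm H x := by
  have h := inner_le_dualNorm_mul hH x x
  rw [real_inner_self_eq_norm_sq] at h
  have h1 : 0 < ‖x‖ := norm_pos_iff.2 hx
  have := seminorm_pos hH hx
  by_contra hneg
  nlinarith [dualNorm_nonneg hH x, pow_pos h1 2]

theorem dualNorm_smul_le (hH : ∀ ξ, H ξ = 0 → ξ = 0) (c : ℝ) (x : EuclideanSpace ℝ (Fin n)) :
    dualNorm H (c • x) ≤ |c| * dualNorm H x := by
  refine dualNorm_le_of_forall (mul_nonneg (abs_nonneg _) (dualNorm_nonneg hH x)) fun ξ => ?_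
  rw [real_inner_smul_left, ← real_inner_smul_right]
  refine (inner_le_dualNorm_mul hH x _).trans (le_of_eq ?_)
  rw [map_smul_eq_mul, Real.norm_eq_abs]; ring

theorem dualNorm_smul (hH : ∀ ξ, H ξ = 0 → ξ = 0) (c : ℝ) (x : EuclideanSpace ℝ (Fin n)) :
    dualNorm H (c • x) = |c| * dualNorm H x := by
  refine (dualNorm_smul_le hH c x).antisymm ?_
  rcases eq_or_ne c 0 with rfl | hc
  · simpa using dualNorm_nonneg hH 0
  · have h := dualNorm_smul_le hH c⁻¹ (c • x)
    rw [smul_smul, inv_mul_cancel₀ hc, one_smul, abs_inv] at h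
    have : 0 < |c| := abs_pos.2 hc
    calc |c| * dualNorm H x ≤ |c| * (|c|⁻¹ * dualNorm H (c • x)) := by gcongr
      _ = dualNorm H (c • x) := by field_simp

theorem dualNorm_add_le (hH : ∀ ξ, H ξ = 0 → ξ = 0) (x y : EuclideanSpace ℝ (Fin n)) :
    dualNorm H (x + y) ≤ dualNorm H x + dualNorm H y := by
  refine dualNorm_le_of_forall (add_nonneg (dualNorm_nonneg hH x) (dualNorm_nonneg hH y))
    fun ξ => ?_
  rw [inner_add_left, add_mul]
  exact add_le_add (inner_le_dualNorm_mul hH x ξ) (inner_le_dualNorm_mul hH y ξ)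

/-- The dual norm as a seminorm. -/
noncomputable def dualSeminorm (hH : ∀ ξ, H ξ = 0 → ξ = 0) :
    Seminorm ℝ (EuclideanSpace ℝ (Fin n)) :=
  Seminorm.of (dualNorm H) (dualNorm_add_le hH) (dualNorm_smul hH)

theorem dualSeminorm_apply (hH : ∀ ξ, H ξ = 0 → ξ = 0) (x : EuclideanSpace ℝ (Fin n)) :
    dualSeminorm hH x = dualNorm H x := rfl

theorem continuous_dualNorm (hH : ∀ ξ, H ξ = 0 → ξ = 0) : Continuous (dualNorm H) :=
  continuous_seminorm (dualSeminorm hH)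

theorem dualNorm_sub_le (hH : ∀ ξ, H ξ = 0 → ξ = 0) (x y : EuclideanSpace ℝ (Fin n)) :
    dualNorm H x - dualNorm H y ≤ dualNorm H (x - y) := by
  have := dualNorm_add_le hH (x - y) y
  rw [sub_add_cancel] at this
  linarith

theorem dualNorm_neg (hH : ∀ ξ, H ξ = 0 → ξ = 0) (x : EuclideanSpace ℝ (Fin n)) :
    dualNorm H (-x) = dualNorm H x := map_neg_eq_map (dualSeminorm hH) x

theorem sq_inner_le (hH : ∀ ξ, H ξ = 0 → ξ = 0) (x ξ : EuclideanSpace ℝ (Fin n)) :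
    ⟪x, ξ⟫ ^ 2 ≤ (dualNorm H x * H ξ) ^ 2 := by
  refine sq_le_sq' ?_ (inner_le_dualNorm_mul hH x ξ)
  have := inner_le_dualNorm_mul hH (-x) ξ
  rw [inner_neg_left, dualNorm_neg hH] at this
  linarith

/-- `H` is the dual norm of its dual norm. -/
theorem seminorm_le_of_inner_le {ξ : EuclideanSpace ℝ (Fin n)}
    {C : ℝ} (hC : 0 ≤ C) (h : ∀ x, ⟪x, ξ⟫ ≤ C * dualNorm H x) : H ξ ≤ C := by
  rcases eq_or_ne ξ 0 with rfl | hξ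
  · simpa using hC
  -- Hahn–Banach: cξ ↦ cH(ξ) is dominated by H and extends with the same bound. The Riesz
  -- representative x of the extension has H₀(x) ≤ 1 and ⟪x, ξ⟫ = H(ξ).
  let f : EuclideanSpace ℝ (Fin n) →ₗ.[ℝ] ℝ := LinearPMap.mkSpanSingleton ξ (H ξ) hξ
  obtain ⟨g, hg1, hg2⟩ := exists_extension_of_le_sublinear f (fun x => H x)
    (fun c hc x => by rw [map_smul_eq_mul, Real.norm_of_nonneg hc.le])
    (fun x y => map_add_le_add H x y) (by
      rintro ⟨x, hx⟩
      obtain ⟨c, rfl⟩ := Submodule.mem_span_singleton.1 hx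
      have : f ⟨c • ξ, hx⟩ = c • H ξ := LinearPMap.mkSpanSingleton'_apply ..
      rw [this, map_smul_eq_mul, smul_eq_mul]
      exact mul_le_mul_of_nonneg_right (le_abs_self c) (apply_nonneg H _))
  have hgξ : g ξ = H ξ := by
    have := hg1 ⟨ξ, Submodule.mem_span_singleton_self ξ⟩
    rw [this]
    exact LinearPMap.mkSpanSingleton_apply ..
  let x := (InnerProductSpace.toDual ℝ (EuclideanSpace ℝ (Fin n))).symm
    (LinearMap.toContinuousLinearMap g)
  have hx : ∀ ζ, ⟪x, ζ⟫ = g ζ := fun ζ => by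
    simp only [x, InnerProductSpace.toDual_symm_apply, LinearMap.coe_toContinuousLinearMap']
  have hx1 : dualNorm H x ≤ 1 :=
    dualNorm_le_of_forall zero_le_one fun ζ => by rw [hx, one_mul]; exact hg2 ζ
  calc H ξ = ⟪x, ξ⟫ := by rw [hx, hgξ]
    _ ≤ C * dualNorm H x := h x
    _ ≤ C * 1 := by gcongr
    _ = C := mul_one C

end DualNorm

/-! ### Polar coordinates in ℝⁿ adapted to a norm. -/

section Polar

variable {n : ℕ}

theorem lintegral_Ioi_comp_mul_left {h : ℝ} (hh : 0 < h) (f : ℝ → ENNReal) :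
    ∫⁻ R in Ioi (0 : ℝ), f R = ∫⁻ r in Ioi (0 : ℝ), ENNReal.ofReal h * f (h * r) := by
  have him : (fun r => h * r) '' Ioi (0 : ℝ) = Ioi 0 := by
    rw [image_mul_left_Ioi hh, mul_zero]
  have := lintegral_image_eq_lintegral_abs_deriv_mul (s := Ioi (0 : ℝ)) (f := fun r => h * r)
    (f' := fun _ => h) measurableSet_Ioi
    (fun x _ => by simpa using ((hasDerivAt_id x).const_mul h).hasDerivWithinAt)
    (mul_right_injective₀ hh.ne').injOn f
  rw [him, abs_of_pos hh] at this
  exact this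

/-- Polar coordinates. -/
theorem lintegral_polar (hn : 1 ≤ n) {f : EuclideanSpace ℝ (Fin n) → ENNReal}
    (hf : Measurable f) :
    ∫⁻ x, f x = ∫⁻ w : Metric.sphere (0 : EuclideanSpace ℝ (Fin n)) 1,
      (∫⁻ r in Ioi (0 : ℝ), ENNReal.ofReal (r ^ (n - 1)) *
        f (r • (w : EuclideanSpace ℝ (Fin n))))
      ∂(volume : Measure (EuclideanSpace ℝ (Fin n))).toSphere := by
  have : Nonempty (Fin n) := ⟨⟨0, hn⟩⟩
  have hmp := (volume : Measure (EuclideanSpace ℝ (Fin n))).measurePreserving_homeomorphUnitSphereProd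
  set e := homeomorphUnitSphereProd (EuclideanSpace ℝ (Fin n))
  have hg : Measurable fun p : Metric.sphere (0 : EuclideanSpace ℝ (Fin n)) 1 × Ioi (0 : ℝ) =>
      f ((p.2 : ℝ) • (p.1 : EuclideanSpace ℝ (Fin n))) := by
    have : Measurable fun p : Metric.sphere (0 : EuclideanSpace ℝ (Fin n)) 1 × Ioi (0 : ℝ) =>
      ((p.2 : ℝ) • (p.1 : EuclideanSpace ℝ (Fin n))) := by fun_prop
    exact hf.comp this
  calc ∫⁻ x, f x = ∫⁻ x in ({0}ᶜ : Set (EuclideanSpace ℝ (Fin n))), f x := by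
        rw [restrict_compl_singleton]
    _ = ∫⁻ x : ({0}ᶜ : Set (EuclideanSpace ℝ (Fin n))),
          f (x : EuclideanSpace ℝ (Fin n)) ∂(volume.comap Subtype.val) :=
        (lintegral_subtype_comap (measurableSet_singleton _).compl f).symm
    _ = ∫⁻ x : ({0}ᶜ : Set (EuclideanSpace ℝ (Fin n))),
          f (((e x).2 : ℝ) • ((e x).1 : EuclideanSpace ℝ (Fin n))) ∂(volume.comap Subtype.val) := by
        refine lintegral_congr fun x => ?_
        congr 1
        have h0 : ‖(x : EuclideanSpace ℝ (Fin n))‖ ≠ 0 := norm_ne_zero_iff.2 x.2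
        simp only [e, homeomorphUnitSphereProd_apply_snd_coe,
          homeomorphUnitSphereProd_apply_fst_coe]
        rw [smul_smul, mul_inv_cancel₀ h0, one_smul]
    _ = _ := by
        rw [hmp.lintegral_comp hg, lintegral_prod _ hg.aemeasurable]
        refine lintegral_congr fun w => ?_
        have hgw : Measurable fun r : Ioi (0 : ℝ) =>
            f ((r : ℝ) • (w : EuclideanSpace ℝ (Fin n))) :=
          hg.comp (measurable_const.prodMk measurable_id)
        rw [Measure.volumeIoiPow, lintegral_withDensity_eq_lintegral_mul _ (by fun_prop) hgw,
          finrank_euclideanSpace_fin]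
        exact lintegral_subtype_comap measurableSet_Ioi (fun r : ℝ =>
          ENNReal.ofReal (r ^ (n - 1)) * f (r • (w : EuclideanSpace ℝ (Fin n))))

/-- Polar coordinates adapted to a norm `N`. -/
theorem lintegral_polar_norm (hn : 1 ≤ n) {f : EuclideanSpace ℝ (Fin n) → ENNReal}
    (hf : Measurable f) {N : EuclideanSpace ℝ (Fin n) → ℝ} (hN : ∀ x, x ≠ 0 → 0 < N x) :
    ∫⁻ x, f x = ∫⁻ w : Metric.sphere (0 : EuclideanSpace ℝ (Fin n)) 1,
      (ENNReal.ofReal ((N w)⁻¹ ^ n) * ∫⁻ r in Ioi (0 : ℝ), ENNReal.ofReal (r ^ (n - 1)) *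
        f (r • (N w)⁻¹ • (w : EuclideanSpace ℝ (Fin n))))
      ∂(volume : Measure (EuclideanSpace ℝ (Fin n))).toSphere := by
  rw [lintegral_polar hn hf]
  refine lintegral_congr fun w => ?_
  have hw : (w : EuclideanSpace ℝ (Fin n)) ≠ 0 := by
    intro h0
    have := w.2
    rw [h0] at this
    simp at this
  have hNw := hN _ hw
  -- On each ray the radius is rescaled by N(w)⁻¹; together with r^(n-1) this produces the factor
  -- N(w)⁻ⁿ.
  rw [lintegral_Ioi_comp_mul_left (inv_pos.2 hNw),
    ← lintegral_const_mul' _ _ ENNReal.ofReal_ne_top]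
  refine setLIntegral_congr_fun measurableSet_Ioi fun r hr => ?_
  have hr : 0 < r := hr
  rw [← mul_assoc, ← mul_assoc, ← ENNReal.ofReal_mul (by positivity),
    ← ENNReal.ofReal_mul (by positivity), smul_smul, mul_comm (N w)⁻¹ r]
  congr 2
  obtain ⟨k, rfl⟩ : ∃ k, n = k + 1 := ⟨n - 1, by omega⟩
  simp only [Nat.add_sub_cancel]
  ring

theorem upperHalfSpace_eq_prod (n : ℕ) :
    upperHalfSpace n = (univ : Set (EuclideanSpace ℝ (Fin n))) ×ˢ Ioi (0 : ℝ) := by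
  ext z; simp [upperHalfSpace]

theorem measurableSet_upperHalfSpace (n : ℕ) : MeasurableSet (upperHalfSpace n) := by
  rw [upperHalfSpace_eq_prod]; exact MeasurableSet.univ.prod measurableSet_Ioi

theorem lintegral_upperHalfSpace {f : EuclideanSpace ℝ (Fin n) × ℝ → ENNReal}
    (hf : Measurable f) :
    ∫⁻ z in upperHalfSpace n, f z = ∫⁻ x, ∫⁻ y in Ioi (0 : ℝ), f (x, y) := by
  rw [upperHalfSpace_eq_prod, Measure.volume_eq_prod, setLIntegral_prod _ hf.aemeasurable,
    Measure.restrict_univ]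

end Polar

/-! ### The split gradient in terms of the Fréchet derivative. -/

section Gradient

variable {n : ℕ} {u : EuclideanSpace ℝ (Fin n) × ℝ → ℝ}

theorem inner_grad_fst (hu : Differentiable ℝ u) (z : EuclideanSpace ℝ (Fin n) × ℝ)
    (ξ : EuclideanSpace ℝ (Fin n)) : ⟪ξ, (grad u z).1⟫ = fderiv ℝ u z (ξ, 0) := by
  have h1 : HasFDerivAt (fun x => u (x, z.2))
      ((fderiv ℝ u z).comp (ContinuousLinearMap.inl ℝ _ _)) z.1 :=
    HasFDerivAt.comp z.1 (hu (z.1, z.2)).hasFDerivAt (hasFDerivAt_prodMk_left z.1 z.2)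
  rw [real_inner_comm, grad, gradient, InnerProductSpace.toDual_symm_apply, h1.fderiv]
  simp

theorem grad_snd (hu : Differentiable ℝ u) (z : EuclideanSpace ℝ (Fin n) × ℝ) :
    (grad u z).2 = fderiv ℝ u z (0, 1) := by
  have h1 : HasDerivAt (fun y => (z.1, y)) ((0 : EuclideanSpace ℝ (Fin n)), (1 : ℝ)) z.2 :=
    (hasDerivAt_const z.2 z.1).prodMk (hasDerivAt_id z.2)
  exact (HasFDerivAt.comp_hasDerivAt z.2 (hu (z.1, z.2)).hasFDerivAt h1).deriv

theorem continuous_grad (hu : ContDiff ℝ 1 u) : Continuous (grad u) := by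
  have hd := hu.differentiable (by simp)
  have hc := hu.continuous_fderiv (by simp)
  refine Continuous.prodMk ?_ ?_
  · have : (fun z : EuclideanSpace ℝ (Fin n) × ℝ => gradient (fun x => u (x, z.2)) z.1)
        = fun z => (InnerProductSpace.toDual ℝ (EuclideanSpace ℝ (Fin n))).symm
          ((fderiv ℝ u z).comp (ContinuousLinearMap.inl ℝ _ _)) := by
      funext z
      have h1 : HasFDerivAt (fun x => u (x, z.2))
          ((fderiv ℝ u z).comp (ContinuousLinearMap.inl ℝ _ _)) z.1 :=
        HasFDerivAt.comp z.1 (hd (z.1, z.2)).hasFDerivAt (hasFDerivAt_prodMk_left z.1 z.2)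
      rw [gradient, h1.fderiv]
    rw [this]
    exact (LinearIsometryEquiv.continuous _).comp (hc.clm_comp continuous_const)
  · have : (fun z : EuclideanSpace ℝ (Fin n) × ℝ => deriv (fun y => u (z.1, y)) z.2)
        = fun z => fderiv ℝ u z (0, 1) := funext fun z => grad_snd hd z
    rw [this]
    exact hc.clm_apply continuous_const

end Gradient

/-! ### Reduction of the inequality to the quadrant, ray by ray. -/

section Inequality

variable {n : ℕ} {H : Seminorm ℝ (EuclideanSpace ℝ (Fin n))} {α A : ℝ}
  {u : EuclideanSpace ℝ (Fin n) × ℝ → ℝ}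

theorem Phi_sq (H : Seminorm ℝ (EuclideanSpace ℝ (Fin n))) (ζ : EuclideanSpace ℝ (Fin n) × ℝ) :
    Phi H ζ ^ 2 = H ζ.1 ^ 2 + ζ.2 ^ 2 := Real.sq_sqrt (by positivity)

theorem Phi0_sq (H : Seminorm ℝ (EuclideanSpace ℝ (Fin n))) (z : EuclideanSpace ℝ (Fin n) × ℝ) :
    Phi0 H z ^ 2 = dualNorm H z.1 ^ 2 + z.2 ^ 2 := Real.sq_sqrt (by positivity)

theorem measurable_traceDensity (hH : ∀ ξ, H ξ = 0 → ξ = 0) (hu : Continuous u) :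
    Measurable (traceDensity H α u) := by
  have := (continuous_dualNorm hH).measurable
  have : Measurable fun x : EuclideanSpace ℝ (Fin n) => u (x, 0) :=
    (hu.comp (by fun_prop)).measurable
  unfold traceDensity
  fun_prop

theorem measurable_hardyDensity (hH : ∀ ξ, H ξ = 0 → ξ = 0) (hu : Continuous u) :
    Measurable (hardyDensity H α u) := by
  have := (continuous_dualNorm hH).measurable
  have := hu.measurable
  unfold hardyDensity
  simp_rw [Phi0_sq]
  fun_prop

theorem measurable_energyDensity (hu : ContDiff ℝ 1 u) : Measurable (energyDensity H α u) := by
  have h1 := (continuous_grad hu).measurable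
  have h2 := (continuous_seminorm H).measurable
  unfold energyDensity
  simp_rw [Phi_sq]
  generalize grad u = g at h1 ⊢
  fun_prop

/-- The interpolation inequality, in terms of lower Lebesgue integrals. -/
theorem lintegral_interpolation_inequality (hp : AngParams n α A) (hH : ∀ ξ, H ξ = 0 → ξ = 0)
    (hu : ContDiff ℝ 1 u) (huc : HasCompactSupport u) :
    ENNReal.ofReal (angConst n α A) * (∫⁻ x, ENNReal.ofReal (traceDensity H α u x))
      + ENNReal.ofReal (((n + α - 1) / 2 - 2 * A) ^ 2)
        * (∫⁻ z in upperHalfSpace n, ENNReal.ofReal (hardyDensity H α u z))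
      ≤ ∫⁻ z in upperHalfSpace n, ENNReal.ofReal (energyDensity H α u z) := by
  have hn := hp.one_le
  have m1 := (measurable_traceDensity (α := α) hH hu.continuous).ennreal_ofReal
  have m2 := (measurable_hardyDensity (α := α) hH hu.continuous).ennreal_ofReal
  have m3 := (measurable_energyDensity (H := H) (α := α) hu).ennreal_ofReal
  have hN : ∀ x, x ≠ 0 → 0 < dualNorm H x := fun x hx => dualNorm_pos hH hx
  obtain ⟨R₀, hR₀⟩ := huc.isCompact.isBounded.exists_norm_le
  have hz : ∀ z, R₀ < ‖z‖ → u z = 0 := fun z hz => by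
    by_contra h
    exact (hR₀ z (subset_tsupport _ h)).not_gt hz
  rw [lintegral_upperHalfSpace m2, lintegral_upperHalfSpace m3,
    lintegral_polar_norm hn m1 hN, lintegral_polar_norm hn m2.lintegral_prod_right' hN,
    lintegral_polar_norm hn m3.lintegral_prod_right' hN,
    ← lintegral_const_mul' _ _ ENNReal.ofReal_ne_top,
    ← lintegral_const_mul' _ _ ENNReal.ofReal_ne_top]
  -- Superadditivity of the lower integral requires no measurability in w and points in the right
  -- direction here.
  refine (le_lintegral_add _ _).trans (lintegral_mono fun w => ?_)
  have hw : (w : EuclideanSpace ℝ (Fin n)) ≠ 0 := by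
    intro h0
    have := w.2
    rw [h0] at this
    simp at this
  have hNw := hN _ hw
  rw [mul_left_comm, mul_left_comm (ENNReal.ofReal (((n + α - 1) / 2 - 2 * A) ^ 2)), ← mul_add]
  refine mul_le_mul_right ?_ _
  set σ := (dualNorm H w)⁻¹ • (w : EuclideanSpace ℝ (Fin n)) with hσ
  have hNσ : dualNorm H σ = 1 := by
    rw [hσ, dualNorm_smul hH, abs_of_pos (inv_pos.2 hNw), inv_mul_cancel₀ hNw.ne']
  have hNr : ∀ r : ℝ, 0 < r → dualNorm H (r • σ) = r := fun r hr => by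
    rw [dualNorm_smul hH, hNσ, abs_of_pos hr, mul_one]
  have hσ0 : 0 < ‖σ‖ := by
    rw [norm_pos_iff, hσ]; simp [hw, hNw.ne']
  let Lσ : ℝ × ℝ →L[ℝ] EuclideanSpace ℝ (Fin n) × ℝ :=
    ((ContinuousLinearMap.fst ℝ ℝ ℝ).smulRight σ).prod (ContinuousLinearMap.snd ℝ ℝ ℝ)
  have hL : ∀ r y, Lσ (r, y) = (r • σ, y) := fun r y => rfl
  -- The restriction of u to the plane spanned by σ and the y-axis, where H₀(rσ) = r for r > 0.
  set U : ℝ × ℝ → ℝ := fun p => u (Lσ p) with hU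
  have hUc : ContDiff ℝ 1 U := hu.comp Lσ.contDiff
  have hud := hu.differentiable (by simp)
  have hUf : ∀ p v, fderiv ℝ U p v = fderiv ℝ u (Lσ p) (Lσ v) := by
    intro p v
    have : HasFDerivAt U ((fderiv ℝ u (Lσ p)).comp Lσ) p :=
      (hud (Lσ p)).hasFDerivAt.comp p Lσ.hasFDerivAt
    rw [this.fderiv]; rfl
  have hR0 : 0 < (|R₀| + 1) * (‖σ‖⁻¹ + 1) := by positivity
  have hsupp : ∀ r y, ((|R₀| + 1) * (‖σ‖⁻¹ + 1)) ^ 2 ≤ r ^ 2 + y ^ 2 → U (r, y) = 0 := by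
    intro r y hry
    refine hz _ ?_
    by_contra hle
    rw [not_lt, hL, Prod.norm_def, max_le_iff, norm_smul, Real.norm_eq_abs, Real.norm_eq_abs]
      at hle
    have h1 : |r| ≤ |R₀| * ‖σ‖⁻¹ := by
      rw [← div_eq_mul_inv, le_div_iff₀ hσ0]; exact hle.1.trans (le_abs_self _)
    have h2 : |y| ≤ |R₀| := hle.2.trans (le_abs_self _)
    have h3 : r ^ 2 ≤ (|R₀| * ‖σ‖⁻¹) ^ 2 := by rw [← sq_abs r]; gcongr
    have h4 : y ^ 2 ≤ |R₀| ^ 2 := by rw [← sq_abs y]; gcongr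
    have h5 : 0 < ‖σ‖⁻¹ := inv_pos.2 hσ0
    have h6 := abs_nonneg R₀
    have h7 : 0 ≤ |R₀| * ‖σ‖⁻¹ := by positivity
    nlinarith [mul_nonneg h6 h7]
  have key := quadrant_inequality hp hUc hR0 hsupp
  refine le_trans (le_of_eq ?_) (key.trans ?_)
  · congr 1
    · congr 1
      refine setLIntegral_congr_fun measurableSet_Ioi fun r hr => ?_
      have hr : 0 < r := hr
      simp only [traceDensity, hNr r hr, hU, hL]
      rw [← ENNReal.ofReal_mul (by positivity)]
      congr 1
      obtain ⟨k, rfl⟩ : ∃ k, n = k + 1 := ⟨n - 1, by omega⟩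
      simp only [Nat.add_sub_cancel]
      rw [show ((k + 1 : ℕ) : ℝ) + α - 2 = k - (1 - α) by push_cast; ring,
        Real.rpow_sub hr k, Real.rpow_natCast]
      ring
    · congr 1
      refine setLIntegral_congr_fun measurableSet_Ioi fun r hr => ?_
      have hr : 0 < r := hr
      rw [← lintegral_const_mul' _ _ ENNReal.ofReal_ne_top]
      refine setLIntegral_congr_fun measurableSet_Ioi fun y hy => ?_
      simp only [hardyDensity, Phi0_sq, hNr r hr, hU, hL]
      rw [← ENNReal.ofReal_mul (by positivity)]
      congr 1
      ring
  · refine setLIntegral_mono' measurableSet_Ioi fun r hr => ?_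
    have hr : 0 < r := hr
    rw [← lintegral_const_mul' _ _ ENNReal.ofReal_ne_top]
    refine setLIntegral_mono' measurableSet_Ioi fun y hy => ?_
    have hy : 0 < y := hy
    rw [← ENNReal.ofReal_mul (by positivity)]
    refine ENNReal.ofReal_le_ofReal ?_
    simp only [energyDensity, Phi_sq]
    rw [mul_assoc]
    refine mul_le_mul_of_nonneg_left (mul_le_mul_of_nonneg_left (add_le_add ?_ (le_of_eq ?_))
      (by positivity)) (by positivity)
    -- The only loss in passing to rays: |⟪σ, ∇ₓu⟫| ≤ H₀(σ)H(∇ₓu) = H(∇ₓu).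
    · rw [hUf, hL, hL, one_smul, ← inner_grad_fst hud]
      have := sq_inner_le hH σ (grad u (r • σ, y)).1
      rwa [hNσ, one_mul] at this
    · rw [hUf, hL, hL, zero_smul, grad_snd hud]

end Inequality

end FinslerHardy

/-! ### Finiteness of the integrals, the inequality for them, identification of the constant. -/

namespace FinslerHardy
open Set Filter Topology ProbabilityTheory

variable {n : ℕ} {H : Seminorm ℝ (EuclideanSpace ℝ (Fin n))} {α A : ℝ}
  {u : EuclideanSpace ℝ (Fin n) × ℝ → ℝ}

/-- Domination by a product: a constant on a ball in x times y^α on a bounded interval, integrable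
at 0 because α > -1. -/
theorem integrableOn_rpow_mul_of_bounded (hα : -1 < α) {f : EuclideanSpace ℝ (Fin n) × ℝ → ℝ}
    (hf : Measurable f) {M R : ℝ} (hM : ∀ z, |f z| ≤ M) (hR : ∀ z, R < ‖z‖ → f z = 0) :
    IntegrableOn (fun z => z.2 ^ α * f z) (upperHalfSpace n) := by
  have hM0 : 0 ≤ M := (abs_nonneg _).trans (hM 0)
  have i1 : Integrable ((Metric.closedBall (0 : EuclideanSpace ℝ (Fin n)) |R|).indicator
      fun _ => M) :=
    (integrable_indicator_iff measurableSet_closedBall).2 (by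
      simpa using integrableOn_const (C := M) (measure_closedBall_lt_top.ne))
  have i2 : Integrable ((Icc 0 |R|).indicator fun y : ℝ => y ^ α)
      (volume.restrict (Ioi 0)) := by
    rw [integrable_indicator_iff measurableSet_Icc]
    have := (integrableOn_continuous_mul_rpow (f := fun _ => 1) continuous_const hα
      (abs_nonneg R)).integrable
    simp only [one_mul] at this
    exact this.mono_measure (Measure.restrict_mono le_rfl Measure.restrict_le_self)
  have hmul := i1.mul_prod i2
  have heq : (volume : Measure (EuclideanSpace ℝ (Fin n))).prod (volume.restrict (Ioi (0 : ℝ)))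
      = (volume : Measure (EuclideanSpace ℝ (Fin n) × ℝ)).restrict (upperHalfSpace n) := by
    rw [upperHalfSpace_eq_prod, Measure.volume_eq_prod, ← Measure.prod_restrict,
      Measure.restrict_univ]
  rw [heq] at hmul
  refine hmul.mono' (Measurable.aestronglyMeasurable (by fun_prop)) ?_
  filter_upwards [ae_restrict_mem (measurableSet_upperHalfSpace n)] with z hz
  have hz : 0 < z.2 := hz
  by_cases hzR : R < ‖z‖
  · rw [hR z hzR, mul_zero, norm_zero]
    refine mul_nonneg (indicator_nonneg (fun _ _ => hM0) _) (indicator_nonneg (fun y hy => ?_) _)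
    exact Real.rpow_nonneg hy.1 _
  · have hle : ‖z‖ ≤ |R| := (not_lt.1 hzR).trans (le_abs_self R)
    rw [indicator_of_mem, indicator_of_mem, norm_mul, Real.norm_eq_abs, Real.norm_eq_abs,
      abs_of_nonneg (Real.rpow_nonneg hz.le _), mul_comm]
    · exact mul_le_mul_of_nonneg_right (hM z) (Real.rpow_nonneg hz.le _)
    · exact ⟨hz.le, (le_abs_self _).trans ((norm_snd_le z).trans hle)⟩
    · simpa using (norm_fst_le z).trans hle

theorem grad_eq_zero (hu : Differentiable ℝ u) {z : EuclideanSpace ℝ (Fin n) × ℝ}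
    (hz : z ∉ tsupport u) : grad u z = 0 := by
  have h0 : fderiv ℝ u z = 0 := fderiv_of_notMem_tsupport ℝ hz
  refine Prod.ext ?_ ?_
  · have := inner_grad_fst hu z (grad u z).1
    rw [h0] at this
    exact inner_self_eq_zero.1 this
  · rw [grad_snd hu, h0]; rfl

theorem integrableOn_energyDensity (hα : -1 < α) (hu : ContDiff ℝ 1 u)
    (huc : HasCompactSupport u) : IntegrableOn (energyDensity H α u) (upperHalfSpace n) := by
  have hc : Continuous fun z => Phi H (grad u z) ^ 2 := by
    simp_rw [Phi_sq]
    have h1 := continuous_grad hu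
    have h2 : Continuous fun z => H (grad u z).1 :=
      (continuous_seminorm H).comp (continuous_fst.comp h1)
    have h3 : Continuous fun z => (grad u z).2 := continuous_snd.comp h1
    exact (h2.pow 2).add (h3.pow 2)
  have hsupp : ∀ z, z ∉ tsupport u → Phi H (grad u z) ^ 2 = 0 := fun z hz => by
    rw [grad_eq_zero (hu.differentiable (by simp)) hz, Phi_sq]; simp
  have hcs : HasCompactSupport fun z => Phi H (grad u z) ^ 2 := .intro huc hsupp
  obtain ⟨M, hM⟩ := hcs.exists_bound_of_continuous hc
  obtain ⟨R, hR⟩ := huc.isCompact.isBounded.exists_norm_le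
  exact integrableOn_rpow_mul_of_bounded hα hc.measurable hM
    fun z hz => hsupp z fun h => (hR z h).not_gt hz

theorem energyDensity_nonneg {z : EuclideanSpace ℝ (Fin n) × ℝ} (hz : z ∈ upperHalfSpace n) :
    0 ≤ energyDensity H α u z := by
  have : 0 < z.2 := hz
  unfold energyDensity; positivity

theorem hardyDensity_nonneg {z : EuclideanSpace ℝ (Fin n) × ℝ} (hz : z ∈ upperHalfSpace n) :
    0 ≤ hardyDensity H α u z := by
  have : 0 < z.2 := hz
  unfold hardyDensity; positivity

theorem traceDensity_nonneg (hH : ∀ ξ, H ξ = 0 → ξ = 0) (x : EuclideanSpace ℝ (Fin n)) :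
    0 ≤ traceDensity H α u x := by
  have := dualNorm_nonneg hH x
  unfold traceDensity; positivity

theorem ae_upperHalfSpace_of_forall {f : EuclideanSpace ℝ (Fin n) × ℝ → ℝ}
    (hf : ∀ z ∈ upperHalfSpace n, 0 ≤ f z) :
    0 ≤ᵐ[volume.restrict (upperHalfSpace n)] f := by
  filter_upwards [ae_restrict_mem (measurableSet_upperHalfSpace n)] with z hz using hf z hz

theorem AngParams.half (hp : AngParams n α A) : AngParams n α (A / 2) where
  one_le := hp.one_le
  neg_one_lt := hp.neg_one_lt
  lt_one := hp.lt_one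
  pos := half_pos hp.pos
  lt := by linarith [hp.lt, hp.pos]

theorem AngParams.angConst_pos (hp : AngParams n α A) : 0 < angConst n α A := by
  have h1 := beta_pos hp.pos' (show 0 < (1 + α) / 2 by linarith [hp.neg_one_lt])
  have h2 := beta_pos (show 0 < (1 - α) / 2 by linarith [hp.lt_one])
    (show 0 < n / 2 - (A + (1 - α) / 2) by linarith [hp.lt])
  have := hp.pos
  unfold angConst
  positivity

/-- The energy is finite, so the inequality for lower integrals bounds the other two. Its Hardy
coefficient (γ-2A)² may vanish (b = 2-α in the theorem); with A/2 in place of A, still admissible,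
the coefficient (γ-A)² is positive. -/
theorem lintegral_densities_lt_top (hp : AngParams n α A) (hH : ∀ ξ, H ξ = 0 → ξ = 0)
    (hu : ContDiff ℝ 1 u) (huc : HasCompactSupport u) :
    (∫⁻ x, ENNReal.ofReal (traceDensity H α u x)) < ⊤ ∧
      (∫⁻ z in upperHalfSpace n, ENNReal.ofReal (hardyDensity H α u z)) < ⊤ := by
  have hE : ∫⁻ z in upperHalfSpace n, ENNReal.ofReal (energyDensity H α u z) < ⊤ :=
    (hasFiniteIntegral_iff_ofReal (ae_upperHalfSpace_of_forall fun _ => energyDensity_nonneg)).1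
      (integrableOn_energyDensity hp.neg_one_lt hu huc).2
  have h := (lintegral_interpolation_inequality hp.half hH hu huc).trans_lt hE
  have hK := hp.half.angConst_pos
  have hκ : 0 < ((n + α - 1) / 2 - 2 * (A / 2)) ^ 2 := by
    have : 0 < (n + α - 1) / 2 - 2 * (A / 2) := by linarith [hp.lt]
    positivity
  obtain ⟨h1, h2⟩ := ENNReal.add_lt_top.1 h
  constructor
  · exact ENNReal.lt_top_of_mul_ne_top_right h1.ne (by simpa using hK)
  · exact ENNReal.lt_top_of_mul_ne_top_right h2.ne (by simpa using hκ.ne')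

theorem integrable_traceDensity (hp : AngParams n α A) (hH : ∀ ξ, H ξ = 0 → ξ = 0)
    (hu : ContDiff ℝ 1 u) (huc : HasCompactSupport u) : Integrable (traceDensity H α u) :=
  ⟨(measurable_traceDensity hH hu.continuous).aestronglyMeasurable,
    (hasFiniteIntegral_iff_ofReal (Eventually.of_forall (traceDensity_nonneg hH))).2
      (lintegral_densities_lt_top hp hH hu huc).1⟩

theorem integrableOn_hardyDensity (hp : AngParams n α A) (hH : ∀ ξ, H ξ = 0 → ξ = 0)
    (hu : ContDiff ℝ 1 u) (huc : HasCompactSupport u) :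
    IntegrableOn (hardyDensity H α u) (upperHalfSpace n) :=
  ⟨(measurable_hardyDensity hH hu.continuous).aestronglyMeasurable,
    (hasFiniteIntegral_iff_ofReal (ae_upperHalfSpace_of_forall fun _ => hardyDensity_nonneg)).2
      (lintegral_densities_lt_top hp hH hu huc).2⟩

theorem interpolation_inequality (hp : AngParams n α A) (hH : ∀ ξ, H ξ = 0 → ξ = 0)
    (hu : ContDiff ℝ 1 u) (huc : HasCompactSupport u) :
    angConst n α A * (∫ x, traceDensity H α u x)
      + ((n + α - 1) / 2 - 2 * A) ^ 2 * (∫ z in upperHalfSpace n, hardyDensity H α u z)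
    ≤ ∫ z in upperHalfSpace n, energyDensity H α u z := by
  have h := lintegral_interpolation_inequality hp hH hu huc
  have nT := Eventually.of_forall (f := ae volume) (traceDensity_nonneg (α := α) (u := u) hH)
  have nS := ae_upperHalfSpace_of_forall fun z => hardyDensity_nonneg (H := H) (α := α) (u := u)
    (z := z)
  have nE := ae_upperHalfSpace_of_forall fun z => energyDensity_nonneg (H := H) (α := α) (u := u)
    (z := z)
  rw [← ofReal_integral_eq_lintegral_ofReal (integrable_traceDensity hp hH hu huc) nT,
    ← ofReal_integral_eq_lintegral_ofReal (integrableOn_hardyDensity hp hH hu huc) nS,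
    ← ofReal_integral_eq_lintegral_ofReal (integrableOn_energyDensity hp.neg_one_lt hu huc) nE,
    ← ENNReal.ofReal_mul hp.angConst_pos.le, ← ENNReal.ofReal_mul (sq_nonneg _),
    ← ENNReal.ofReal_add (mul_nonneg hp.angConst_pos.le (integral_nonneg_of_ae nT))
      (mul_nonneg (sq_nonneg _) (integral_nonneg_of_ae nS)),
    ENNReal.ofReal_le_ofReal_iff (integral_nonneg_of_ae nE)] at h
  exact h

/-- This A makes γ - 2A equal to (α+b-2)/2. The two bounds on b combine to n > 1-α, which forces n ≥
1 and gives the upper bound on A. -/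
theorem angParams_of_hyp {b : ℝ} (hα : α ∈ Ioo (-1 : ℝ) 1) (hb : 2 - α ≤ b)
    (hbn : b < (n : ℝ) + 1) : AngParams n α ((n + 1 - b) / 4) where
  one_le := by
    by_contra h0
    have : n = 0 := by omega
    subst this
    have := hα.2
    norm_num at hbn
    linarith
  neg_one_lt := hα.1
  lt_one := hα.2
  pos := by linarith
  lt := by linarith [hα.2]

/-- The numerator beta has total argument A+1, and Γ(A+1) = AΓ(A) absorbs the prefactor A. Likewise
Γ((3-α)/2) = ((1-α)/2)Γ((1-α)/2) accounts for the factor 1-α. -/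
theorem angConst_eq_K {b : ℝ} (hα : α ∈ Ioo (-1 : ℝ) 1) (hbn : b < (n : ℝ) + 1) :
    angConst n α ((n + 1 - b) / 4) = K n α b := by
  have hA : 0 < (n + 1 - b) / 4 := by linarith
  have h1 : (0 : ℝ) < (1 - α) / 2 := by linarith [hα.2]
  have e1 := Real.Gamma_add_one hA.ne'
  have e2 := Real.Gamma_add_one h1.ne'
  have g1 := (Real.Gamma_pos_of_pos hA).ne'
  have g2 := (Real.Gamma_pos_of_pos h1).ne'
  have h1' := h1.ne'
  have hA' := hA.ne'
  unfold angConst K beta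
  rw [show (n + 1 - b) / 4 + (1 - α) / 2 + (1 + α) / 2 = (n + 1 - b) / 4 + 1 by ring, e1,
    show (3 - α) / 2 = (1 - α) / 2 + 1 by ring, e2,
    show (n + 1 - b) / 4 + (1 - α) / 2 = (n - 2 * α - b + 3) / 4 by ring,
    show (1 - α) / 2 + (n / 2 - (n - 2 * α - b + 3) / 4) = (n + b - 1) / 4 by ring,
    show n / 2 - (n - 2 * α - b + 3) / 4 = (n + 2 * α + b - 3) / 4 by ring,
    show (1 + α) / 2 = (α + 1) / 2 by ring]
  have e3 : 1 - α = 2 * ((1 - α) / 2) := by ring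
  set s := (1 - α) / 2
  rw [e3]
  set a := (n + 1 - b) / 4
  set x := Real.Gamma ((n + 2 * α + b - 3) / 4)
  set y := Real.Gamma ((n + b - 1) / 4)
  -- Without a lower bound on b these arguments may be poles, where `Real.Gamma` is 0; both sides
  -- are then 0.
  rcases eq_or_ne x 0 with hx | hx
  · simp [hx]
  rcases eq_or_ne y 0 with hy | hy
  · simp [hy]
  field_simp

end FinslerHardy

/-! ### Smooth approximation of the dual norm and test functions of (H₀(x), y). -/

namespace FinslerHardy
open Set Filter Topology ProbabilityTheory
open scoped Convolution

variable {n : ℕ} {H : Seminorm ℝ (EuclideanSpace ℝ (Fin n))} {α A : ℝ}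

/-- The dual norm can be approximated uniformly by smooth functions with gradients in the unit
ball of `H`. -/
theorem exists_smooth_approx_dualNorm (hH : ∀ ξ, H ξ = 0 → ξ = 0) {ε : ℝ} (hε : 0 < ε) :
    ∃ N : EuclideanSpace ℝ (Fin n) → ℝ, ContDiff ℝ ∞ N ∧ (∀ x, |N x - dualNorm H x| ≤ ε) ∧
      ∀ x, H (gradient N x) ≤ 1 := by
  have hc := continuous_dualNorm hH
  obtain ⟨r, hr, hrε⟩ := Metric.continuousAt_iff.1 (hc.continuousAt (x := 0)) ε hε
  have h0 : dualNorm H 0 = 0 := map_zero (dualSeminorm hH)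
  let φ : ContDiffBump (0 : EuclideanSpace ℝ (Fin n)) := ⟨r / 2, r, half_pos hr, half_lt_self hr⟩
  set N : EuclideanSpace ℝ (Fin n) → ℝ :=
    (φ.normed volume ⋆[ContinuousLinearMap.lsmul ℝ ℝ, volume] dualNorm H) with hN
  have hNs : ContDiff ℝ ∞ N :=
    φ.hasCompactSupport_normed.contDiff_convolution_left _ φ.contDiff_normed
      hc.locallyIntegrable
  have habs : ∀ x y, |dualNorm H x - dualNorm H y| ≤ dualNorm H (x - y) := fun x y => by
    refine abs_le.2 ⟨?_, dualNorm_sub_le hH x y⟩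
    have := dualNorm_sub_le hH y x
    rw [← dualNorm_neg hH (y - x), neg_sub] at this
    linarith
  have hint : ∀ x, Integrable fun t => φ.normed volume t * dualNorm H (x - t) := fun x =>
    (φ.continuous_normed.mul (hc.comp (by fun_prop))).integrable_of_hasCompactSupport
      φ.hasCompactSupport_normed.mul_right
  have hNval : ∀ x, N x = ∫ t, φ.normed volume t * dualNorm H (x - t) := fun x => rfl
  -- Averaging translates keeps the function 1-Lipschitz for H₀. Hence every directional derivative
  -- satisfies ⟪∇N, v⟫ ≤ H₀(v), and biduality turns this into H(∇N) ≤ 1.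
  have hlip : ∀ x y, N x - N y ≤ dualNorm H (x - y) := by
    intro x y
    rw [hNval, hNval, ← integral_sub (hint x) (hint y)]
    calc ∫ t, (φ.normed volume t * dualNorm H (x - t) - φ.normed volume t * dualNorm H (y - t))
        ≤ ∫ t, φ.normed volume t * dualNorm H (x - y) := by
          refine integral_mono ((hint x).sub (hint y)) (φ.integrable_normed.mul_const _)
            fun t => ?_
          have := dualNorm_sub_le hH (x - t) (y - t)
          rw [sub_sub_sub_cancel_right] at this
          simp only
          rw [← mul_sub]
          exact mul_le_mul_of_nonneg_left this (φ.nonneg_normed t)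
      _ = dualNorm H (x - y) := by
          rw [integral_mul_const, φ.integral_normed, one_mul]
  refine ⟨N, hNs, fun x => ?_, fun x => ?_⟩
  · rw [← Real.dist_eq]
    refine φ.dist_normed_convolution_le hc.aestronglyMeasurable fun y hy => ?_
    rw [Real.dist_eq]
    refine (habs y x).trans ?_
    have := hrε (x := y - x) (by rw [dist_zero_right, ← dist_eq_norm]; exact hy)
    rw [h0, dist_zero_right, Real.norm_eq_abs] at this
    exact (le_abs_self _).trans this.le
  · refine seminorm_le_of_inner_le zero_le_one fun v => ?_
    rw [one_mul, real_inner_comm, gradient, InnerProductSpace.toDual_symm_apply]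
    have h1 := ((hNs.differentiable (by simp)) x).hasFDerivAt.hasLineDerivAt v
    refine le_of_tendsto h1.tendsto_slope_zero_right ?_
    filter_upwards [self_mem_nhdsWithin] with t ht
    have ht : 0 < t := ht
    have h2 := hlip (x + t • v) x
    rw [add_sub_cancel_left, dualNorm_smul hH, abs_of_pos ht] at h2
    rw [smul_eq_mul, inv_mul_le_iff₀ ht]
    exact h2

/-- Equivalence of norms: it confines the supports of all transplanted functions to one ball,
independently of the approximation. -/
theorem exists_norm_le_of_approx (hH : ∀ ξ, H ξ = 0 → ξ = 0) (R : ℝ) :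
    ∃ R' : ℝ, 0 < R' ∧ ∀ (x : EuclideanSpace ℝ (Fin n)) (y s : ℝ), |s - dualNorm H x| ≤ 1 →
      ‖(s, y)‖ ≤ R → ‖(x, y)‖ ≤ R' := by
  obtain ⟨c, hc, hcH⟩ := exists_pos_mul_norm_le (H := dualSeminorm hH) (fun x hx => by
    by_contra h
    exact (dualNorm_pos hH h).ne' hx)
  refine ⟨max 1 (max ((R + 1) / c) R), by positivity, fun x y s hs hR => ?_⟩
  rw [Prod.norm_def, max_le_iff] at hR ⊢
  constructor
  · refine le_max_of_le_right (le_max_of_le_left ?_)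
    rw [le_div_iff₀ hc, mul_comm]
    refine (hcH x).trans ?_
    rw [dualSeminorm_apply]
    have := (abs_le.1 hs).1
    have := (le_abs_self s).trans hR.1
    linarith
  · exact le_max_of_le_right (le_max_of_le_right hR.2)

/-- The transplanted function `(x, y) ↦ F (N x, y)`. -/
theorem contDiff_transplant {F : ℝ × ℝ → ℝ} (hF : ContDiff ℝ ∞ F)
    {N : EuclideanSpace ℝ (Fin n) → ℝ} (hN : ContDiff ℝ ∞ N) :
    ContDiff ℝ ∞ fun z : EuclideanSpace ℝ (Fin n) × ℝ => F (N z.1, z.2) :=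
  hF.comp ((hN.comp contDiff_fst).prodMk contDiff_snd)

theorem Phi_sq_grad_transplant_le {F : ℝ × ℝ → ℝ} (hF : Differentiable ℝ F)
    {N : EuclideanSpace ℝ (Fin n) → ℝ} (hN : Differentiable ℝ N)
    (hN1 : ∀ x, H (gradient N x) ≤ 1) (z : EuclideanSpace ℝ (Fin n) × ℝ) :
    Phi H (grad (fun z => F (N z.1, z.2)) z) ^ 2
      ≤ fderiv ℝ F (N z.1, z.2) (1, 0) ^ 2 + fderiv ℝ F (N z.1, z.2) (0, 1) ^ 2 := by
  have hd : HasFDerivAt (fun z : EuclideanSpace ℝ (Fin n) × ℝ => F (N z.1, z.2))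
      ((fderiv ℝ F (N z.1, z.2)).comp (((fderiv ℝ N z.1).comp
        (ContinuousLinearMap.fst ℝ _ ℝ)).prod (ContinuousLinearMap.snd ℝ _ ℝ))) z :=
    HasFDerivAt.comp z (hF (N z.1, z.2)).hasFDerivAt
      (((hN z.1).hasFDerivAt.comp z hasFDerivAt_fst).prodMk hasFDerivAt_snd)
  have hdiff : Differentiable ℝ fun z : EuclideanSpace ℝ (Fin n) × ℝ => F (N z.1, z.2) :=
    hF.comp ((hN.comp differentiable_fst).prodMk differentiable_snd)
  have e1 : (grad (fun z => F (N z.1, z.2)) z).1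
      = fderiv ℝ F (N z.1, z.2) (1, 0) • gradient N z.1 := by
    refine ext_inner_left ℝ fun ξ => ?_
    rw [inner_grad_fst hdiff, hd.fderiv, real_inner_smul_right, real_inner_comm, gradient,
      InnerProductSpace.toDual_symm_apply]
    simp only [ContinuousLinearMap.comp_apply, ContinuousLinearMap.prod_apply,
      ContinuousLinearMap.coe_fst', ContinuousLinearMap.coe_snd']
    rw [show (fderiv ℝ N z.1 ξ, (0 : ℝ)) = fderiv ℝ N z.1 ξ • ((1 : ℝ), (0 : ℝ)) by simp, map_smul,
      smul_eq_mul, mul_comm]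
  have e2 : (grad (fun z => F (N z.1, z.2)) z).2 = fderiv ℝ F (N z.1, z.2) (0, 1) := by
    rw [grad_snd hdiff, hd.fderiv]
    simp
  rw [Phi_sq, e1, e2, map_smul_eq_mul, mul_pow, Real.norm_eq_abs, sq_abs]
  have h1 : H (gradient N z.1) ^ 2 ≤ 1 := pow_le_one₀ (apply_nonneg H _) (hN1 _)
  have := mul_le_mul_of_nonneg_left h1 (sq_nonneg (fderiv ℝ F (N z.1, z.2) (1, 0)))
  linarith

/-- An inequality valid for all test functions extends to functions of the dual norm. -/
theorem inequality_of_dualNorm (hp : AngParams n α A) (hH : ∀ ξ, H ξ = 0 → ξ = 0) {C κ : ℝ}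
    (hC : ∀ u : EuclideanSpace ℝ (Fin n) × ℝ → ℝ, ContDiff ℝ ∞ u → HasCompactSupport u →
      C * (∫ x, traceDensity H α u x) + κ * (∫ z in upperHalfSpace n, hardyDensity H α u z)
        ≤ ∫ z in upperHalfSpace n, energyDensity H α u z)
    {F : ℝ × ℝ → ℝ} (hF : ContDiff ℝ ∞ F) (hFc : HasCompactSupport F) :
    (Integrable fun x => F (dualNorm H x, 0) ^ 2 / dualNorm H x ^ (1 - α)) ∧
    IntegrableOn (fun z => z.2 ^ α * (F (dualNorm H z.1, z.2) ^ 2 / Phi0 H z ^ 2))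
      (upperHalfSpace n) ∧
    IntegrableOn (fun z => z.2 ^ α * (fderiv ℝ F (dualNorm H z.1, z.2) (1, 0) ^ 2
      + fderiv ℝ F (dualNorm H z.1, z.2) (0, 1) ^ 2)) (upperHalfSpace n) ∧
    C * (∫ x, F (dualNorm H x, 0) ^ 2 / dualNorm H x ^ (1 - α))
      + κ * (∫ z in upperHalfSpace n,
        z.2 ^ α * (F (dualNorm H z.1, z.2) ^ 2 / Phi0 H z ^ 2))
      ≤ ∫ z in upperHalfSpace n, z.2 ^ α * (fderiv ℝ F (dualNorm H z.1, z.2) (1, 0) ^ 2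
        + fderiv ℝ F (dualNorm H z.1, z.2) (0, 1) ^ 2) := by
  have hFcont := hF.continuous
  have hF1 : ContDiff ℝ 1 F := hF.of_le (by simp)
  have hdc := continuous_dualNorm hH
  set G : ℝ × ℝ → ℝ := fun p => fderiv ℝ F p (1, 0) ^ 2 + fderiv ℝ F p (0, 1) ^ 2 with hG
  have hGc : Continuous G :=
    ((continuous_fderiv_apply hF1 _).pow 2).add ((continuous_fderiv_apply hF1 _).pow 2)
  have hG0 : ∀ p, p ∉ tsupport F → G p = 0 := fun p hp => by
    simp [hG, fderiv_of_notMem_tsupport ℝ hp]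
  have hGs : HasCompactSupport G := .intro hFc hG0
  obtain ⟨M1, hM1⟩ := hFc.exists_bound_of_continuous hFcont
  obtain ⟨M2, hM2⟩ := hGs.exists_bound_of_continuous hGc
  obtain ⟨R, hR⟩ := hFc.isCompact.isBounded.exists_norm_le
  obtain ⟨R', hR', hRR⟩ := exists_norm_le_of_approx hH R
  -- A cutoff equal to 1 on a ball containing all supports. Its own trace and Hardy densities,
  -- already known to be integrable, serve as dominating functions, which settles the singular
  -- weights.
  let χ : ContDiffBump (0 : EuclideanSpace ℝ (Fin n) × ℝ) := ⟨R', R' + 1, hR', by linarith⟩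
  have hχ : ContDiff ℝ 1 χ := χ.contDiff
  have iT := (integrable_traceDensity (u := χ) hp hH hχ χ.hasCompactSupport).const_mul (M1 ^ 2)
  have iS := (integrableOn_hardyDensity (u := χ) hp hH hχ χ.hasCompactSupport).const_mul (M1 ^ 2)
  have iE : IntegrableOn (fun z => z.2 ^ α * (M2 * χ z)) (upperHalfSpace n) := by
    refine integrableOn_rpow_mul_of_bounded hp.neg_one_lt (hχ.continuous.measurable.const_mul _)
      (M := |M2|) (R := R' + 1) (fun z => ?_) fun z hz => ?_
    · rw [abs_mul, abs_of_nonneg χ.nonneg]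
      exact mul_le_of_le_one_right (abs_nonneg _) χ.le_one
    · rw [χ.zero_of_le_dist (by rw [dist_zero_right]; exact hz.le), mul_zero]
  have bF : ∀ (x : EuclideanSpace ℝ (Fin n)) (y s : ℝ), |s - dualNorm H x| ≤ 1 →
      F (s, y) ^ 2 ≤ M1 ^ 2 * χ (x, y) ^ 2 ∧ G (s, y) ≤ M2 * χ (x, y) ∧
        (χ (x, y) ≠ 1 → F (s, y) = 0) := by
    intro x y s hs
    have hM10 : 0 ≤ M1 := (norm_nonneg _).trans (hM1 0)
    have hM20 : 0 ≤ M2 := (norm_nonneg _).trans (hM2 0)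
    by_cases h : ‖(x, y)‖ ≤ R'
    · have h1 : χ (x, y) = 1 := χ.one_of_mem_closedBall (by simpa using h)
      rw [h1]
      refine ⟨?_, ?_, fun h' => absurd rfl h'⟩
      · rw [one_pow, mul_one, ← sq_abs (F (s, y))]
        have := hM1 (s, y)
        rw [Real.norm_eq_abs] at this
        gcongr
      · rw [mul_one]; exact (le_abs_self _).trans (hM2 (s, y))
    · have hnot : (s, y) ∉ tsupport F := fun hmem => h (hRR x y s hs (hR _ hmem))
      rw [hG0 _ hnot, image_eq_zero_of_notMem_tsupport hnot]
      refine ⟨?_, mul_nonneg hM20 χ.nonneg, fun _ => rfl⟩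
      rw [zero_pow two_ne_zero]; positivity
  have hεpos : ∀ k : ℕ, (0 : ℝ) < 1 / (k + 1) := fun k => by positivity
  choose N hNs hNa hN1 using fun k : ℕ => exists_smooth_approx_dualNorm (H := H) hH (hεpos k)
  have hNa1 : ∀ k x, |N k x - dualNorm H x| ≤ 1 := fun k x => (hNa k x).trans (by
    rw [div_le_one (by positivity)]
    have : (0 : ℝ) ≤ k := k.cast_nonneg
    linarith)
  have hNt : ∀ x, Tendsto (fun k => N k x) atTop (𝓝 (dualNorm H x)) := fun x => by
    rw [tendsto_iff_dist_tendsto_zero]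
    exact squeeze_zero (fun _ => dist_nonneg) (fun k => hNa k x)
      tendsto_one_div_add_atTop_nhds_zero_nat
  have hd0 : ∀ x, |dualNorm H x - dualNorm H x| ≤ 1 := fun x => by simp
  -- domination
  have dT : ∀ x s, |s - dualNorm H x| ≤ 1 →
      ‖F (s, 0) ^ 2 / dualNorm H x ^ (1 - α)‖ ≤ M1 ^ 2 * traceDensity H α χ x := by
    intro x s hs
    have := dualNorm_nonneg hH x
    rw [Real.norm_of_nonneg (by positivity), traceDensity, ← mul_div_assoc]
    have := (bF x 0 s hs).1
    gcongr
  have dS : ∀ z ∈ upperHalfSpace n, ∀ s, |s - dualNorm H z.1| ≤ 1 →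
      ‖z.2 ^ α * (F (s, z.2) ^ 2 / Phi0 H z ^ 2)‖ ≤ M1 ^ 2 * hardyDensity H α χ z := by
    intro z hz s hs
    have hz : 0 < z.2 := hz
    rw [Real.norm_of_nonneg (by positivity), hardyDensity, mul_div_assoc, mul_left_comm,
      ← mul_div_assoc (M1 ^ 2)]
    have := (bF z.1 z.2 s hs).1
    gcongr
  have dE : ∀ z ∈ upperHalfSpace n, ∀ s, |s - dualNorm H z.1| ≤ 1 →
      ‖z.2 ^ α * G (s, z.2)‖ ≤ z.2 ^ α * (M2 * χ z) := by
    intro z hz s hs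
    have hz : 0 < z.2 := hz
    have hGn : 0 ≤ G (s, z.2) := by simp only [hG]; positivity
    rw [Real.norm_of_nonneg (by positivity)]
    have := (bF z.1 z.2 s hs).2.1
    gcongr
  -- measurability
  have mT : ∀ {g : EuclideanSpace ℝ (Fin n) → ℝ}, Continuous g →
      Measurable fun x => F (g x, 0) ^ 2 / dualNorm H x ^ (1 - α) := fun hg => by
    have h1 : Measurable fun x => F (_, 0) := (hFcont.comp (hg.prodMk continuous_const)).measurable
    have := hdc.measurable
    fun_prop
  have mS : ∀ {g : EuclideanSpace ℝ (Fin n) → ℝ}, Continuous g → Measurable fun z :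
      EuclideanSpace ℝ (Fin n) × ℝ => z.2 ^ α * (F (g z.1, z.2) ^ 2 / Phi0 H z ^ 2) := fun hg => by
    have h1 : Measurable fun z : EuclideanSpace ℝ (Fin n) × ℝ => F (_, z.2) :=
      (hFcont.comp ((hg.comp continuous_fst).prodMk continuous_snd)).measurable
    have := hdc.measurable
    simp_rw [Phi0_sq]
    fun_prop
  have mE : ∀ {g : EuclideanSpace ℝ (Fin n) → ℝ}, Continuous g → Measurable fun z :
      EuclideanSpace ℝ (Fin n) × ℝ => z.2 ^ α * G (g z.1, z.2) := fun hg => by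
    have h1 : Measurable fun z : EuclideanSpace ℝ (Fin n) × ℝ => G (_, z.2) :=
      (hGc.comp ((hg.comp continuous_fst).prodMk continuous_snd)).measurable
    exact (by fun_prop : Measurable fun z : EuclideanSpace ℝ (Fin n) × ℝ => z.2 ^ α).mul h1
  have hae : ∀ {p : EuclideanSpace ℝ (Fin n) × ℝ → Prop}, (∀ z ∈ upperHalfSpace n, p z) →
      ∀ᵐ z ∂(volume.restrict (upperHalfSpace n)), p z := fun h => by
    filter_upwards [ae_restrict_mem (measurableSet_upperHalfSpace n)] with z hz using h z hz
  refine ⟨iT.mono' (mT hdc).aestronglyMeasurable (Eventually.of_forall fun x => dT x _ (hd0 x)),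
    iS.mono' (mS hdc).aestronglyMeasurable (hae fun z hz => dS z hz _ (hd0 _)),
    iE.mono' (mE hdc).aestronglyMeasurable (hae fun z hz => dE z hz _ (hd0 _)), ?_⟩
  have lT : Tendsto (fun k => ∫ x, F (N k x, 0) ^ 2 / dualNorm H x ^ (1 - α)) atTop
      (𝓝 (∫ x, F (dualNorm H x, 0) ^ 2 / dualNorm H x ^ (1 - α))) := by
    refine tendsto_integral_of_dominated_convergence _
      (fun k => (mT (hNs k).continuous).aestronglyMeasurable) iT
      (fun k => Eventually.of_forall fun x => dT x _ (hNa1 k x))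
      (Eventually.of_forall fun x => ?_)
    have : Continuous fun s => F (s, 0) ^ 2 / dualNorm H x ^ (1 - α) := by fun_prop
    exact (this.tendsto _).comp (hNt x)
  have lS : Tendsto (fun k => ∫ z in upperHalfSpace n,
      z.2 ^ α * (F (N k z.1, z.2) ^ 2 / Phi0 H z ^ 2)) atTop
      (𝓝 (∫ z in upperHalfSpace n,
        z.2 ^ α * (F (dualNorm H z.1, z.2) ^ 2 / Phi0 H z ^ 2))) := by
    refine tendsto_integral_of_dominated_convergence _
      (fun k => (mS (hNs k).continuous).aestronglyMeasurable) iS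
      (fun k => hae fun z hz => dS z hz _ (hNa1 k z.1)) (Eventually.of_forall fun z => ?_)
    have : Continuous fun s => z.2 ^ α * (F (s, z.2) ^ 2 / Phi0 H z ^ 2) := by fun_prop
    exact (this.tendsto _).comp (hNt z.1)
  have lE : Tendsto (fun k => ∫ z in upperHalfSpace n, z.2 ^ α * G (N k z.1, z.2)) atTop
      (𝓝 (∫ z in upperHalfSpace n, z.2 ^ α * G (dualNorm H z.1, z.2))) := by
    refine tendsto_integral_of_dominated_convergence _
      (fun k => (mE (hNs k).continuous).aestronglyMeasurable) iE
      (fun k => hae fun z hz => dE z hz _ (hNa1 k z.1)) (Eventually.of_forall fun z => ?_)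
    have : Continuous fun s => z.2 ^ α * G (s, z.2) := by fun_prop
    exact (this.tendsto _).comp (hNt z.1)
  -- The trace and Hardy terms converge to their limits, so the signs of `C` and `κ` do not matter.
  -- Only the energy is estimated, through H(∇N) ≤ 1.
  refine le_of_tendsto_of_tendsto' ((lT.const_mul C).add (lS.const_mul κ)) lE fun k => ?_
  set u : EuclideanSpace ℝ (Fin n) × ℝ → ℝ := fun z => F (N k z.1, z.2) with hu
  have hus : ContDiff ℝ ∞ u := contDiff_transplant hF (hNs k)
  have huc : HasCompactSupport u := by
    refine HasCompactSupport.intro (isCompact_closedBall 0 (R' + 1)) fun z hz => ?_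
    refine (bF z.1 z.2 _ (hNa1 k z.1)).2.2 ?_
    rw [χ.zero_of_le_dist]
    · exact zero_ne_one
    · rw [Metric.mem_closedBall, not_le] at hz
      exact hz.le
  have h := hC u hus huc
  have hS : ∀ z, hardyDensity H α u z = z.2 ^ α * (F (N k z.1, z.2) ^ 2 / Phi0 H z ^ 2) :=
    fun z => by rw [hardyDensity, mul_div_assoc]
  simp_rw [hS] at h
  refine h.trans (setIntegral_mono_on
    (integrableOn_energyDensity hp.neg_one_lt (hus.of_le (by simp)) huc)
    (iE.mono' (mE (hNs k).continuous).aestronglyMeasurable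
      (hae fun z hz => dE z hz _ (hNa1 k z.1))) (measurableSet_upperHalfSpace n) fun z hz => ?_)
  have hz : 0 < z.2 := hz
  exact mul_le_mul_of_nonneg_left (Phi_sq_grad_transplant_le (hF1.differentiable (by simp))
    ((hNs k).differentiable (by simp)) (hN1 k) z) (Real.rpow_nonneg hz.le _)

end FinslerHardy

namespace FinslerHardy
open Set Filter Topology ProbabilityTheory

variable {n : ℕ} {H : Seminorm ℝ (EuclideanSpace ℝ (Fin n))} {α A : ℝ}

/-! ### Integrals of functions of the dual norm. -/

section RadialIntegral

/-- The surface constant of the unit sphere of the dual norm. -/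
noncomputable def sphereConst (H : Seminorm ℝ (EuclideanSpace ℝ (Fin n))) : ENNReal :=
  ∫⁻ w : Metric.sphere (0 : EuclideanSpace ℝ (Fin n)) 1,
    ENNReal.ofReal ((dualNorm H w)⁻¹ ^ n) ∂(volume : Measure (EuclideanSpace ℝ (Fin n))).toSphere

/-- In polar coordinates adapted to H₀ the inner integral does not depend on the direction and
factors out. -/
theorem lintegral_comp_dualNorm (hn : 1 ≤ n) (hH : ∀ ξ, H ξ = 0 → ξ = 0) {f : ℝ → ENNReal}
    (hf : Measurable f) :
    ∫⁻ x, f (dualNorm H x)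
      = sphereConst H * ∫⁻ r in Ioi (0 : ℝ), ENNReal.ofReal (r ^ (n - 1)) * f r := by
  have hm := (continuous_dualNorm hH).measurable
  rw [lintegral_polar_norm hn (f := fun x => f (dualNorm H x)) (hf.comp hm) (fun x hx => dualNorm_pos hH hx), sphereConst,
    ← lintegral_mul_const _ (by fun_prop)]
  refine lintegral_congr fun w => ?_
  congr 1
  refine setLIntegral_congr_fun measurableSet_Ioi fun r hr => ?_
  have hr : 0 < r := hr
  have hw : 0 < dualNorm H w := dualNorm_pos hH fun h0 => by
    have := w.2
    rw [h0] at this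
    simp at this
  rw [dualNorm_smul hH, dualNorm_smul hH, abs_of_pos hr, abs_of_pos (inv_pos.2 hw),
    inv_mul_cancel₀ hw.ne', mul_one]

/-- Otherwise the formula applied to the constant 1 would give the whole space measure zero. -/
theorem sphereConst_ne_zero (hn : 1 ≤ n) (hH : ∀ ξ, H ξ = 0 → ξ = 0) : sphereConst H ≠ 0 := by
  intro h
  have := lintegral_comp_dualNorm hn hH (f := fun _ => 1) measurable_const
  rw [h, zero_mul, lintegral_one] at this
  exact (Measure.measure_univ_ne_zero.2 (NeZero.ne _)) this

theorem sphereConst_ne_top (hH : ∀ ξ, H ξ = 0 → ξ = 0) : sphereConst H ≠ ⊤ := by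
  obtain ⟨c, hc, hcH⟩ := exists_pos_mul_norm_le (H := dualSeminorm hH) (fun x hx => by
    by_contra h
    exact (dualNorm_pos hH h).ne' hx)
  refine ne_top_of_le_ne_top (b := ∫⁻ _ : Metric.sphere (0 : EuclideanSpace ℝ (Fin n)) 1,
    ENNReal.ofReal (c⁻¹ ^ n) ∂(volume : Measure (EuclideanSpace ℝ (Fin n))).toSphere) ?_
    (lintegral_mono fun w => ENNReal.ofReal_le_ofReal ?_)
  · rw [lintegral_const]
    exact ENNReal.mul_ne_top ENNReal.ofReal_ne_top (measure_ne_top _ _)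
  · have h1 : c ≤ dualNorm H w := by
      have h2 := hcH w
      have h3 : ‖(w : EuclideanSpace ℝ (Fin n))‖ = 1 := by simp
      rwa [h3, mul_one] at h2
    have := hc.trans_le h1
    gcongr

theorem lintegral_upperHalfSpace_comp_dualNorm (hn : 1 ≤ n) (hH : ∀ ξ, H ξ = 0 → ξ = 0)
    {f : ℝ → ℝ → ENNReal} (hf : Measurable (Function.uncurry f)) :
    ∫⁻ z in upperHalfSpace n, f (dualNorm H z.1) z.2
      = sphereConst H * ∫⁻ r in Ioi (0 : ℝ), ENNReal.ofReal (r ^ (n - 1)) *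
          ∫⁻ y in Ioi (0 : ℝ), f r y := by
  have hm := (continuous_dualNorm hH).measurable
  have h1 : Measurable fun z : EuclideanSpace ℝ (Fin n) × ℝ => (dualNorm H z.1, z.2) := by fun_prop
  rw [lintegral_upperHalfSpace (f := fun z => f (dualNorm H z.1) z.2) (hf.comp h1)]
  exact lintegral_comp_dualNorm hn hH hf.lintegral_prod_right'

end RadialIntegral

/-! ### Separated test functions on the plane. -/

section TestFunction

variable {φ : ℝ → ℝ} {δ : ℝ}

/-- The test function with radial part `φ` and angular part the `δ`-shift of the extremal
function. -/
noncomputable def testFunction (n : ℕ) (α A δ : ℝ) (φ : ℝ → ℝ) (p : ℝ × ℝ) : ℝ :=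
  φ (Real.sqrt (p.1 ^ 2 + p.2 ^ 2)) * angProfile n α A (p.2 ^ 2 / (p.1 ^ 2 + p.2 ^ 2) + δ)

theorem norm_le_sqrt (p : ℝ × ℝ) : ‖p‖ ≤ Real.sqrt (p.1 ^ 2 + p.2 ^ 2) := by
  rw [Prod.norm_def, max_le_iff, Real.norm_eq_abs, Real.norm_eq_abs]
  exact ⟨Real.abs_le_sqrt (by nlinarith [sq_nonneg p.2]),
    Real.abs_le_sqrt (by nlinarith [sq_nonneg p.1])⟩

/-- At the origin the function is locally zero because φ is; elsewhere the square root is smooth and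
the argument of the profile is at least δ, away from its singular point 0. -/
theorem contDiff_testFunction (hp : AngParams n α A) (hδ : 0 < δ) (hφ : ContDiff ℝ ∞ φ)
    {ε : ℝ} (hε : 0 < ε) (hφ0 : ∀ ρ, |ρ| < ε → φ ρ = 0) :
    ContDiff ℝ ∞ (testFunction n α A δ φ) := by
  rw [contDiff_iff_contDiffAt]
  intro p
  rcases eq_or_ne p 0 with rfl | hp0
  · refine (contDiffAt_const (c := (0 : ℝ))).congr_of_eventuallyEq ?_
    have hc : Continuous fun p : ℝ × ℝ => Real.sqrt (p.1 ^ 2 + p.2 ^ 2) := by fun_prop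
    have : ∀ᶠ p : ℝ × ℝ in 𝓝 0, Real.sqrt (p.1 ^ 2 + p.2 ^ 2) < ε :=
      hc.continuousAt.eventually_lt continuousAt_const (by simpa using hε)
    filter_upwards [this] with p hpε
    rw [testFunction, hφ0 _ (by rwa [abs_of_nonneg (Real.sqrt_nonneg _)]), zero_mul]
  · have hpos : 0 < p.1 ^ 2 + p.2 ^ 2 := by
      by_contra h
      have h1 : p.1 = 0 := by nlinarith [sq_nonneg p.1, sq_nonneg p.2]
      have h2 : p.2 = 0 := by nlinarith [sq_nonneg p.1, sq_nonneg p.2]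
      exact hp0 (Prod.ext h1 h2)
    have hq : ContDiffAt ℝ ∞ (fun p : ℝ × ℝ => p.1 ^ 2 + p.2 ^ 2) p := by fun_prop
    refine ContDiffAt.mul ?_ ?_
    · exact hφ.contDiffAt.comp p (hq.sqrt hpos.ne')
    · refine ContDiffAt.comp p (g := angProfile n α A)
        (f := fun p : ℝ × ℝ => p.2 ^ 2 / (p.1 ^ 2 + p.2 ^ 2) + δ)
        (hp.contDiffAt_angProfile (by positivity)) ?_
      exact ((by fun_prop : ContDiffAt ℝ ∞ (fun p : ℝ × ℝ => p.2 ^ 2) p).div hq hpos.ne').add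
        contDiffAt_const

theorem hasCompactSupport_testFunction {R : ℝ} (hφR : ∀ ρ, R < |ρ| → φ ρ = 0) :
    HasCompactSupport (testFunction n α A δ φ) := by
  refine HasCompactSupport.intro (isCompact_closedBall 0 R) fun p hp => ?_
  rw [Metric.mem_closedBall, dist_zero_right, not_le] at hp
  rw [testFunction, hφR _ ((hp.trans_le (norm_le_sqrt p)).trans_le (le_abs_self _)), zero_mul]

theorem testFunction_polar {ρ : ℝ} (hρ : 0 < ρ) (θ : ℝ) :
    testFunction n α A δ φ (ρ * Real.cos θ, ρ * Real.sin θ)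
      = φ ρ * angProfile n α A (Real.sin θ ^ 2 + δ) := by
  rw [testFunction]
  simp only
  rw [sq_polar_add_sq_polar, Real.sqrt_sq hρ.le, mul_pow,
    mul_div_cancel_left₀ _ (pow_pos hρ 2).ne']

theorem polarRadial_testFunction (hF : Differentiable ℝ (testFunction n α A δ φ))
    (hφ : Differentiable ℝ φ) {ρ : ℝ} (hρ : 0 < ρ) (θ : ℝ) :
    polarRadial (testFunction n α A δ φ) ρ θ
      = deriv φ ρ * angProfile n α A (Real.sin θ ^ 2 + δ) := by
  have h1 := hasDerivAt_polar_radius hF ρ θ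
  have h2 := (hφ ρ).hasDerivAt.mul_const (angProfile n α A (Real.sin θ ^ 2 + δ))
  refine h1.unique (h2.congr_of_eventuallyEq ?_)
  filter_upwards [Ioi_mem_nhds hρ] with r hr using testFunction_polar hr θ

theorem polarAngular_testFunction (hp : AngParams n α A) (hδ : 0 < δ)
    (hF : Differentiable ℝ (testFunction n α A δ φ)) {ρ : ℝ} (hρ : 0 < ρ) (θ : ℝ) :
    polarAngular (testFunction n α A δ φ) ρ θ = φ ρ *
      (angProfileDeriv n α A (Real.sin θ ^ 2 + δ) * (2 * Real.sin θ * Real.cos θ)) := by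
  have h1 := hasDerivAt_polar_angle hF ρ θ
  have h2 := ((hp.hasDerivAt_angProfile (show 0 < Real.sin θ ^ 2 + δ by positivity)).comp θ
    (((Real.hasDerivAt_sin θ).pow 2).add_const δ)).const_mul (φ ρ)
  rw [funext (testFunction_polar hρ)] at h1
  rw [h1.unique h2]
  simp

end TestFunction

/-! ### Optimality of the angular constant. -/

theorem integrableOn_Ioi_mul_rpow {f : ℝ → ℝ} (hf : Continuous f) {s R : ℝ} (hs : -1 < s)
    (hR : 0 ≤ R) (hfR : ∀ ρ, R < ρ → f ρ = 0) :
    IntegrableOn (fun ρ => f ρ * ρ ^ s) (Ioi 0) := by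
  refine (integrableOn_continuous_mul_rpow hf hs hR).of_forall_sdiff_eq_zero measurableSet_Ioi
    fun ρ hρ => ?_
  have : R < ρ := by
    by_contra h
    exact hρ.2 ⟨le_of_lt hρ.1, not_lt.1 h⟩
  rw [hfR ρ this, zero_mul]

/-- Optimality of the constant. -/
theorem le_angConst (hp : AngParams n α A) (hH : ∀ ξ, H ξ = 0 → ξ = 0) {C : ℝ}
    (hC : ∀ u : EuclideanSpace ℝ (Fin n) × ℝ → ℝ, ContDiff ℝ ∞ u → HasCompactSupport u →
      C * (∫ x, traceDensity H α u x) + ((n + α - 1) / 2 - 2 * A) ^ 2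
        * (∫ z in upperHalfSpace n, hardyDensity H α u z)
        ≤ ∫ z in upperHalfSpace n, energyDensity H α u z) :
    C ≤ angConst n α A := by
  have hn := hp.one_le
  have hm := measurable_angWeight n α
  set P := angProfile n α A with hP
  set γ := ((n : ℝ) + α - 1) / 2 with hγ
  set lam := 4 * (A * (n / 2 - (A + (1 - α) / 2))) with hlam
  have hlam0 : 0 < lam := by
    have := hp.pos
    have : 0 < n / 2 - (A + (1 - α) / 2) := by linarith [hp.lt]
    positivity
  have hγ0 : 0 < γ := by linarith [hp.lt, hp.pos]
  have hsplit : γ ^ 2 = (γ - 2 * A) ^ 2 + lam := by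
    rw [hlam, hγ]; ring
  have hpow1 : (n : ℝ) + α - 2 = 2 * γ - 1 := by rw [hγ]; ring
  have hpow2 : (n : ℝ) + α = 2 * γ + 1 := by rw [hγ]; ring
  have hcpos : 0 < (sphereConst H).toReal :=
    ENNReal.toReal_pos (sphereConst_ne_zero hn hH) (sphereConst_ne_top hH)
  have step : ∀ δ > 0, C * P δ ^ 2 ≤ angConst n α A * P 0 ^ 2 := by
    intro δ hδ
    set g : ℝ → ℝ := fun θ => P (Real.sin θ ^ 2 + δ) with hg
    set g' : ℝ → ℝ := fun θ =>
      angProfileDeriv n α A (Real.sin θ ^ 2 + δ) * (2 * Real.sin θ * Real.cos θ) with hg'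
    have mg : Measurable g := by
      refine Continuous.measurable (continuous_iff_continuousAt.2 fun θ => ?_)
      exact ContinuousAt.comp (g := P) (f := fun θ => Real.sin θ ^ 2 + δ)
        (hp.hasDerivAt_angProfile (by positivity)).continuousAt (by fun_prop)
    have mg' : Measurable g' := by
      refine Continuous.measurable (continuous_iff_continuousAt.2 fun θ => ?_)
      refine ContinuousAt.mul (ContinuousAt.comp (g := angProfileDeriv n α A)
        (f := fun θ => Real.sin θ ^ 2 + δ)
        (hp.hasDerivAt_angProfileDeriv (by positivity)).continuousAt (by fun_prop)) (by fun_prop)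
    -- X and Y are the angular mass and Dirichlet energy of the shifted profile; I and I' below are
    -- their radial counterparts for φ.
    set X := ∫⁻ θ in Ioo 0 (Real.pi / 2), ENNReal.ofReal (angWeight n α θ * g θ ^ 2) with hX
    set Y := ∫⁻ θ in Ioo 0 (Real.pi / 2), ENNReal.ofReal (angWeight n α θ * g' θ ^ 2) with hY
    have hXY : Y + ENNReal.ofReal lam * X ≤ ENNReal.ofReal (angConst n α A * P 0 ^ 2) := by
      refine le_trans (le_of_eq ?_) (hp.angular_energy_le hδ.le)
      rw [hX, hY, ← lintegral_const_mul' _ _ ENNReal.ofReal_ne_top,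
        ← lintegral_add_left (by fun_prop)]
      refine setLIntegral_congr_fun measurableSet_Ioo fun θ hθ => ?_
      have hw := angWeight_nonneg n α hθ
      rw [← ENNReal.ofReal_mul hlam0.le, ← ENNReal.ofReal_add (by positivity) (by positivity)]
      congr 1
      simp only [hg, hg', hlam]
      ring
    have hYt : Y ≠ ⊤ := fun h => by simp [h] at hXY
    have hXt : X ≠ ⊤ := fun h => by
      rw [h, ENNReal.mul_top (by simpa using hlam0)] at hXY
      simp at hXY
    have hXYr : Y.toReal + lam * X.toReal ≤ angConst n α A * P 0 ^ 2 := by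
      have h1 := ENNReal.toReal_mono ENNReal.ofReal_ne_top hXY
      rwa [ENNReal.toReal_add hYt (ENNReal.mul_ne_top ENNReal.ofReal_ne_top hXt),
        ENNReal.toReal_mul, ENNReal.toReal_ofReal hlam0.le, ENNReal.toReal_ofReal
        (mul_nonneg hp.angConst_pos.le (sq_nonneg _))] at h1
    have almost : ∀ η > 0, C * P δ ^ 2 ≤ angConst n α A * P 0 ^ 2 + η * X.toReal := by
      intro η hη
      obtain ⟨φ, hφ, ⟨ε, hε, hφ0⟩, ⟨R, hR, hφR⟩, hIpos, hIle⟩ :=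
        exists_radial_almost_optimal hγ0 hη
      have hφc := hφ.continuous
      have hφ'c : Continuous (deriv φ) := hφ.continuous_deriv (by simp)
      have hφ'R : ∀ ρ, R < ρ → deriv φ ρ = 0 := fun ρ hρ => by
        have : φ =ᶠ[𝓝 ρ] fun _ => 0 := by
          filter_upwards [Ioi_mem_nhds hρ] with r hr using hφR r (lt_of_lt_of_le hr (le_abs_self r))
        rw [this.deriv_eq]; simp
      set I := ∫⁻ ρ in Ioi (0 : ℝ), ENNReal.ofReal (φ ρ ^ 2 * ρ ^ (2 * γ - 1)) with hI
      set I' := ∫⁻ ρ in Ioi (0 : ℝ), ENNReal.ofReal (deriv φ ρ ^ 2 * ρ ^ (2 * γ + 1)) with hI'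
      have hnn : ∀ (f : ℝ → ℝ) (s : ℝ),
          0 ≤ᵐ[volume.restrict (Ioi (0 : ℝ))] fun ρ => f ρ ^ 2 * ρ ^ s := fun f s => by
        filter_upwards [ae_restrict_mem measurableSet_Ioi] with ρ hρ
        have : (0 : ℝ) < ρ := hρ
        positivity
      have iI := integrableOn_Ioi_mul_rpow (f := fun ρ => φ ρ ^ 2) (by fun_prop)
        (show -1 < 2 * γ - 1 by linarith) hR.le
        (fun ρ hρ => by simp [hφR ρ (lt_of_lt_of_le hρ (le_abs_self ρ))])
      have iI' := integrableOn_Ioi_mul_rpow (f := fun ρ => deriv φ ρ ^ 2) (by fun_prop)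
        (show -1 < 2 * γ + 1 by linarith) hR.le (fun ρ hρ => by simp [hφ'R ρ hρ])
      have eI := ofReal_integral_eq_lintegral_ofReal iI (hnn φ _)
      have eI' := ofReal_integral_eq_lintegral_ofReal iI' (hnn (deriv φ) _)
      have hIt : I ≠ ⊤ := by rw [hI, ← eI]; exact ENNReal.ofReal_ne_top
      have hI't : I' ≠ ⊤ := by rw [hI', ← eI']; exact ENNReal.ofReal_ne_top
      have rI : I.toReal = ∫ ρ in Ioi (0 : ℝ), φ ρ ^ 2 * ρ ^ (2 * γ - 1) := by
        rw [hI, ← eI, ENNReal.toReal_ofReal (integral_nonneg_of_ae (hnn _ _))]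
      have rI' : I'.toReal = ∫ ρ in Ioi (0 : ℝ), deriv φ ρ ^ 2 * ρ ^ (2 * γ + 1) := by
        rw [hI', ← eI', ENNReal.toReal_ofReal (integral_nonneg_of_ae (hnn _ _))]
      rw [← rI] at hIpos hIle
      rw [← rI'] at hIle
      set F := testFunction n α A δ φ with hF
      have hFs : ContDiff ℝ ∞ F := contDiff_testFunction hp hδ hφ hε hφ0
      have hFc : HasCompactSupport F := hasCompactSupport_testFunction hφR
      have hF1 : ContDiff ℝ 1 F := hFs.of_le (by simp)
      have hFd := hF1.differentiable (by simp)
      have mF := hF1.continuous.measurable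
      obtain ⟨-, -, -, key⟩ := inequality_of_dualNorm hp hH hC hFs hFc
      have hdn := dualNorm_nonneg hH
      -- the trace term
      have eT : ∫ x, F (dualNorm H x, 0) ^ 2 / dualNorm H x ^ (1 - α)
          = (sphereConst H).toReal * (P δ ^ 2 * I.toReal) := by
        have m1 : Measurable fun r => F (r, 0) := mF.comp (by fun_prop)
        have mT : Measurable fun r => F (r, 0) ^ 2 / r ^ (1 - α) := by fun_prop
        rw [integral_eq_lintegral_of_nonneg_ae
          (f := fun x => F (dualNorm H x, 0) ^ 2 / dualNorm H x ^ (1 - α))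
          (Eventually.of_forall fun x => by have := hdn x; positivity)
          (mT.comp (continuous_dualNorm hH).measurable).aestronglyMeasurable,
          lintegral_comp_dualNorm hn hH (f := fun r => ENNReal.ofReal (F (r, 0) ^ 2 / r ^ (1 - α)))
          mT.ennreal_ofReal, ENNReal.toReal_mul]
        congr 1
        have : ∫⁻ r in Ioi (0 : ℝ), ENNReal.ofReal (r ^ (n - 1)) *
            ENNReal.ofReal (F (r, 0) ^ 2 / r ^ (1 - α)) = ENNReal.ofReal (P δ ^ 2) * I := by
          rw [hI, ← lintegral_const_mul' _ _ ENNReal.ofReal_ne_top]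
          refine setLIntegral_congr_fun measurableSet_Ioi fun r hr => ?_
          have hr : 0 < r := hr
          have hFr : F (r, 0) = φ r * P δ := by
            have := testFunction_polar (n := n) (α := α) (A := A) (δ := δ) (φ := φ) hr 0
            simpa using this
          rw [← ENNReal.ofReal_mul (by positivity), ← ENNReal.ofReal_mul (by positivity), hFr,
            ← hpow1]
          congr 1
          obtain ⟨k, rfl⟩ : ∃ k, n = k + 1 := ⟨n - 1, by omega⟩
          simp only [Nat.add_sub_cancel]
          rw [show ((k + 1 : ℕ) : ℝ) + α - 2 = k - (1 - α) by push_cast; ring,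
            Real.rpow_sub hr k, Real.rpow_natCast]
          ring
        rw [this, ENNReal.toReal_mul, ENNReal.toReal_ofReal (sq_nonneg _)]
      -- the Hardy term
      have eS : ∫ z in upperHalfSpace n, z.2 ^ α * (F (dualNorm H z.1, z.2) ^ 2 / Phi0 H z ^ 2)
          = (sphereConst H).toReal * (I.toReal * X.toReal) := by
        have mS : Measurable (Function.uncurry fun r y : ℝ =>
            y ^ α * (F (r, y) ^ 2 / (r ^ 2 + y ^ 2))) := by
          unfold Function.uncurry; fun_prop
        have h1 : Measurable fun z : EuclideanSpace ℝ (Fin n) × ℝ => (dualNorm H z.1, z.2) := by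
          have := (continuous_dualNorm hH).measurable
          fun_prop
        simp_rw [Phi0_sq]
        rw [integral_eq_lintegral_of_nonneg_ae
          (f := fun z : EuclideanSpace ℝ (Fin n) × ℝ =>
            z.2 ^ α * (F (dualNorm H z.1, z.2) ^ 2 / (dualNorm H z.1 ^ 2 + z.2 ^ 2)))
          (ae_upperHalfSpace_of_forall fun z hz => by
            have : 0 < z.2 := hz
            positivity)
          (mS.comp h1).aestronglyMeasurable,
          lintegral_upperHalfSpace_comp_dualNorm hn hH
          (f := fun r y => ENNReal.ofReal (y ^ α * (F (r, y) ^ 2 / (r ^ 2 + y ^ 2))))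
          mS.ennreal_ofReal, ENNReal.toReal_mul]
        congr 1
        rw [← ENNReal.toReal_mul]
        congr 1
        calc _ = ∫⁻ r in Ioi (0 : ℝ), ∫⁻ y in Ioi (0 : ℝ),
              ENNReal.ofReal (r ^ (n - 1) * y ^ α * (F (r, y) ^ 2 / (r ^ 2 + y ^ 2))) := by
              refine setLIntegral_congr_fun measurableSet_Ioi fun r hr => ?_
              have hr : 0 < r := hr
              rw [← lintegral_const_mul' _ _ ENNReal.ofReal_ne_top]
              refine lintegral_congr fun y => ?_
              rw [← ENNReal.ofReal_mul (by positivity), mul_assoc]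
          _ = ∫⁻ ρ in Ioi (0 : ℝ), ENNReal.ofReal (φ ρ ^ 2 * ρ ^ (2 * γ - 1)) * X := by
              rw [lintegral_quadrant_hardy hn mF, hpow1]
              refine setLIntegral_congr_fun measurableSet_Ioi fun ρ hρ => ?_
              have hρ : 0 < ρ := hρ
              rw [hX, ← lintegral_const_mul' _ _ ENNReal.ofReal_ne_top]
              refine setLIntegral_congr_fun measurableSet_Ioo fun θ hθ => ?_
              rw [← ENNReal.ofReal_mul (by positivity), hF, testFunction_polar hρ]
              congr 1
              simp only [hg]
              ring
          _ = I * X := lintegral_mul_const' _ _ hXt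
      -- the energy
      have eE : ∫ z in upperHalfSpace n, z.2 ^ α * (fderiv ℝ F (dualNorm H z.1, z.2) (1, 0) ^ 2
          + fderiv ℝ F (dualNorm H z.1, z.2) (0, 1) ^ 2)
          = (sphereConst H).toReal * (I'.toReal * X.toReal + I.toReal * Y.toReal) := by
        have mD1 := (continuous_fderiv_apply hF1 (1, 0)).measurable
        have mD2 := (continuous_fderiv_apply hF1 (0, 1)).measurable
        have mE : Measurable (Function.uncurry fun r y : ℝ =>
            y ^ α * (fderiv ℝ F (r, y) (1, 0) ^ 2 + fderiv ℝ F (r, y) (0, 1) ^ 2)) :=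
          (by fun_prop : Measurable fun p : ℝ × ℝ => p.2 ^ α).mul
            ((mD1.pow_const 2).add (mD2.pow_const 2))
        have h1 : Measurable fun z : EuclideanSpace ℝ (Fin n) × ℝ => (dualNorm H z.1, z.2) := by
          have := (continuous_dualNorm hH).measurable
          fun_prop
        rw [integral_eq_lintegral_of_nonneg_ae
          (f := fun z : EuclideanSpace ℝ (Fin n) × ℝ => z.2 ^ α *
            (fderiv ℝ F (dualNorm H z.1, z.2) (1, 0) ^ 2
              + fderiv ℝ F (dualNorm H z.1, z.2) (0, 1) ^ 2))
          (ae_upperHalfSpace_of_forall fun z hz => by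
            have : 0 < z.2 := hz
            positivity)
          (mE.comp h1).aestronglyMeasurable,
          lintegral_upperHalfSpace_comp_dualNorm hn hH
          (f := fun r y => ENNReal.ofReal
            (y ^ α * (fderiv ℝ F (r, y) (1, 0) ^ 2 + fderiv ℝ F (r, y) (0, 1) ^ 2)))
          mE.ennreal_ofReal, ENNReal.toReal_mul]
        congr 1
        rw [← ENNReal.toReal_mul, ← ENNReal.toReal_mul, ← ENNReal.toReal_add
          (ENNReal.mul_ne_top hI't hXt) (ENNReal.mul_ne_top hIt hYt)]
        congr 1
        calc _ = ∫⁻ r in Ioi (0 : ℝ), ∫⁻ y in Ioi (0 : ℝ), ENNReal.ofReal (r ^ (n - 1) * y ^ α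
              * (fderiv ℝ F (r, y) (1, 0) ^ 2 + fderiv ℝ F (r, y) (0, 1) ^ 2)) := by
              refine setLIntegral_congr_fun measurableSet_Ioi fun r hr => ?_
              have hr : 0 < r := hr
              rw [← lintegral_const_mul' _ _ ENNReal.ofReal_ne_top]
              refine lintegral_congr fun y => ?_
              rw [← ENNReal.ofReal_mul (by positivity), mul_assoc]
          _ = (∫⁻ ρ in Ioi (0 : ℝ), ENNReal.ofReal (deriv φ ρ ^ 2 * ρ ^ (2 * γ + 1)) * X)
              + ∫⁻ ρ in Ioi (0 : ℝ), ENNReal.ofReal (φ ρ ^ 2 * ρ ^ (2 * γ - 1)) * Y := by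
              rw [lintegral_quadrant_energy hn hF1, hpow1, hpow2]
              congr 1
              · refine setLIntegral_congr_fun measurableSet_Ioi fun ρ hρ => ?_
                have hρ : 0 < ρ := hρ
                rw [hX, ← lintegral_const_mul' _ _ ENNReal.ofReal_ne_top]
                refine setLIntegral_congr_fun measurableSet_Ioo fun θ hθ => ?_
                have hw := angWeight_nonneg n α hθ
                rw [← ENNReal.ofReal_mul (by positivity), ← ENNReal.ofReal_mul (by positivity),
                  polarRadial_testFunction hFd (hφ.differentiable (by simp)) hρ]
                congr 1
                simp only [hg]
                ring
              · refine setLIntegral_congr_fun measurableSet_Ioi fun ρ hρ => ?_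
                have hρ : 0 < ρ := hρ
                rw [hY, ← lintegral_const_mul' _ _ ENNReal.ofReal_ne_top]
                refine setLIntegral_congr_fun measurableSet_Ioo fun θ hθ => ?_
                rw [← ENNReal.ofReal_mul (by positivity),
                  polarAngular_testFunction hp hδ hFd hρ]
                congr 1
                simp only [hg']
                ring
          _ = I' * X + I * Y := by
              rw [lintegral_mul_const' _ _ hXt, lintegral_mul_const' _ _ hYt]
      rw [eT, eS, eE] at key
      have hX0 : 0 ≤ X.toReal := ENNReal.toReal_nonneg
      -- Up to `sphereConst`, `key` says C P(δ)² I + (γ-2A)² I X ≤ I' X + I Y. Inserting I' ≤ (γ²+η)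
      -- I cancels the Hardy term and leaves C P(δ)² ≤ Y + λX + ηX.
      have k1 : (sphereConst H).toReal * (I.toReal * (C * P δ ^ 2))
          ≤ (sphereConst H).toReal
            * (I.toReal * (angConst n α A * P 0 ^ 2 + η * X.toReal)) := by
        have h1 : I'.toReal * X.toReal ≤ (γ ^ 2 + η) * I.toReal * X.toReal := by gcongr
        have h2 := mul_le_mul_of_nonneg_left h1 hcpos.le
        have h3 := mul_le_mul_of_nonneg_left hXYr (mul_nonneg hcpos.le hIpos.le)
        rw [hsplit] at h2
        linarith
      exact le_of_mul_le_mul_left (le_of_mul_le_mul_left k1 hcpos) hIpos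
    -- X depends on δ but not on η, so η can tend to 0 while δ is fixed.
    refine le_of_forall_pos_le_add fun ε hε => ?_
    have hX0 : 0 ≤ X.toReal := ENNReal.toReal_nonneg
    refine (almost (ε / (X.toReal + 1)) (by positivity)).trans ?_
    have : ε / (X.toReal + 1) * X.toReal ≤ ε := by
      rw [div_mul_eq_mul_div, div_le_iff₀ (by positivity)]
      nlinarith
    linarith
  -- Finally δ → 0: P is continuous at 0 from the right, and P(0) > 0 permits the division.
  have hlim : Tendsto (fun δ => C * P δ ^ 2) (𝓝[>] 0) (𝓝 (C * P 0 ^ 2)) :=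
    ((hp.tendsto_angProfile_zero.mono_left (nhdsWithin_mono _ Ioi_subset_Ici_self)).pow 2).const_mul
      C
  have hfin : C * P 0 ^ 2 ≤ angConst n α A * P 0 ^ 2 :=
    le_of_tendsto hlim (by filter_upwards [self_mem_nhdsWithin] with δ hδ using step δ hδ)
  exact le_of_mul_le_mul_right hfin (pow_pos (hp.angProfile_pos le_rfl) 2)

end FinslerHardy

/-! ### The theorem, with A = (n+1-b)/4. -/

theorem theorem1 (n : ℕ) (α b : ℝ) (hα : α ∈ Set.Ioo (-1 : ℝ) 1)
    (hb : 2 - α ≤ b) (hbn : b < (n : ℝ) + 1)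
    (H : Seminorm ℝ (EuclideanSpace ℝ (Fin n))) (hH : FinslerHardy.IsFinslerNorm H) :
    -- the inequality, all of whose integrals are finite
    (∀ u : EuclideanSpace ℝ (Fin n) × ℝ → ℝ, ContDiff ℝ ∞ u → HasCompactSupport u →
      Integrable (FinslerHardy.traceDensity H α u) ∧
      IntegrableOn (FinslerHardy.hardyDensity H α u) (FinslerHardy.upperHalfSpace n) ∧
      IntegrableOn (FinslerHardy.energyDensity H α u) (FinslerHardy.upperHalfSpace n) ∧
      FinslerHardy.InterpolationInequality H α b (FinslerHardy.K n α b) u) ∧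
    -- optimality of the constant
    (∀ C : ℝ,
      (∀ u : EuclideanSpace ℝ (Fin n) × ℝ → ℝ, ContDiff ℝ ∞ u → HasCompactSupport u →
        FinslerHardy.InterpolationInequality H α b C u) →
      C ≤ FinslerHardy.K n α b) := by
  have hp := FinslerHardy.angParams_of_hyp hα hb hbn
  have hK := FinslerHardy.angConst_eq_K hα hbn
  have hcoef : (((n : ℝ) + α - 1) / 2 - 2 * ((n + 1 - b) / 4)) ^ 2 = (α + b - 2) ^ 2 / 4 := by ring
  refine ⟨fun u hu huc => ?_, fun C hC => ?_⟩
  · have hu1 : ContDiff ℝ 1 u := hu.of_le (by simp)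
    refine ⟨FinslerHardy.integrable_traceDensity hp hH.definite hu1 huc,
      FinslerHardy.integrableOn_hardyDensity hp hH.definite hu1 huc,
      FinslerHardy.integrableOn_energyDensity hα.1 hu1 huc, ?_⟩
    have h := FinslerHardy.interpolation_inequality hp hH.definite hu1 huc
    rwa [hK, hcoef] at h
  · rw [← hK]
    refine FinslerHardy.le_angConst hp hH.definite fun u hu huc => ?_
    rw [hcoef]
    exact hC u hu huc
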